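/- **Lemma 2.1.** Let $(X,g,J)$ be a Kähler manifold (for instance a closed one): a complex manifold of complex dimension $n$ with complex structure $J$ and a smooth Riemannian metric $g$ such that $g(J\cdot,J\cdot)=g$, whose fundamental form $\omega=g(J\cdot,\cdot)$ satisfies $d\omega=0$. Let $\Omega^{*,*}(X)$ be the algebra of smooth complex-valued differential forms on $X$ with the wedge product, $\mathbb Z_2$-graded by total degree mod $2$; write $|a|$ for the degree of a homogeneous element $a$. Let $d=\partial+\bar\partial$ be the usual decomposition, and let $\partial^*=-*\bar\partial*$ be the formal adjoint of $\partial$, where $*$ is the $\mathbb C$-linear Hodge star operator of $g$ (with volume form $\omega^n/n!$). For homogeneous $a$ and arbitrary $b$ put $$[a\bullet b]_{\partial^*}=(-1)^{|a|}\bigl(\partial^*(a\wedge b)-\partial^*a\wedge b-(-1)^{|a|}a\wedge\partial^*b\bigr).$$ Then for all homogeneous $a,b\in\Omega^{*,*}(X)$ and all $c\in\Omega^{*,*}(X)$, $$[a\bullet(b\wedge c)]_{\partial^*}=[a\bullet b]_{\partial^*}\wedge c+(-1)^{(|a|+1)|b|}\,b\wedge[a\bullet c]_{\partial^*}.$$ Moreover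 $(\Omega^{*,*}(X),\wedge,\delta=\bar\partial,\Delta=\partial^*)$ is a dGBV algebra over $\mathbb C$. That is, $\Omega^{*,*}(X)$ is an associative supercommutative $\mathbb Z_2$-graded algebra with identity ($a\wedge b=(-1)^{|a||b|}b\wedge a$ for homogeneous $a,b$); $\delta$ and $\Delta$ are $\mathbb C$-linear maps of odd degree from $\Omega^{*,*}(X)$ to itself with $\delta^2=0$, $\delta\Delta+\Delta\delta=0$ and $\Delta^2=0$; $\delta(a\wedge b)=\delta a\wedge b+(-1)^{|a|}a\wedge\delta b$ for homogeneous $a$; and, for homogeneous $a$, the map $[a\bullet\cdot\,]_{\partial^*}$ is a derivation of degree $|a|+1$, i.e. it shifts degrees by $|a|+1$ and satisfies the identity above. -/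

import Mathlib

open scoped Manifold ContDiff

noncomputable section

/-! ### Differential Gerstenhaber-Batalin-Vilkovisky algebras -/

section DGBV

variable {k : Type*} [Field k] {A : Type*} [Ring A] [Algebra k A]

/-- The bracket `[a • b] = (-1)^|a| (Δ(a ∧ b) - Δa ∧ b - (-1)^|a| a ∧ Δb)` generated by an
operator `Δ`, for an element `a` of parity `|a| = i`. -/
def bvBracket (k : Type*) [Field k] {A : Type*} [Ring A] [Algebra k A]
    (Δ : A → A) (i : ZMod 2) (a b : A) : A :=
  (-1 : k) ^ i.val • (Δ (a * b) - Δ a * b - (-1 : k) ^ i.val • (a * Δ b))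

/-- `(A, 𝒜, δ, Δ)` is a dGBV algebra over `k`: `A = 𝒜 0 ⊕ 𝒜 1` is a supercommutative algebra
with identity (associative and unital by `[Ring A] [Algebra k A]`), and `δ`, `Δ` are odd linear
maps with the properties listed. -/
structure IsDGBVAlgebra (𝒜 : ZMod 2 → Submodule k A) (δ Δ : A →ₗ[k] A) : Prop where
  one_mem : (1 : A) ∈ 𝒜 0
  mul_mem : ∀ i j : ZMod 2, ∀ a ∈ 𝒜 i, ∀ b ∈ 𝒜 j, a * b ∈ 𝒜 (i + j)
  isInternal : DirectSum.IsInternal 𝒜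
  supercomm : ∀ i j : ZMod 2, ∀ a ∈ 𝒜 i, ∀ b ∈ 𝒜 j, a * b = (-1 : k) ^ (i * j).val • (b * a)
  δ_odd : ∀ i : ZMod 2, ∀ a ∈ 𝒜 i, δ a ∈ 𝒜 (i + 1)
  Δ_odd : ∀ i : ZMod 2, ∀ a ∈ 𝒜 i, Δ a ∈ 𝒜 (i + 1)
  δ_δ : ∀ a : A, δ (δ a) = 0
  δ_Δ : ∀ a : A, δ (Δ a) + Δ (δ a) = 0
  Δ_Δ : ∀ a : A, Δ (Δ a) = 0
  δ_mul : ∀ i : ZMod 2, ∀ a ∈ 𝒜 i, ∀ b : A,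
    δ (a * b) = δ a * b + (-1 : k) ^ i.val • (a * δ b)
  bracket_mem : ∀ i j : ZMod 2, ∀ a ∈ 𝒜 i, ∀ b ∈ 𝒜 j,
    bvBracket k Δ i a b ∈ 𝒜 ((i + 1) + j)
  bracket_mul : ∀ i j : ZMod 2, ∀ a ∈ 𝒜 i, ∀ b ∈ 𝒜 j, ∀ c : A,
    bvBracket k Δ i a (b * c) =
      bvBracket k Δ i a b * c + (-1 : k) ^ ((i + 1) * j).val • (b * bvBracket k Δ i a c)

end DGBV

/-! ### Complex-valued exterior forms on a complex vector space -/

section LinearAlgebra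

/-- The exterior algebra over `ℂ` of the space `Hom_ℝ(V, ℂ) = V* ⊗ ℂ` of complex-valued real
covectors of a complex vector space `V`; its product is the wedge product. -/
abbrev CForm (V : Type*) [AddCommGroup V] [Module ℂ V] : Type _ :=
  ExteriorAlgebra ℂ (V →ₗ[ℝ] ℂ)

variable {V : Type*} [AddCommGroup V] [Module ℂ V] {W : Type*} [AddCommGroup W] [Module ℂ W]

/-- A covector as a form of degree one. -/
def oneForm : (V →ₗ[ℝ] ℂ) →ₗ[ℂ] CForm V := ExteriorAlgebra.ι ℂ

/-- A real covector as a form of degree one. -/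
def realOneForm (ξ : V →ₗ[ℝ] ℝ) : CForm V :=
  oneForm (Complex.ofRealCLM.toLinearMap ∘ₗ ξ)

/-- Pullback of exterior forms along a `ℂ`-linear map. -/
def pullForm (f : V →ₗ[ℂ] W) : CForm W →ₐ[ℂ] CForm V :=
  ExteriorAlgebra.map (LinearMap.lcomp ℂ ℂ (f.restrictScalars ℝ))

/-- The forms of even total degree (`i = 0`) or of odd total degree (`i = 1`). -/
def formParity (V : Type*) [AddCommGroup V] [Module ℂ V] (i : ZMod 2) :
    Submodule ℂ (CForm V) :=
  CliffordAlgebra.evenOdd (0 : QuadraticForm ℂ (V →ₗ[ℝ] ℂ)) i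

instance finite_real_of_finite_complex [Module.Finite ℂ V] : Module.Finite ℝ V :=
  Module.Finite.trans ℂ V

instance finite_covectors [Module.Finite ℂ V] : Module.Finite ℂ (V →ₗ[ℝ] ℂ) :=
  Module.Finite.of_restrictScalars_finite ℝ ℂ _

instance finite_cForm [Module.Finite ℂ V] : Module.Finite ℂ (CForm V) :=
  Module.Finite.of_basis (Module.finBasis ℂ (V →ₗ[ℝ] ℂ)).ExteriorAlgebra

variable [Module.Finite ℂ V]

/-- The Gram matrix `g_{jl}` of a real bilinear form in a real basis of `V`. -/
def gramMatrix (g : V →ₗ[ℝ] V →ₗ[ℝ] ℝ) :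
    Matrix (Fin (Module.finrank ℝ V)) (Fin (Module.finrank ℝ V)) ℝ :=
  Matrix.of fun j l => g (Module.finBasis ℝ V j) (Module.finBasis ℝ V l)

/-- The metric induced by `g` on covectors, extended `ℂ`-bilinearly:
`(ξ, η) ↦ ∑ g^{jl} ξ_j η_l`, where `g^{jl}` is the inverse of the Gram matrix. -/
def cometric (g : V →ₗ[ℝ] V →ₗ[ℝ] ℝ) : (V →ₗ[ℝ] ℂ) →ₗ[ℂ] Module.Dual ℂ (V →ₗ[ℝ] ℂ) :=
  LinearMap.mk₂ ℂ
    (fun ξ η => ∑ j, ∑ l, (((gramMatrix g)⁻¹ j l : ℝ) : ℂ) *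
      (ξ (Module.finBasis ℝ V j) * η (Module.finBasis ℝ V l)))
    (fun ξ ξ' η => by simp [add_mul, mul_add, Finset.sum_add_distrib])
    (fun c ξ η => by
      simp only [LinearMap.smul_apply, smul_eq_mul, Finset.mul_sum]
      exact Finset.sum_congr rfl fun j _ => Finset.sum_congr rfl fun l _ => by ring)
    (fun ξ η η' => by simp [mul_add, Finset.sum_add_distrib])
    (fun c ξ η => by
      simp only [LinearMap.smul_apply, smul_eq_mul, Finset.mul_sum]
      exact Finset.sum_congr rfl fun j _ => Finset.sum_congr rfl fun l _ => by ring)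

/-- Iterated contraction: `contractAll g (ξ₁ ∧ ⋯ ∧ ξₖ) = ι(ξ₁♯) ∘ ⋯ ∘ ι(ξₖ♯)`, where `ξ♯` is the
(complex) tangent vector dual to the covector `ξ` with respect to `g` and `ι` denotes the
interior product. -/
def contractAll (g : V →ₗ[ℝ] V →ₗ[ℝ] ℝ) : CForm V →ₐ[ℂ] Module.End ℂ (CForm V) :=
  ExteriorAlgebra.lift ℂ ⟨CliffordAlgebra.contractLeft ∘ₗ cometric g, fun ξ =>
    LinearMap.ext fun α => CliffordAlgebra.contractLeft_contractLeft (cometric g ξ) α⟩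

/-- The fundamental form `ω(u, v) = g(Ju, v)`, where `J` is multiplication by `i`, written as
`ω = 1/2 ∑ e^j ∧ g(J e_j, ·)` in a real basis `e_j` of `V` with dual basis `e^j`. -/
def fundamentalForm (g : V →ₗ[ℝ] V →ₗ[ℝ] ℝ) : CForm V :=
  (1 / 2 : ℂ) • ∑ j, realOneForm ((Module.finBasis ℝ V).coord j) *
    realOneForm (g (Complex.I • Module.finBasis ℝ V j))

/-- The volume form `ω^n / n!`, with `n = dim_ℂ V`. -/
def volForm (g : V →ₗ[ℝ] V →ₗ[ℝ] ℝ) : CForm V :=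
  (1 / (Nat.factorial (Module.finrank ℂ V)) : ℂ) •
    fundamentalForm g ^ Module.finrank ℂ V

/-- The `ℂ`-linear Hodge star operator: `*(ξ₁ ∧ ⋯ ∧ ξₖ) = ι(ξₖ♯) ⋯ ι(ξ₁♯) vol`. On an oriented
`g`-orthonormal coframe `e^1, …, e^{2n}` it is given by `*(e^I) = e^L`, where `L` is the
complement of `I`, ordered so that `e^I ∧ e^L = vol`. -/
def hodgeStar (g : V →ₗ[ℝ] V →ₗ[ℝ] ℝ) (α : CForm V) : CForm V :=
  contractAll g (CliffordAlgebra.reverse α) (volForm g)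

end LinearAlgebra

/-! ### The operators `∂` and `∂̄` in linear coordinates -/

section Local

variable {E : Type*} [NormedAddCommGroup E] [NormedSpace ℂ E] [Module.Finite ℂ E]

/-- The directional derivative at `y` along `v` of a map into a finite-dimensional complex vector
space, taken coefficientwise in a basis. -/
def dirDeriv {F : Type*} [AddCommGroup F] [Module ℂ F] [Module.Finite ℂ F]
    (f : E → F) (y v : E) : F :=
  ∑ j, fderiv ℝ (fun z => (Module.finBasis ℂ F).repr (f z) j) y v • Module.finBasis ℂ F j

/-- The constant one-form `dz_j`, where `z_j` are linear complex coordinates on `E`. -/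
def dz (E : Type*) [NormedAddCommGroup E] [NormedSpace ℂ E] [Module.Finite ℂ E]
    (j : Fin (Module.finrank ℂ E)) : CForm E :=
  oneForm (((Module.finBasis ℂ E).coord j).restrictScalars ℝ)

/-- The constant one-form `dz̄_j`. -/
def dzBar (E : Type*) [NormedAddCommGroup E] [NormedSpace ℂ E] [Module.Finite ℂ E]
    (j : Fin (Module.finrank ℂ E)) : CForm E :=
  oneForm (Complex.conjAe.toLinearMap ∘ₗ ((Module.finBasis ℂ E).coord j).restrictScalars ℝ)

/-- `∂α/∂z_j = 1/2 (∂α/∂x_j - i ∂α/∂y_j)`. -/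
def wirtinger (α : E → CForm E) (y : E) (j : Fin (Module.finrank ℂ E)) : CForm E :=
  (1 / 2 : ℂ) • (dirDeriv α y (Module.finBasis ℂ E j) -
    Complex.I • dirDeriv α y (Complex.I • Module.finBasis ℂ E j))

/-- `∂α/∂z̄_j = 1/2 (∂α/∂x_j + i ∂α/∂y_j)`. -/
def wirtingerBar (α : E → CForm E) (y : E) (j : Fin (Module.finrank ℂ E)) : CForm E :=
  (1 / 2 : ℂ) • (dirDeriv α y (Module.finBasis ℂ E j) +
    Complex.I • dirDeriv α y (Complex.I • Module.finBasis ℂ E j))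

/-- `∂α = ∑ dz_j ∧ ∂α/∂z_j`. -/
def localDel (α : E → CForm E) (y : E) : CForm E := ∑ j, dz E j * wirtinger α y j

/-- `∂̄α = ∑ dz̄_j ∧ ∂α/∂z̄_j`. -/
def localDelBar (α : E → CForm E) (y : E) : CForm E := ∑ j, dzBar E j * wirtingerBar α y j

end Local

/-! ### Forms on a complex manifold -/

section Manifold

variable (E : Type*) [NormedAddCommGroup E] [NormedSpace ℂ E] [Module.Finite ℂ E]
  (X : Type*) [TopologicalSpace X] [ChartedSpace E X]

instance finite_tangentSpace (x : X) : Module.Finite ℂ (TangentSpace 𝓘(ℂ, E) x) :=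
  inferInstanceAs (Module.Finite ℂ E)

/-- Complex-valued differential forms on `X` (of mixed degree, without any regularity), with the
pointwise algebra structure; the product is the wedge product. -/
abbrev RawForm : Type _ := ∀ x : X, CForm (TangentSpace 𝓘(ℂ, E) x)

variable {E X}

/-- The differential at `y` of the inverse of a chart. -/
def chartSymmDeriv (φ : OpenPartialHomeomorph X E) (y : E) :
    E →ₗ[ℂ] TangentSpace 𝓘(ℂ, E) (φ.symm y) :=
  (mfderiv 𝓘(ℂ, E) 𝓘(ℂ, E) φ.symm y).toLinearMap

/-- The differential at `x` of a chart. -/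
def chartDeriv (φ : OpenPartialHomeomorph X E) (x : X) :
    TangentSpace 𝓘(ℂ, E) x →ₗ[ℂ] E :=
  (mfderiv 𝓘(ℂ, E) 𝓘(ℂ, E) φ x).toLinearMap

/-- The expression `(φ⁻¹)^* α` of a form in a chart `φ`. -/
def inChart (φ : OpenPartialHomeomorph X E) (α : RawForm E X) (y : E) : CForm E :=
  pullForm (chartSymmDeriv φ y) (α (φ.symm y))

/-- A form is smooth if in every chart all of its coefficients are (real) smooth functions. -/
def IsSmoothForm (α : RawForm E X) : Prop :=
  ∀ φ ∈ atlas E X, ∀ l : Module.Dual ℂ (CForm E),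
    ContDiffOn ℝ ∞ (fun y => l (inChart φ α y)) φ.target

/-- The operator `∂` on forms, computed at `x` in the preferred holomorphic chart at `x`. -/
def del (α : RawForm E X) : RawForm E X := fun x =>
  pullForm (chartDeriv (chartAt E x) x)
    (localDel (inChart (chartAt E x) α) (chartAt E x x))

/-- The operator `∂̄` on forms, computed at `x` in the preferred holomorphic chart at `x`. -/
def delBar (α : RawForm E X) : RawForm E X := fun x =>
  pullForm (chartDeriv (chartAt E x) x)
    (localDelBar (inChart (chartAt E x) α) (chartAt E x x))

theorem IsSmoothForm.mul {α β : RawForm E X} (hα : IsSmoothForm α) (hβ : IsSmoothForm β) :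
    IsSmoothForm (α * β) := by
  intro φ hφ l
  let B := Module.finBasis ℂ (CForm E)
  have key : (fun y => l (inChart φ (α * β) y)) = fun y => ∑ i, ∑ j,
      (B.coord i (inChart φ α y) * B.coord j (inChart φ β y)) * l (B i * B j) := by
    funext y
    have h1 : inChart φ (α * β) y = inChart φ α y * inChart φ β y := by
      simp [inChart]
    rw [h1]
    conv_lhs => rw [← B.sum_repr (inChart φ α y), ← B.sum_repr (inChart φ β y)]
    simp only [Finset.sum_mul_sum, map_sum, smul_mul_smul_comm, map_smul, smul_eq_mul,
      Module.Basis.coord_apply]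
  rw [key]
  exact ContDiffOn.sum fun i _ => ContDiffOn.sum fun j _ =>
    ((hα φ hφ (B.coord i)).mul (hβ φ hφ (B.coord j))).mul contDiffOn_const

variable (E X) in
/-- The algebra `Ω^{*,*}(X)` of smooth complex-valued differential forms on `X`. -/
def SmoothForms : Subalgebra ℂ (RawForm E X) where
  carrier := {α | IsSmoothForm α}
  mul_mem' := IsSmoothForm.mul
  add_mem' := by
    intro α β hα hβ φ hφ l
    simpa [inChart] using (hα φ hφ l).add (hβ φ hφ l)
  algebraMap_mem' := by
    intro c φ hφ l
    simpa [inChart] using contDiffOn_const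

variable (E X) in
/-- The smooth forms of even total degree (`i = 0`) or of odd total degree (`i = 1`). -/
def smoothFormParity (i : ZMod 2) : Submodule ℂ (SmoothForms E X) where
  carrier := {α | ∀ x, α.1 x ∈ formParity (TangentSpace 𝓘(ℂ, E) x) i}
  add_mem' := fun hα hβ x => add_mem (hα x) (hβ x)
  zero_mem' := fun _ => zero_mem _
  smul_mem' := fun c _ hα x => Submodule.smul_mem _ c (hα x)

variable (E X) in
/-- A smooth Hermitian metric on `X`: a smooth Riemannian metric `g` with `g(Ju, Jv) = g(u, v)`. -/
structure HermitianMetric where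
  inner : ∀ x : X, TangentSpace 𝓘(ℂ, E) x →ₗ[ℝ] TangentSpace 𝓘(ℂ, E) x →ₗ[ℝ] ℝ
  symm : ∀ x u v, inner x u v = inner x v u
  pos : ∀ x u, u ≠ 0 → 0 < inner x u u
  inner_J : ∀ x u v, inner x (Complex.I • u) (Complex.I • v) = inner x u v
  smooth : ∀ φ ∈ atlas E X, ∀ u v : E, ContDiffOn ℝ ∞ (fun y =>
    inner (φ.symm y) (chartSymmDeriv φ y u) (chartSymmDeriv φ y v)) φ.target

variable (g : HermitianMetric E X)

/-- The fundamental form `ω` of a Hermitian metric. -/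
def kahlerForm : RawForm E X := fun x => fundamentalForm (g.inner x)

/-- A Hermitian metric is Kähler if `dω = 0`, where `d = ∂ + ∂̄`. -/
def IsKahler : Prop := del (kahlerForm g) + delBar (kahlerForm g) = 0

/-- The pointwise Hodge star operator of a Hermitian metric. -/
def hodge (α : RawForm E X) : RawForm E X := fun x => hodgeStar (g.inner x) (α x)

/-- The formal adjoint `∂^* = - * ∂̄ *` of `∂` (with the `ℂ`-linear Hodge star). -/
def delStar (α : RawForm E X) : RawForm E X := -hodge g (delBar (hodge g α))

end Manifold

end

/-! Write ι_ξ for the interior product with the vector metrically dual to a covector ξ. Pure linear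
algebra gives *(ξ ∧ *x) = ι_ξ x (`hodgeStarLin_oneForm_mul_hodgeStarLin`). So at a point where the
star operator has zero derivative, ∂* = -*∂̄* becomes -∑ ι(dz̄_j) ∘ ∂/∂z̄_j. The Kähler condition
makes this formula available at every point: closedness of ω is exactly what allows a quadratic
holomorphic change of coordinates, tangent to the identity, after which the metric is constant to
first order (`exists_quadratic_correction`, `exists_isOsculating`). Since ∂̄ commutes with
holomorphic pullback (`localDelBar_pullAlong`) and star is natural under linear isomorphisms, the
formula may be read in those coordinates.

Two facts follow. First, each summand composes an odd derivation of the wedge product (a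
contraction) with an even one (a partial derivative). Its failure to be a derivation is therefore a
sum of terms ± ∂_j a ∧ ι_j b + ι_j a ∧ ∂_j b, and each of these is of first order in b. Hence the
bracket with a is a derivation (`bracket_mul_at`, `IsKahler.bvBracket_mul`). Second, let C be
contraction with ω. For a covector ξ of type (0,1) one has ι_ξ = i[C, ξ ∧ ·]
(`sharpProd_eq_commutator`). Summing over ξ = dz̄_j gives the Kähler identity ∂* = -i[C, ∂̄]
(`IsKahler.delStar_eq`), and with ∂̄² = 0 the anticommutation of ∂̄ and ∂* is immediate.

The rest is formal. (∂*)² = 0 follows from ** = (-1)^deg and ∂̄² = 0. Parities are the eigenspaces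
of the involution `signForm`, so statements about degree become equations. Regularity is handled
once for an arbitrary algebra of coefficient functions (`Regular`): the same argument shows that
star is smooth when the metric is, and stationary at a point when the metric is. -/

noncomputable section

/-! ### Exterior algebra: grading involution, reversal, interior products, pullback -/

section Algebra

variable {V : Type*} [AddCommGroup V] [Module ℂ V] {W : Type*} [AddCommGroup W] [Module ℂ W]

theorem CForm.induction {P : CForm V → Prop} (algebraMap : ∀ r : ℂ, P (algebraMap ℂ _ r))
    (add : ∀ x y, P x → P y → P (x + y))
    (oneForm_mul : ∀ ξ x, P x → P (oneForm ξ * x)) (x : CForm V) : P x :=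
  CliffordAlgebra.left_induction (Q := (0 : QuadraticForm ℂ (V →ₗ[ℝ] ℂ))) algebraMap
    (fun x y hx hy => add x y hx hy) (fun x ξ hx => oneForm_mul ξ x hx) x

/-- The automorphism equal to `(-1)^k` on forms of degree `k`. -/
def signForm : CForm V →ₐ[ℂ] CForm V :=
  CliffordAlgebra.involute (Q := (0 : QuadraticForm ℂ (V →ₗ[ℝ] ℂ)))

/-- The anti-automorphism reversing the order of the factors. -/
def revForm : CForm V →ₗ[ℂ] CForm V :=
  CliffordAlgebra.reverse (Q := (0 : QuadraticForm ℂ (V →ₗ[ℝ] ℂ)))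

/-- The interiorProd product with a complex tangent vector, given as a functional on covectors. -/
def interiorProd (d : Module.Dual ℂ (V →ₗ[ℝ] ℂ)) : CForm V →ₗ[ℂ] CForm V :=
  CliffordAlgebra.contractLeft (Q := (0 : QuadraticForm ℂ (V →ₗ[ℝ] ℂ))) d

@[simp] theorem signForm_oneForm (ξ : V →ₗ[ℝ] ℂ) : signForm (oneForm ξ) = -oneForm ξ :=
  CliffordAlgebra.involute_ι _

@[simp] theorem signForm_signForm (x : CForm V) : signForm (signForm x) = x :=
  CliffordAlgebra.involute_involute x

@[simp] theorem revForm_oneForm (ξ : V →ₗ[ℝ] ℂ) : revForm (oneForm ξ) = oneForm ξ :=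
  CliffordAlgebra.reverse_ι _

@[simp] theorem revForm_algebraMap (r : ℂ) :
    revForm (algebraMap ℂ (CForm V) r) = algebraMap ℂ (CForm V) r :=
  CliffordAlgebra.reverse.commutes r

@[simp] theorem revForm_one : revForm (1 : CForm V) = 1 :=
  CliffordAlgebra.reverse.map_one

@[simp] theorem revForm_mul (x y : CForm V) : revForm (x * y) = revForm y * revForm x :=
  CliffordAlgebra.reverse.map_mul x y

theorem revForm_signForm (x : CForm V) : revForm (signForm x) = signForm (revForm x) :=
  CliffordAlgebra.reverse_involute x

theorem revForm_pow (x : CForm V) (k : ℕ) : revForm (x ^ k) = revForm x ^ k := by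
  induction k with
  | zero => simp
  | succ k ih => rw [pow_succ, revForm_mul, ih, ← pow_succ']

theorem interiorProd_oneForm_mul (d : Module.Dual ℂ (V →ₗ[ℝ] ℂ)) (ξ : V →ₗ[ℝ] ℂ) (x : CForm V) :
    interiorProd d (oneForm ξ * x) = d ξ • x - oneForm ξ * interiorProd d x :=
  CliffordAlgebra.contractLeft_ι_mul d ξ x

@[simp] theorem interiorProd_algebraMap (d : Module.Dual ℂ (V →ₗ[ℝ] ℂ)) (r : ℂ) :
    interiorProd d (algebraMap ℂ (CForm V) r) = 0 :=
  CliffordAlgebra.contractLeft_algebraMap _ d r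

@[simp] theorem interiorProd_one (d : Module.Dual ℂ (V →ₗ[ℝ] ℂ)) :
    interiorProd d (1 : CForm V) = 0 :=
  CliffordAlgebra.contractLeft_one _ d

@[simp] theorem interiorProd_oneForm (d : Module.Dual ℂ (V →ₗ[ℝ] ℂ)) (ξ : V →ₗ[ℝ] ℂ) :
    interiorProd d (oneForm ξ) = algebraMap ℂ (CForm V) (d ξ) :=
  CliffordAlgebra.contractLeft_ι _ d ξ

/-- The involution records the sign of moving a covector past a form, so signs can be tracked
without splitting forms into homogeneous pieces. -/
theorem oneForm_mul_eq_signForm_mul (ξ : V →ₗ[ℝ] ℂ) (x : CForm V) :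
    oneForm ξ * x = signForm x * oneForm ξ := by
  induction x using CForm.induction with
  | algebraMap r => rw [AlgHom.commutes]; exact (Algebra.commutes r (oneForm ξ)).symm
  | add x y hx hy => rw [mul_add, hx, hy, map_add, add_mul]
  | oneForm_mul η x hx =>
    have h : oneForm ξ * oneForm η = -(oneForm η * oneForm ξ) :=
      eq_neg_of_add_eq_zero_left (ExteriorAlgebra.ι_add_mul_swap ξ η)
    rw [← mul_assoc, h, neg_mul, mul_assoc, hx, map_mul, signForm_oneForm]
    simp [mul_assoc]

theorem mul_oneForm_eq (ξ : V →ₗ[ℝ] ℂ) (x : CForm V) :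
    x * oneForm ξ = oneForm ξ * signForm x := by
  rw [oneForm_mul_eq_signForm_mul, signForm_signForm]

theorem oneForm_mul_oneForm (ξ η : V →ₗ[ℝ] ℂ) :
    oneForm ξ * oneForm η = -(oneForm η * oneForm ξ) := by
  rw [oneForm_mul_eq_signForm_mul, signForm_oneForm, neg_mul]

theorem interiorProd_mul (d : Module.Dual ℂ (V →ₗ[ℝ] ℂ)) (x y : CForm V) :
    interiorProd d (x * y) = interiorProd d x * y + signForm x * interiorProd d y := by
  induction x using CForm.induction with
  | algebraMap r => simp [← Algebra.smul_def]
  | add x x' hx hx' => simp only [add_mul, map_add, hx, hx']; abel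
  | oneForm_mul ξ x hx =>
    rw [mul_assoc, interiorProd_oneForm_mul, hx, interiorProd_oneForm_mul, map_mul, signForm_oneForm]
    simp only [mul_add, sub_mul, smul_mul_assoc, neg_mul, mul_assoc]
    abel

theorem signForm_interiorProd (d : Module.Dual ℂ (V →ₗ[ℝ] ℂ)) (x : CForm V) :
    signForm (interiorProd d x) = -interiorProd d (signForm x) := by
  induction x using CForm.induction with
  | algebraMap r => simp
  | add x x' hx hx' => simp only [map_add, hx, hx']; abel
  | oneForm_mul ξ x hx =>
    rw [interiorProd_oneForm_mul, map_sub, map_smul, map_mul, hx, map_mul, signForm_oneForm, neg_mul, neg_mul,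
      map_neg, interiorProd_oneForm_mul]
    simp

/-- Reversal sends a leading covector to the far end, where contraction reaches it only after
passing all the other factors; the involution and the minus sign account for that passage. -/
theorem interiorProd_revForm (d : Module.Dual ℂ (V →ₗ[ℝ] ℂ)) (x : CForm V) :
    interiorProd d (revForm x) = -revForm (interiorProd d (signForm x)) := by
  induction x using CForm.induction with
  | algebraMap r => simp
  | add x x' hx hx' => simp only [map_add, hx, hx']; abel
  | oneForm_mul ξ x hx =>
    rw [revForm_mul, revForm_oneForm, interiorProd_mul, hx, map_mul, signForm_oneForm, neg_mul,
      neg_mul, map_neg, interiorProd_oneForm_mul, interiorProd_oneForm, map_neg, map_sub, map_smul, revForm_mul,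
      revForm_oneForm, revForm_signForm]
    rw [← Algebra.commutes, ← Algebra.smul_def]
    abel

theorem ZMod.two_eq_zero_or_one : ∀ i : ZMod 2, i = 0 ∨ i = 1 := by decide

/-- The involution acts by +1 on the even part and by -1 on the odd part, and these two are
complementary. Every later statement about parity is proved through this equation. -/
theorem mem_formParity_iff (i : ZMod 2) (x : CForm V) :
    x ∈ formParity V i ↔ signForm x = (-1 : ℂ) ^ i.val • x := by
  have h0 : ∀ y ∈ formParity V 0, signForm y = y := fun y hy =>
    CliffordAlgebra.involute_eq_of_mem_even hy
  have h1 : ∀ y ∈ formParity V 1, signForm y = -y := fun y hy =>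
    CliffordAlgebra.involute_eq_of_mem_odd hy
  have hx : x ∈ formParity V 0 ⊔ formParity V 1 := by
    have : IsCompl (formParity V 0) (formParity V 1) := CliffordAlgebra.evenOdd_isCompl _
    rw [this.sup_eq_top]; trivial
  obtain ⟨y, hy, z, hz, rfl⟩ := Submodule.mem_sup.1 hx
  have key : ∀ u : CForm V, u = -u → u = 0 := fun u hu => by
    have h2 : (2 : ℂ) • u = 0 := by rw [two_smul]; nth_rw 1 [hu]; exact neg_add_cancel u
    exact (smul_eq_zero.1 h2).resolve_left two_ne_zero
  rcases ZMod.two_eq_zero_or_one i with rfl | rfl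
  · rw [ZMod.val_zero, pow_zero, one_smul]
    refine ⟨fun h => h0 _ h, fun h => ?_⟩
    rw [map_add, h0 y hy, h1 z hz] at h
    have : z = 0 := key z (add_left_cancel h).symm
    simpa [this] using hy
  · rw [ZMod.val_one, pow_one, neg_one_smul]
    refine ⟨fun h => h1 _ h, fun h => ?_⟩
    rw [map_add, h0 y hy, h1 z hz, neg_add] at h
    have : y = 0 := key y (add_right_cancel h)
    simpa [this] using hz

theorem mul_eq_of_signForm_eq_self {y : CForm V} (hy : signForm y = y) (x : CForm V) :
    x * y = y * x := by
  induction x using CForm.induction with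
  | algebraMap r => exact Algebra.commutes r y
  | add x x' hx hx' => rw [add_mul, mul_add, hx, hx']
  | oneForm_mul ξ x hx => rw [mul_assoc, hx, ← mul_assoc, oneForm_mul_eq_signForm_mul, hy, mul_assoc]

theorem mul_eq_of_signForm_eq_neg {y : CForm V} (hy : signForm y = -y) (x : CForm V) :
    x * y = y * signForm x := by
  induction x using CForm.induction with
  | algebraMap r => simpa using Algebra.commutes r y
  | add x x' hx hx' => rw [add_mul, map_add, mul_add, hx, hx']
  | oneForm_mul ξ x hx =>
    rw [mul_assoc, hx, ← mul_assoc, oneForm_mul_eq_signForm_mul, hy, map_mul, signForm_oneForm]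
    simp [mul_assoc]

theorem formParity_supercomm {i j : ZMod 2} {x y : CForm V} (hx : x ∈ formParity V i)
    (hy : y ∈ formParity V j) : x * y = (-1 : ℂ) ^ (i * j).val • (y * x) := by
  rw [mem_formParity_iff] at hx hy
  rcases ZMod.two_eq_zero_or_one j with rfl | rfl
  · rw [mul_eq_of_signForm_eq_self (by simpa using hy)]
    simp
  · rw [mul_eq_of_signForm_eq_neg (by simpa [ZMod.val_one] using hy), hx]
    simp

/-! ### Pullback -/

@[simp] theorem pullForm_oneForm (f : V →ₗ[ℂ] W) (ξ : W →ₗ[ℝ] ℂ) :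
    pullForm f (oneForm ξ) = oneForm (ξ ∘ₗ f.restrictScalars ℝ) :=
  ExteriorAlgebra.map_apply_ι _ _

theorem pullForm_id (x : CForm V) : pullForm LinearMap.id x = x := by
  induction x using CForm.induction with
  | algebraMap r => simp
  | add x x' hx hx' => rw [map_add, hx, hx']
  | oneForm_mul ξ x hx => rw [map_mul, hx, pullForm_oneForm]; rfl

theorem pullForm_comp {U : Type*} [AddCommGroup U] [Module ℂ U] (f : V →ₗ[ℂ] W) (h : U →ₗ[ℂ] V)
    (x : CForm W) : pullForm (f ∘ₗ h) x = pullForm h (pullForm f x) := by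
  induction x using CForm.induction with
  | algebraMap r => simp
  | add x x' hx hx' => simp only [map_add, hx, hx']
  | oneForm_mul ξ x hx => simp only [map_mul, hx, pullForm_oneForm]; rfl

theorem signForm_pullForm (f : V →ₗ[ℂ] W) (x : CForm W) :
    signForm (pullForm f x) = pullForm f (signForm x) := by
  induction x using CForm.induction with
  | algebraMap r => simp
  | add x x' hx hx' => simp only [map_add, hx, hx']
  | oneForm_mul ξ x hx => simp [hx]

theorem revForm_pullForm (f : V →ₗ[ℂ] W) (x : CForm W) :
    revForm (pullForm f x) = pullForm f (revForm x) := by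
  induction x using CForm.induction with
  | algebraMap r => simp
  | add x x' hx hx' => simp only [map_add, hx, hx']
  | oneForm_mul ξ x hx => simp [hx]

theorem pullForm_interiorProd (f : V →ₗ[ℂ] W) (d : Module.Dual ℂ (V →ₗ[ℝ] ℂ))
    (d' : Module.Dual ℂ (W →ₗ[ℝ] ℂ))
    (h : ∀ ξ : W →ₗ[ℝ] ℂ, d (ξ ∘ₗ f.restrictScalars ℝ) = d' ξ) (x : CForm W) :
    pullForm f (interiorProd d' x) = interiorProd d (pullForm f x) := by
  induction x using CForm.induction with
  | algebraMap r => simp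
  | add x x' hx hx' => simp only [map_add, hx, hx']
  | oneForm_mul ξ x hx =>
    rw [interiorProd_oneForm_mul, map_sub, map_mul, map_mul, map_smul, hx, pullForm_oneForm,
      interiorProd_oneForm_mul, h]

end Algebra

/-! ### Hermitian linear algebra: dual vectors, contraction, the star operator -/

section Metric

variable {V : Type*} [AddCommGroup V] [Module ℂ V]

/-- A positive definite symmetric real bilinear form invariant under multiplication by `i`. -/
structure IsHermitianForm (g : V →ₗ[ℝ] V →ₗ[ℝ] ℝ) : Prop where
  symm : ∀ u v, g u v = g v u
  pos : ∀ u, u ≠ 0 → 0 < g u u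
  inner_J : ∀ u v, g (Complex.I • u) (Complex.I • v) = g u v

/-- Multiplication by `i` as a real linear map. -/
def jMap (V : Type*) [AddCommGroup V] [Module ℂ V] : V →ₗ[ℝ] V :=
  (LinearMap.lsmul ℂ V Complex.I).restrictScalars ℝ

@[simp] theorem jMap_apply (v : V) : jMap V v = Complex.I • v := rfl

/-- The complex-valued covector `g(u, ·)`. -/
def flatCov (g : V →ₗ[ℝ] V →ₗ[ℝ] ℝ) (u : V) : V →ₗ[ℝ] ℂ :=
  Complex.ofRealCLM.toLinearMap ∘ₗ g u

@[simp] theorem flatCov_apply (g : V →ₗ[ℝ] V →ₗ[ℝ] ℝ) (u v : V) :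
    flatCov g u v = (g u v : ℂ) := rfl

/-- Evaluation of covectors at a vector. -/
def evalCov (u : V) : Module.Dual ℂ (V →ₗ[ℝ] ℂ) where
  toFun η := η u
  map_add' _ _ := rfl
  map_smul' _ _ := rfl

@[simp] theorem evalCov_apply (u : V) (η : V →ₗ[ℝ] ℂ) : evalCov u η = η u := rfl

variable [Module.Finite ℂ V]

theorem sum_coord_smul {M : Type*} [AddCommGroup M] [Module ℂ M] (m : V →ₗ[ℝ] M) (u : V) :
    ∑ j, (((Module.finBasis ℝ V).coord j u : ℝ) : ℂ) • m (Module.finBasis ℝ V j) = m u := by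
  conv_rhs => rw [← (Module.finBasis ℝ V).sum_repr u, map_sum]
  refine Finset.sum_congr rfl fun j _ => ?_
  rw [map_smul]
  rfl

theorem sum_smul_coord (φ : V →ₗ[ℝ] ℂ) :
    ∑ j, φ (Module.finBasis ℝ V j) • realOneForm ((Module.finBasis ℝ V).coord j) = oneForm φ := by
  have : φ = ∑ j, φ (Module.finBasis ℝ V j) •
      (Complex.ofRealCLM.toLinearMap ∘ₗ (Module.finBasis ℝ V).coord j) := by
    ext u
    rw [← sum_coord_smul φ u, LinearMap.sum_apply]
    refine Finset.sum_congr rfl fun j _ => ?_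
    simp [mul_comm]
  conv_rhs => rw [this, map_sum]
  simp [realOneForm]

theorem cometric_apply (g : V →ₗ[ℝ] V →ₗ[ℝ] ℝ) (ξ η : V →ₗ[ℝ] ℂ) :
    cometric g ξ η = ∑ j, ∑ l, (((gramMatrix g)⁻¹ j l : ℝ) : ℂ) *
      (ξ (Module.finBasis ℝ V j) * η (Module.finBasis ℝ V l)) := rfl

/-- The interior product with the vector dual to a covector. -/
def sharpProd (g : V →ₗ[ℝ] V →ₗ[ℝ] ℝ) (ξ : V →ₗ[ℝ] ℂ) : CForm V →ₗ[ℂ] CForm V :=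
  interiorProd (cometric g ξ)

theorem contractAll_oneForm (g : V →ₗ[ℝ] V →ₗ[ℝ] ℝ) (ξ : V →ₗ[ℝ] ℂ) :
    contractAll g (oneForm ξ) = sharpProd g ξ := by
  unfold contractAll oneForm
  rw [ExteriorAlgebra.lift_ι_apply]
  rfl

theorem contractAll_oneForm_mul (g : V →ₗ[ℝ] V →ₗ[ℝ] ℝ) (ξ : V →ₗ[ℝ] ℂ) (x y : CForm V) :
    contractAll g (oneForm ξ * x) y = sharpProd g ξ (contractAll g x y) := by
  rw [map_mul, contractAll_oneForm]; rfl

theorem signForm_contractAll (g : V →ₗ[ℝ] V →ₗ[ℝ] ℝ) (x y : CForm V) :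
    signForm (contractAll g x y) = contractAll g (signForm x) (signForm y) := by
  induction x using CForm.induction with
  | algebraMap r => simp [Module.algebraMap_end_apply]
  | add x x' hx hx' => simp only [map_add, LinearMap.add_apply, hx, hx']
  | oneForm_mul ξ x hx =>
    rw [contractAll_oneForm_mul, sharpProd, signForm_interiorProd, hx, map_mul, signForm_oneForm,
      neg_mul, map_neg, LinearMap.neg_apply, contractAll_oneForm_mul]
    rfl

/-- The Hodge star as a linear map. -/
def hodgeStarLin (g : V →ₗ[ℝ] V →ₗ[ℝ] ℝ) : CForm V →ₗ[ℂ] CForm V :=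
  LinearMap.applyₗ (volForm g) ∘ₗ (contractAll g).toLinearMap ∘ₗ revForm

theorem hodgeStarLin_apply (g : V →ₗ[ℝ] V →ₗ[ℝ] ℝ) (x : CForm V) :
    hodgeStarLin g x = contractAll g (revForm x) (volForm g) := rfl

/-- Reversal puts ξ last in the contraction; bringing it back to the front costs the involution on
x, and ξ then acts as the outermost interior product. -/
theorem hodgeStarLin_oneForm_mul (g : V →ₗ[ℝ] V →ₗ[ℝ] ℝ) (ξ : V →ₗ[ℝ] ℂ) (x : CForm V) :
    hodgeStarLin g (oneForm ξ * x) = sharpProd g ξ (hodgeStarLin g (signForm x)) := by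
  rw [hodgeStarLin_apply, hodgeStarLin_apply, revForm_mul, revForm_oneForm, mul_oneForm_eq,
    contractAll_oneForm_mul, revForm_signForm]

theorem fundamentalForm_eq (g : V →ₗ[ℝ] V →ₗ[ℝ] ℝ) :
    fundamentalForm g = (1 / 2 : ℂ) • ∑ j, realOneForm ((Module.finBasis ℝ V).coord j) *
      oneForm (flatCov g (Complex.I • Module.finBasis ℝ V j)) := rfl

theorem signForm_fundamentalForm (g : V →ₗ[ℝ] V →ₗ[ℝ] ℝ) :
    signForm (fundamentalForm g) = fundamentalForm g := by
  rw [fundamentalForm_eq]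
  simp [map_sum, realOneForm]

theorem revForm_fundamentalForm (g : V →ₗ[ℝ] V →ₗ[ℝ] ℝ) :
    revForm (fundamentalForm g) = -fundamentalForm g := by
  rw [fundamentalForm_eq]
  simp only [map_smul, map_sum, revForm_mul, realOneForm, revForm_oneForm, ← smul_neg,
    ← Finset.sum_neg_distrib]
  exact congrArg _ (Finset.sum_congr rfl fun j _ => oneForm_mul_oneForm _ _)

theorem signForm_volForm (g : V →ₗ[ℝ] V →ₗ[ℝ] ℝ) : signForm (volForm g) = volForm g := by
  simp [volForm, signForm_fundamentalForm]

theorem signForm_hodgeStarLin (g : V →ₗ[ℝ] V →ₗ[ℝ] ℝ) (x : CForm V) :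
    signForm (hodgeStarLin g x) = hodgeStarLin g (signForm x) := by
  rw [hodgeStarLin_apply, hodgeStarLin_apply, signForm_contractAll, signForm_volForm,
    revForm_signForm]

/-- The product has degree 2n + 1, while the space of complex-valued covectors has complex dimension
2n, so that exterior power is zero. -/
theorem oneForm_mul_volForm (g : V →ₗ[ℝ] V →ₗ[ℝ] ℝ) (ξ : V →ₗ[ℝ] ℂ) :
    oneForm ξ * volForm g = 0 := by
  let P := LinearMap.range (ExteriorAlgebra.ι ℂ : (V →ₗ[ℝ] ℂ) →ₗ[ℂ] CForm V)
  have h1 : ∀ η : V →ₗ[ℝ] ℂ, oneForm η ∈ P ^ 1 := fun η => by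
    rw [pow_one]; exact LinearMap.mem_range_self _ η
  have h2 : fundamentalForm g ∈ P ^ 2 := by
    rw [fundamentalForm_eq]
    refine Submodule.smul_mem _ _ (Submodule.sum_mem _ fun j _ => ?_)
    rw [show 2 = 1 + 1 from rfl, pow_add]
    exact Submodule.mul_mem_mul (h1 _) (h1 _)
  have h3 : oneForm ξ * volForm g ∈ P ^ (1 + 2 * Module.finrank ℂ V) := by
    rw [pow_add, pow_mul]
    exact Submodule.mul_mem_mul (h1 _) (Submodule.smul_mem _ _ (Submodule.pow_mem_pow _ h2 _))
  have h4 : Module.finrank ℂ (V →ₗ[ℝ] ℂ) = 2 * Module.finrank ℂ V := by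
    rw [Module.finrank_linearMap_self, finrank_real_of_complex]
  have h5 : Module.finrank ℂ (⋀[ℂ]^(1 + 2 * Module.finrank ℂ V) (V →ₗ[ℝ] ℂ)) = 0 := by
    rw [exteriorPower.finrank_eq, h4, Nat.choose_eq_zero_of_lt (by omega)]
  have h6 := Submodule.finrank_eq_zero.1 h5
  have h7 : oneForm ξ * volForm g ∈ (⋀[ℂ]^(1 + 2 * Module.finrank ℂ V) (V →ₗ[ℝ] ℂ)) := h3
  rw [h6] at h7
  exact (Submodule.mem_bot ℂ).1 h7

namespace IsHermitianForm

variable {g : V →ₗ[ℝ] V →ₗ[ℝ] ℝ} (hg : IsHermitianForm g)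
include hg

theorem det_gramMatrix_ne_zero : (gramMatrix g).det ≠ 0 := by
  intro h
  obtain ⟨v, hv, hv0⟩ := Matrix.exists_vecMul_eq_zero_iff.2 h
  let b := Module.finBasis ℝ V
  have h1 : ∀ l, g (∑ j, v j • b j) (b l) = 0 := fun l => by
    have := congrFun hv0 l
    simpa [Matrix.vecMul, dotProduct, gramMatrix, LinearMap.sum_apply] using this
  have h2 : g (∑ j, v j • b j) = 0 := b.ext h1
  have h3 : ∑ j, v j • b j = 0 := by
    by_contra h0
    have := hg.pos _ h0
    rw [h2] at this
    simp at this
  exact hv (funext fun j => Fintype.linearIndependent_iff.1 b.linearIndependent v h3 j)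

/-- The inverse Gram matrix undoes lowering an index: the vector dual to g(u, ·) is u. This frees
all later arguments from coordinates. -/
theorem cometric_flatCov (u : V) : cometric g (flatCov g u) = evalCov u := by
  ext η
  let b := Module.finBasis ℝ V
  have hG : IsUnit (gramMatrix g).det := isUnit_iff_ne_zero.2 hg.det_gramMatrix_ne_zero
  have h1 : ∀ l, ∑ j, (gramMatrix g)⁻¹ j l * g u (b j) = b.repr u l := fun l => by
    have h2 : ∀ j, g u (b j) = Matrix.vecMul (b.repr u) (gramMatrix g) j := fun j => by
      conv_lhs => rw [← b.sum_repr u, map_sum, LinearMap.sum_apply]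
      simp [Matrix.vecMul, dotProduct, gramMatrix, b]
    have h3 : Matrix.vecMul (Matrix.vecMul (b.repr u) (gramMatrix g)) (gramMatrix g)⁻¹ l = b.repr u l := by
      rw [Matrix.vecMul_vecMul, Matrix.mul_nonsing_inv _ hG, Matrix.vecMul_one]
    rw [← h3]
    simp only [h2]
    rw [Matrix.vecMul, dotProduct]
    exact Finset.sum_congr rfl fun j _ => mul_comm _ _
  rw [cometric_apply, Finset.sum_comm, evalCov_apply, ← sum_coord_smul η u]
  refine Finset.sum_congr rfl fun l _ => ?_
  rw [Module.Basis.coord_apply, ← h1, Complex.ofReal_sum, Finset.sum_smul]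
  refine Finset.sum_congr rfl fun j _ => ?_
  simp [b, mul_assoc]

theorem exists_flatCov_eq (φ : V →ₗ[ℝ] ℝ) : ∃ u, g u = φ := by
  have hinj : Function.Injective g := by
    rw [← LinearMap.ker_eq_bot, LinearMap.ker_eq_bot']
    intro u hu
    by_contra h0
    have := hg.pos _ h0
    rw [hu] at this
    simp at this
  have hs : Function.Surjective g := by
    refine (LinearMap.injective_iff_surjective_of_finrank_eq_finrank ?_).1 hinj
    rw [Module.finrank_linearMap_self]
  exact hs φ

theorem exists_eq_flatCov_add (ξ : V →ₗ[ℝ] ℂ) :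
    ∃ u v, ξ = flatCov g u + Complex.I • flatCov g v := by
  obtain ⟨u, hu⟩ := hg.exists_flatCov_eq (Complex.reLm ∘ₗ ξ)
  obtain ⟨v, hv⟩ := hg.exists_flatCov_eq (Complex.imLm ∘ₗ ξ)
  refine ⟨u, v, ?_⟩
  ext x
  have h1 : g u x = (ξ x).re := by rw [hu]; rfl
  have h2 : g v x = (ξ x).im := by rw [hv]; rfl
  simp only [LinearMap.add_apply, LinearMap.smul_apply, flatCov_apply, smul_eq_mul, h1, h2]
  rw [mul_comm, Complex.re_add_im]

/-- Real and imaginary parts of a covector are both represented by vectors, so linear identities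
need checking only on g(u, ·), whose dual vector is known. -/
theorem covector_induction {P : (V →ₗ[ℝ] ℂ) → Prop} (flat : ∀ u, P (flatCov g u))
    (add : ∀ ξ η, P ξ → P η → P (ξ + η)) (smul : ∀ (c : ℂ) ξ, P ξ → P (c • ξ))
    (ξ : V →ₗ[ℝ] ℂ) : P ξ := by
  obtain ⟨u, v, rfl⟩ := hg.exists_eq_flatCov_add ξ
  exact add _ _ (flat u) (smul _ _ (flat v))

theorem cometric_comm (ξ η : V →ₗ[ℝ] ℂ) : cometric g ξ η = cometric g η ξ := by
  induction ξ using hg.covector_induction with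
  | add ξ ξ' h h' => simp [h, h']
  | smul c ξ h => simp [h]
  | flat u =>
    induction η using hg.covector_induction with
    | add ξ ξ' h h' => simp [h, h']
    | smul c ξ h => simp [h]
    | flat v => simp [hg.cometric_flatCov, hg.symm u v]

/-- Iterates the Clifford relation ξ ∧ ι_η + ι_η (ξ ∧ ·) = ⟨ξ, η⟩: moving ξ through a string of
contractions produces one term for each factor, and these terms add up to ι_ξ applied to the string
itself. -/
theorem oneForm_mul_contractAll (ξ : V →ₗ[ℝ] ℂ) (x y : CForm V) :
    oneForm ξ * contractAll g x y =
      contractAll g (signForm x) (oneForm ξ * y) + contractAll g (sharpProd g ξ x) y := by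
  induction x using CForm.induction generalizing y with
  | algebraMap r => simp [Module.algebraMap_end_apply, sharpProd]
  | add x x' hx hx' => simp only [map_add, LinearMap.add_apply, mul_add, hx, hx']; abel
  | oneForm_mul η x hx =>
    have h1 : ∀ z, oneForm ξ * sharpProd g η z =
        cometric g ξ η • z - sharpProd g η (oneForm ξ * z) := fun z => by
      rw [sharpProd, interiorProd_oneForm_mul, hg.cometric_comm]; abel
    have h2 : sharpProd g ξ (oneForm η * x) = cometric g ξ η • x - oneForm η * sharpProd g ξ x :=
      interiorProd_oneForm_mul _ _ _
    rw [contractAll_oneForm_mul, h1, hx, h2, map_mul signForm, signForm_oneForm, neg_mul,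
      map_neg (contractAll g), LinearMap.neg_apply, contractAll_oneForm_mul,
      map_sub (contractAll g), map_smul (contractAll g), LinearMap.sub_apply,
      LinearMap.smul_apply, contractAll_oneForm_mul, map_add (sharpProd g η)]
    abel

/-- In the previous relation applied to the volume form, the term with ξ ∧ vol drops out because the
degree is too large. -/
theorem hodgeStarLin_sharpProd (ξ : V →ₗ[ℝ] ℂ) (x : CForm V) :
    hodgeStarLin g (sharpProd g ξ x) = -(oneForm ξ * hodgeStarLin g (signForm x)) := by
  rw [hodgeStarLin_apply, hodgeStarLin_apply, hg.oneForm_mul_contractAll, oneForm_mul_volForm,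
    map_zero, zero_add, sharpProd, interiorProd_revForm, signForm_signForm]
  simp

/-- For ξ = g(u, ·) the left side is ω(u, ·) = g(Ju, ·), which equals -g(u, J·) by invariance of g.
The two factors of each summand of ω contribute equally, cancelling the 1/2. -/
theorem sharpProd_fundamentalForm (ξ : V →ₗ[ℝ] ℂ) :
    sharpProd g ξ (fundamentalForm g) = -oneForm (ξ ∘ₗ jMap V) := by
  induction ξ using hg.covector_induction with
  | add ξ ξ' h h' =>
    rw [LinearMap.add_comp, map_add, neg_add, ← h, ← h']; simp [sharpProd, interiorProd]
  | smul c ξ h =>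
    rw [LinearMap.smul_comp, map_smul, ← smul_neg, ← h]; simp [sharpProd, interiorProd]
  | flat u =>
    let m : V →ₗ[ℝ] CForm V :=
      (oneForm.restrictScalars ℝ) ∘ₗ (LinearMap.compRight ℝ Complex.ofRealCLM.toLinearMap) ∘ₗ
        g ∘ₗ jMap V
    have hm : ∀ v, m v = oneForm (flatCov g (Complex.I • v)) := fun v => rfl
    have hJ : ∀ v w, g (Complex.I • v) w = -g v (Complex.I • w) := fun v w => by
      rw [← hg.inner_J v, smul_smul, Complex.I_mul_I]; simp
    have e1 : flatCov g u ∘ₗ jMap V = -flatCov g (Complex.I • u) := by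
      ext v; simp [hJ]
    have e2 : ∀ j, flatCov g (Complex.I • Module.finBasis ℝ V j) u =
        -flatCov g (Complex.I • u) (Module.finBasis ℝ V j) := fun j => by
      simp [hJ u, hg.symm u]
    have s1 := sum_coord_smul m u
    have s2 := sum_smul_coord (flatCov g (Complex.I • u))
    simp only [hm] at s1
    rw [fundamentalForm_eq, map_smul, map_sum, sharpProd, hg.cometric_flatCov, e1]
    simp only [realOneForm, interiorProd_oneForm_mul, evalCov_apply, interiorProd_oneForm, e2]
    rw [Finset.sum_sub_distrib]
    have s3 : ∑ j, oneForm (Complex.ofRealCLM.toLinearMap ∘ₗ (Module.finBasis ℝ V).coord j) *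
        algebraMap ℂ (CForm V) (-flatCov g (Complex.I • u) (Module.finBasis ℝ V j)) =
        -oneForm (flatCov g (Complex.I • u)) := by
      rw [← s2, ← Finset.sum_neg_distrib]
      refine Finset.sum_congr rfl fun j _ => ?_
      rw [← Algebra.commutes, ← Algebra.smul_def, neg_smul]; rfl
    have s4 : ∑ j, (Complex.ofRealCLM.toLinearMap ∘ₗ (Module.finBasis ℝ V).coord j) u •
        oneForm (flatCov g (Complex.I • Module.finBasis ℝ V j)) =
        oneForm (flatCov g (Complex.I • u)) := s1
    rw [s3, s4, map_neg, sub_neg_eq_add, ← two_smul ℂ, smul_smul]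
    simp

end IsHermitianForm

end Metric

/-! ### Contraction with ω, and the square of the star operator -/

section HodgeStar

variable {V : Type*} [AddCommGroup V] [Module ℂ V] [Module.Finite ℂ V]

/-- Contraction with the fundamental form: minus the adjoint of the Lefschetz operator. -/
def contractFundamental (g : V →ₗ[ℝ] V →ₗ[ℝ] ℝ) : CForm V →ₗ[ℂ] CForm V :=
  contractAll g (fundamentalForm g)

theorem sharpProd_mul (g : V →ₗ[ℝ] V →ₗ[ℝ] ℝ) (ξ : V →ₗ[ℝ] ℂ) (x y : CForm V) :
    sharpProd g ξ (x * y) = sharpProd g ξ x * y + signForm x * sharpProd g ξ y :=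
  interiorProd_mul _ _ _

theorem sharpProd_oneForm_mul (g : V →ₗ[ℝ] V →ₗ[ℝ] ℝ) (ξ η : V →ₗ[ℝ] ℂ) (x : CForm V) :
    sharpProd g ξ (oneForm η * x) = cometric g ξ η • x - oneForm η * sharpProd g ξ x :=
  interiorProd_oneForm_mul _ _ _

omit [Module.Finite ℂ V] in
theorem comp_jMap_comp_jMap (ξ : V →ₗ[ℝ] ℂ) : (ξ ∘ₗ jMap V) ∘ₗ jMap V = -ξ := by
  ext v
  simp [smul_smul]

namespace IsHermitianForm

variable {g : V →ₗ[ℝ] V →ₗ[ℝ] ℝ} (hg : IsHermitianForm g)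
include hg

/-- This is `oneForm_mul_contractAll` for the string ω: the form ω is even, and contracting it with
ξ gives -ξ ∘ J. -/
theorem contractFundamental_oneForm_mul (ξ : V →ₗ[ℝ] ℂ) (x : CForm V) :
    contractFundamental g (oneForm ξ * x) =
      oneForm ξ * contractFundamental g x + sharpProd g (ξ ∘ₗ jMap V) x := by
  rw [contractFundamental, hg.oneForm_mul_contractAll, signForm_fundamentalForm,
    hg.sharpProd_fundamentalForm, map_neg, LinearMap.neg_apply, contractAll_oneForm]
  abel

/-- A covector of type (0,1) satisfies ξ ∘ J = -iξ, so the commutator of C with ξ ∧ · is -i ι_ξ.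
This is the Kähler identity at the level of symbols. -/
theorem sharpProd_eq_commutator {ξ : V →ₗ[ℝ] ℂ} (hξ : ∀ v, ξ (Complex.I • v) = -Complex.I * ξ v)
    (x : CForm V) : sharpProd g ξ x =
      Complex.I • (contractFundamental g (oneForm ξ * x) -
        oneForm ξ * contractFundamental g x) := by
  have h : ξ ∘ₗ jMap V = (-Complex.I) • ξ := by
    ext v; simp [hξ]
  rw [hg.contractFundamental_oneForm_mul, h, add_sub_cancel_left]
  simp [sharpProd, interiorProd, smul_smul]

theorem sharpProd_fundamentalForm_pow (ξ : V →ₗ[ℝ] ℂ) (k : ℕ) :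
    sharpProd g ξ (fundamentalForm g ^ (k + 1)) =
      -((k + 1 : ℂ) • (oneForm (ξ ∘ₗ jMap V) * fundamentalForm g ^ k)) := by
  induction k with
  | zero => simp [hg.sharpProd_fundamentalForm]
  | succ k ih =>
    rw [pow_succ', sharpProd_mul, ih, hg.sharpProd_fundamentalForm, signForm_fundamentalForm,
      mul_neg, mul_smul_comm, ← mul_assoc, ← mul_eq_of_signForm_eq_self
        (signForm_fundamentalForm g) (oneForm _), mul_assoc, ← pow_succ', neg_mul, ← neg_add]
    push_cast
    rw [add_smul (k + 1 : ℂ), one_smul, add_comm]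

theorem contractFundamental_fundamentalForm_pow (k : ℕ) :
    contractFundamental g (fundamentalForm g ^ (k + 1)) =
      -(((k + 1 : ℂ) * (Module.finrank ℂ V - k)) • fundamentalForm g ^ k) := by
  -- The Lefschetz relation on powers of ω: commuting C past ω ∧ · multiplies a form of degree 2k by
  -- 2k - n.
  have step : ∀ k : ℕ, contractFundamental g (fundamentalForm g ^ (k + 1)) =
      fundamentalForm g * contractFundamental g (fundamentalForm g ^ k) +
        (2 * k - Module.finrank ℂ V : ℂ) • fundamentalForm g ^ k := by
    intro k
    let e := fun j => Complex.ofRealCLM.toLinearMap ∘ₗ (Module.finBasis ℝ V).coord j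
    let f := fun j => flatCov g (Complex.I • Module.finBasis ℝ V j)
    have hw : fundamentalForm g = (1 / 2 : ℂ) • ∑ j, oneForm (e j) * oneForm (f j) := rfl
    -- For `k = 0` the exponent `k - 1` truncates to 0, harmlessly, because the coefficient `k`
    -- vanishes.
    have hpow : ∀ ξ : V →ₗ[ℝ] ℂ, ∀ η, oneForm η * sharpProd g ξ (fundamentalForm g ^ k) =
        -((k : ℂ) • (oneForm η * (oneForm (ξ ∘ₗ jMap V) * fundamentalForm g ^ (k - 1)))) := by
      intro ξ η
      cases k with
      | zero => simp [sharpProd]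
      | succ k =>
        rw [hg.sharpProd_fundamentalForm_pow]
        simp
    have hfJ : ∀ j, ((f j) ∘ₗ jMap V) ∘ₗ jMap V = -f j := fun j => comp_jMap_comp_jMap _
    have heJ : ∀ j, ((e j) ∘ₗ jMap V) ∘ₗ jMap V = -e j := fun j => comp_jMap_comp_jMap _
    -- The vector dual to `f j` is J e_j, on which `e j ∘ J` takes the value -1. Over the 2n real
    -- basis vectors, with the factor 1/2 of ω, this produces the constant -n.
    have hef : ∀ j, cometric g (e j ∘ₗ jMap V) (f j) = -1 := fun j => by
      rw [hg.cometric_comm, hg.cometric_flatCov]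
      simp [e, smul_smul]
    have hterm : ∀ j, contractFundamental g (oneForm (e j) * oneForm (f j) *
        fundamentalForm g ^ k) = oneForm (e j) * oneForm (f j) *
          contractFundamental g (fundamentalForm g ^ k) +
        ((2 * k : ℂ) • (oneForm (e j) * oneForm (f j) * fundamentalForm g ^ (k - 1)) -
          fundamentalForm g ^ k) := by
      intro j
      have h1 : oneForm (f j) * (oneForm (e j) * fundamentalForm g ^ (k - 1)) =
          -(oneForm (e j) * (oneForm (f j) * fundamentalForm g ^ (k - 1))) := by
        rw [← mul_assoc, oneForm_mul_oneForm, neg_mul, mul_assoc]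
      rw [mul_assoc, hg.contractFundamental_oneForm_mul, hg.contractFundamental_oneForm_mul,
        sharpProd_oneForm_mul, hef, mul_add, hpow, hpow, hfJ, heJ]
      simp only [map_neg, neg_mul, mul_neg, h1, smul_neg, neg_neg, neg_smul, one_smul, mul_assoc,
        two_mul, add_smul]
      abel
    have hk : (k : ℂ) • (fundamentalForm g * fundamentalForm g ^ (k - 1)) =
        (k : ℂ) • fundamentalForm g ^ k := by
      cases k with
      | zero => simp
      | succ k => rw [← pow_succ']; simp
    have hmul : ∀ x, fundamentalForm g * x =
        (1 / 2 : ℂ) • ∑ j, oneForm (e j) * oneForm (f j) * x := fun x => by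
      rw [hw, smul_mul_assoc, Finset.sum_mul]
    rw [pow_succ', hmul (fundamentalForm g ^ k), map_smul, map_sum, Finset.sum_congr rfl
      (fun j _ => hterm j), Finset.sum_add_distrib, Finset.sum_sub_distrib, ← Finset.smul_sum,
      Finset.sum_const, Finset.card_univ, Fintype.card_fin,
      smul_add, ← hmul, smul_sub, smul_comm (1 / 2 : ℂ) (2 * k : ℂ),
      ← hmul, mul_smul, hk, ← Nat.cast_smul_eq_nsmul ℂ, finrank_real_of_complex]
    push_cast
    module
  induction k with
  | zero =>
    have h0 : contractFundamental g (1 : CForm V) = 0 := by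
      rw [contractFundamental, fundamentalForm_eq]
      simp [map_sum, LinearMap.sum_apply, realOneForm, contractAll_oneForm, sharpProd]
    rw [step, pow_zero, h0]
    simp [← neg_smul]
  | succ k ih =>
    rw [step, ih, mul_neg, mul_smul_comm, ← pow_succ', ← neg_smul, ← add_smul, ← neg_smul]
    congr 1
    push_cast
    ring

omit hg in
theorem hodgeStarLin_one : hodgeStarLin g (1 : CForm V) = volForm g := by
  rw [hodgeStarLin_apply, revForm_one, map_one]; rfl

/-- Reversal negates ω, so star of the volume form is (-C)^n ω^n / (n!)². Each step of -C on ω^(k+1)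
contributes (k+1)(n-k), and the product of these over all k < n is (n!)². -/
theorem hodgeStarLin_volForm : hodgeStarLin g (volForm g) = 1 := by
  let n := Module.finrank ℂ V
  have key : ∀ m ≤ n, ((contractAll g (-fundamentalForm g)) ^ m) (fundamentalForm g ^ m) =
      ((m.factorial * n.descFactorial m : ℕ) : ℂ) • (1 : CForm V) := by
    intro m hm
    induction m with
    | zero => simp
    | succ m ih =>
      rw [pow_succ, Module.End.mul_apply, map_neg, LinearMap.neg_apply, ← contractFundamental,
        hg.contractFundamental_fundamentalForm_pow, neg_neg, map_smul, contractFundamental,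
        ← map_neg, ih (by omega), smul_smul, Nat.descFactorial_succ, Nat.factorial_succ]
      congr 1
      push_cast [Nat.cast_sub (show m ≤ n by omega)]
      ring
  have hn : (n.factorial : ℂ) ≠ 0 := by exact_mod_cast n.factorial_ne_zero
  rw [hodgeStarLin_apply]
  unfold volForm
  rw [map_smul, map_smul, revForm_pow, revForm_fundamentalForm, map_smul, LinearMap.smul_apply, map_pow (contractAll g), key n le_rfl, Nat.descFactorial_self, smul_smul, smul_smul]
  push_cast
  rw [show (1 / (n.factorial : ℂ)) * (1 / n.factorial) * (n.factorial * n.factorial) = 1 by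
    field_simp, one_smul]

/-- Star exchanges ξ ∧ · with ι_ξ up to sign, so two stars return to ξ ∧ · with one minus sign per
covector; the induction starts from *1 = vol and *vol = 1. -/
theorem hodgeStarLin_hodgeStarLin (x : CForm V) :
    hodgeStarLin g (hodgeStarLin g x) = signForm x := by
  induction x using CForm.induction with
  | algebraMap r =>
    rw [Algebra.algebraMap_eq_smul_one, map_smul, map_smul, hodgeStarLin_one,
      hg.hodgeStarLin_volForm, map_smul, map_one]
  | add x x' hx hx' => simp only [map_add, hx, hx']
  | oneForm_mul ξ x hx =>
    rw [hodgeStarLin_oneForm_mul, hg.hodgeStarLin_sharpProd, signForm_hodgeStarLin,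
      signForm_signForm, hx, map_mul, signForm_oneForm, neg_mul]

/-- The reason that ∂* is built from contractions: conjugating the symbol of ∂̄ by star turns each
wedge with a covector into an interior product. -/
theorem hodgeStarLin_oneForm_mul_hodgeStarLin (ξ : V →ₗ[ℝ] ℂ) (x : CForm V) :
    hodgeStarLin g (oneForm ξ * hodgeStarLin g x) = sharpProd g ξ x := by
  rw [hodgeStarLin_oneForm_mul, signForm_hodgeStarLin, hg.hodgeStarLin_hodgeStarLin,
    signForm_signForm]

end IsHermitianForm

end HodgeStar

/-! ### Compatibility of ω, star and C with complex-linear pullback -/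

section Naturality

variable {V : Type*} [AddCommGroup V] [Module ℂ V] [Module.Finite ℂ V]
  {W : Type*} [AddCommGroup W] [Module ℂ W] [Module.Finite ℂ W]
  {g : V →ₗ[ℝ] V →ₗ[ℝ] ℝ} {h : W →ₗ[ℝ] W →ₗ[ℝ] ℝ} {A : V →ₗ[ℂ] W}

omit [Module.Finite ℂ V] [Module.Finite ℂ W] in
theorem IsHermitianForm.of_injective (hh : IsHermitianForm h) (hA : Function.Injective A)
    (hgh : ∀ u v, g u v = h (A u) (A v)) : IsHermitianForm g where
  symm u v := by rw [hgh, hgh, hh.symm]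
  pos u hu := by rw [hgh]; exact hh.pos _ fun h0 => hu (hA (by rw [h0, map_zero]))
  inner_J u v := by rw [hgh, hgh, A.map_smul, A.map_smul, hh.inner_J]

/-- The basis in the definition of ω is immaterial: expanding the pulled-back coordinate covectors
in a basis of V and summing over the basis of W reassembles g(J e_j, ·). -/
theorem pullForm_fundamentalForm (hgh : ∀ u v, g u v = h (A u) (A v)) :
    pullForm A (fundamentalForm h) = fundamentalForm g := by
  rw [fundamentalForm_eq, fundamentalForm_eq, map_smul, map_sum]
  congr 1
  let m : W →ₗ[ℝ] CForm V :=
      (oneForm.restrictScalars ℝ) ∘ₗ (LinearMap.lcomp ℝ ℂ (A.restrictScalars ℝ)) ∘ₗ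
      (LinearMap.compRight ℝ Complex.ofRealCLM.toLinearMap) ∘ₗ h ∘ₗ jMap W
  have hm : ∀ w, m w = oneForm (flatCov h (Complex.I • w) ∘ₗ A.restrictScalars ℝ) := fun _ => rfl
  have hmA : ∀ v, m (A v) = oneForm (flatCov g (Complex.I • v)) := fun v => by
    rw [hm]
    congr 1
    ext u
    simp [hgh]
  have hterm : ∀ k, pullForm A (realOneForm ((Module.finBasis ℝ W).coord k) *
      oneForm (flatCov h (Complex.I • Module.finBasis ℝ W k))) =
      ∑ j, realOneForm ((Module.finBasis ℝ V).coord j) *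
        ((((Module.finBasis ℝ W).coord k (A (Module.finBasis ℝ V j)) : ℝ) : ℂ) •
          m (Module.finBasis ℝ W k)) := fun k => by
    rw [map_mul, pullForm_oneForm, realOneForm, pullForm_oneForm, ← sum_smul_coord, Finset.sum_mul]
    refine Finset.sum_congr rfl fun j _ => ?_
    rw [mul_smul_comm, smul_mul_assoc, hm]
    rfl
  simp only [hterm]
  rw [Finset.sum_comm]
  refine Finset.sum_congr rfl fun j _ => ?_
  rw [← Finset.mul_sum, sum_coord_smul, hmA]

variable (hh : IsHermitianForm h) (hA : Function.Bijective A)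
  (hgh : ∀ u v, g u v = h (A u) (A v))
include hh hA hgh

/-- It suffices to test on ξ = h(Au, ·), whose pullback is g(u, ·); both sides are then evaluation
of η at Au. -/
theorem cometric_comp (ξ η : W →ₗ[ℝ] ℂ) :
    cometric g (ξ ∘ₗ A.restrictScalars ℝ) (η ∘ₗ A.restrictScalars ℝ) = cometric h ξ η := by
  have hg := hh.of_injective hA.injective hgh
  induction ξ using hh.covector_induction with
  | add ξ ξ' h1 h2 => simp [LinearMap.add_comp, h1, h2]
  | smul c ξ h1 => simp [LinearMap.smul_comp, h1]
  | flat w =>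
    obtain ⟨u, rfl⟩ := hA.surjective w
    have : flatCov h (A u) ∘ₗ A.restrictScalars ℝ = flatCov g u := by
      ext v; simp [hgh]
    rw [this, hg.cometric_flatCov, hh.cometric_flatCov]
    rfl

theorem pullForm_contractAll (x y : CForm W) :
    pullForm A (contractAll h x y) = contractAll g (pullForm A x) (pullForm A y) := by
  induction x using CForm.induction with
  | algebraMap r => simp [Module.algebraMap_end_apply]
  | add x x' hx hx' => simp only [map_add, LinearMap.add_apply, hx, hx']
  | oneForm_mul ξ x hx =>
    rw [contractAll_oneForm_mul, map_mul (pullForm A), pullForm_oneForm, contractAll_oneForm_mul,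
      ← hx]
    exact pullForm_interiorProd _ _ _ (fun η => cometric_comp hh hA hgh ξ η) _

omit hh in
theorem pullForm_volForm : pullForm A (volForm h) = volForm g := by
  have hn : Module.finrank ℂ V = Module.finrank ℂ W :=
    (LinearEquiv.ofBijective A hA).finrank_eq
  rw [volForm, volForm, hn, map_smul, map_pow, pullForm_fundamentalForm hgh]

theorem pullForm_hodgeStarLin (x : CForm W) :
    pullForm A (hodgeStarLin h x) = hodgeStarLin g (pullForm A x) := by
  rw [hodgeStarLin_apply, hodgeStarLin_apply, pullForm_contractAll hh hA hgh,
    pullForm_volForm hA hgh, revForm_pullForm]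

theorem pullForm_contractFundamental (x : CForm W) :
    pullForm A (contractFundamental h x) = contractFundamental g (pullForm A x) := by
  rw [contractFundamental, contractFundamental, pullForm_contractAll hh hA hgh,
    pullForm_fundamentalForm hgh]

end Naturality

/-! ### Coefficients in an arbitrary algebra of functions -/

section Regular

variable {Y : Type*} {S : Subalgebra ℂ (Y → ℂ)}
  {F : Type*} [AddCommGroup F] [Module ℂ F]
  {F' : Type*} [AddCommGroup F'] [Module ℂ F']
  {F'' : Type*} [AddCommGroup F''] [Module ℂ F'']

/-- A vector-valued function is regular with respect to an algebra `S` of functions if all of its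
coefficients belong to `S`. -/
def Regular (S : Subalgebra ℂ (Y → ℂ)) (f : Y → F) : Prop :=
  ∀ l : Module.Dual ℂ F, (fun y => l (f y)) ∈ S

theorem Regular.of_mem {f : Y → ℂ} (hf : f ∈ S) : Regular S f := by
  intro l
  have : (fun y => l (f y)) = l 1 • f := by
    funext y
    rw [Pi.smul_apply, smul_eq_mul, mul_comm, ← smul_eq_mul, ← map_smul, smul_eq_mul, mul_one]
  rw [this]
  exact S.smul_mem hf _

theorem Regular.const (x : F) : Regular S (fun _ : Y => x) := fun l =>
  S.algebraMap_mem (l x)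

theorem Regular.add {f h : Y → F} (hf : Regular S f) (hh : Regular S h) :
    Regular S (fun y => f y + h y) := fun l => by
  simp only [map_add]
  exact S.add_mem (hf l) (hh l)

theorem Regular.sum {ι : Type*} {s : Finset ι} {f : ι → Y → F} (hf : ∀ i ∈ s, Regular S (f i)) :
    Regular S (fun y => ∑ i ∈ s, f i y) := fun l => by
  simp only [map_sum]
  have : (fun y => ∑ i ∈ s, l (f i y)) = ∑ i ∈ s, fun y => l (f i y) := by
    funext y; simp
  rw [this]
  exact S.sum_mem fun i hi => hf i hi l

theorem Regular.map {f : Y → F} (hf : Regular S f) (L : F →ₗ[ℂ] F') :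
    Regular S (fun y => L (f y)) := fun l => hf (l ∘ₗ L)

theorem Regular.smul {c : Y → ℂ} {f : Y → F} (hc : c ∈ S) (hf : Regular S f) :
    Regular S (fun y => c y • f y) := fun l => by
  simp only [map_smul]
  exact S.mul_mem hc (hf l)

theorem Regular.bilin [Module.Finite ℂ F] [Module.Finite ℂ F'] {f : Y → F} {h : Y → F'}
    (hf : Regular S f) (hh : Regular S h) (m : F →ₗ[ℂ] F' →ₗ[ℂ] F'') :
    Regular S (fun y => m (f y) (h y)) := by
  let b := Module.finBasis ℂ F
  have : (fun y => m (f y) (h y)) = fun y => ∑ i, b.coord i (f y) • m (b i) (h y) := by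
    funext y
    conv_lhs => rw [← b.sum_repr (f y), map_sum, LinearMap.sum_apply]
    simp
  rw [this]
  exact Regular.sum fun i _ => Regular.smul (hf _) (hh.map _)

theorem Regular.mul {A : Type*} [Ring A] [Algebra ℂ A] [Module.Finite ℂ A] {f h : Y → A}
    (hf : Regular S f) (hh : Regular S h) : Regular S (fun y => f y * h y) :=
  hf.bilin hh (LinearMap.mul ℂ A)

theorem Regular.pow {A : Type*} [Ring A] [Algebra ℂ A] [Module.Finite ℂ A] {f : Y → A}
    (hf : Regular S f) (k : ℕ) : Regular S (fun y => f y ^ k) := by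
  induction k with
  | zero => simpa using Regular.const (S := S) (1 : A)
  | succ k ih => simpa only [pow_succ] using ih.mul hf

theorem Regular.linearMap [Module.Finite ℂ F] {T : Y → F →ₗ[ℂ] F'}
    (hT : ∀ x, Regular S (fun y => T y x)) : Regular S T := by
  let b := Module.finBasis ℂ F
  have : T = fun y => ∑ i, LinearMap.smulRightₗ (b.coord i) (T y (b i)) := by
    funext y
    refine b.ext fun j => ?_
    simp [LinearMap.sum_apply, Finsupp.single_apply]
  rw [this]
  exact Regular.sum fun i _ => (hT (b i)).map _

theorem Regular.apply [Module.Finite ℂ F] [Module.Finite ℂ F'] {T : Y → F →ₗ[ℂ] F'} {f : Y → F}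
    (hT : Regular S T) (hf : Regular S f) : Regular S (fun y => T y (f y)) :=
  hT.bilin hf LinearMap.id

theorem Regular.algHom {V : Type*} [AddCommGroup V] [Module ℂ V] {A : Type*} [Ring A]
    [Algebra ℂ A] [Module.Finite ℂ A] {Φ : Y → CForm V →ₐ[ℂ] A}
    (hΦ : ∀ ξ, Regular S (fun y => Φ y (oneForm ξ))) (x : CForm V) :
    Regular S (fun y => Φ y x) := by
  induction x using CForm.induction with
  | algebraMap r => simpa using Regular.const (S := S) (algebraMap ℂ A r)
  | add x x' hx hx' => simpa using hx.add hx'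
  | oneForm_mul ξ x hx => simpa using (hΦ ξ).mul hx

variable {V : Type*} [AddCommGroup V] [Module ℂ V] [Module.Finite ℂ V]

theorem Regular.covector {φ : Y → V →ₗ[ℝ] ℂ} (hφ : ∀ v, (fun y => φ y v) ∈ S) :
    Regular S (fun y => oneForm (φ y)) := by
  simp only [← sum_smul_coord]
  exact Regular.sum fun i _ => Regular.smul (hφ _) (Regular.const _)

theorem Regular.pullForm {W : Type*} [AddCommGroup W] [Module ℂ W] [Module.Finite ℂ W]
    {A : Y → V →ₗ[ℂ] W} (hA : ∀ (ξ : W →ₗ[ℝ] ℂ) v, (fun y => ξ (A y v)) ∈ S) :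
    Regular S (fun y => (pullForm (A y)).toLinearMap) :=
  Regular.linearMap (Regular.algHom (Φ := fun y => _root_.pullForm (A y)) fun ξ => by
    simp only [pullForm_oneForm]
    exact Regular.covector (hA ξ))

theorem Regular.fundamentalForm {g : Y → V →ₗ[ℝ] V →ₗ[ℝ] ℝ}
    (hg : ∀ u v, (fun y => (g y u v : ℂ)) ∈ S) : Regular S (fun y => fundamentalForm (g y)) := by
  simp only [fundamentalForm_eq]
  exact Regular.smul (S.algebraMap_mem _) (Regular.sum fun j _ =>
    (Regular.const _).mul (Regular.covector (hg _)))

theorem Regular.volForm {g : Y → V →ₗ[ℝ] V →ₗ[ℝ] ℝ}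
    (hg : ∀ u v, (fun y => (g y u v : ℂ)) ∈ S) : Regular S (fun y => volForm (g y)) :=
  Regular.smul (S.algebraMap_mem _) ((Regular.fundamentalForm hg).pow _)

/-- The inverse of a function of `S` without zeros on `s` belongs to `S`. -/
def InvClosed (S : Subalgebra ℂ (Y → ℂ)) (s : Set Y) : Prop :=
  ∀ f ∈ S, (∀ y ∈ s, f y ≠ 0) → (fun y => (f y)⁻¹) ∈ S

variable {s : Set Y} {g : Y → V →ₗ[ℝ] V →ₗ[ℝ] ℝ} (hS : InvClosed S s)
  (hg : ∀ u v, (fun y => (g y u v : ℂ)) ∈ S) (hpos : ∀ y ∈ s, IsHermitianForm (g y))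
include hS hg hpos

/-- Cramer's rule: the inverse entries are polynomials in the metric coefficients times the inverse
of the determinant, which does not vanish where the metric is positive. -/
theorem inv_gramMatrix_mem (j l : Fin (Module.finrank ℝ V)) :
    (fun y => (((gramMatrix (g y))⁻¹ j l : ℝ) : ℂ)) ∈ S := by
  -- Taking the Gram matrix over the ring `S` itself makes its determinant and adjugate members of
  -- `S` automatically; `ev` specialises them at a point.
  let M : Matrix (Fin (Module.finrank ℝ V)) (Fin (Module.finrank ℝ V)) S :=
    Matrix.of fun j l => ⟨fun y => (gramMatrix (g y) j l : ℂ), hg _ _⟩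
  let ev : Y → S →+* ℂ := fun y => (Pi.evalRingHom (fun _ : Y => ℂ) y).comp S.val.toRingHom
  have hM : ∀ y, (ev y).mapMatrix M = Complex.ofRealHom.mapMatrix (gramMatrix (g y)) :=
    fun y => rfl
  have hdet : ∀ y, (M.det : Y → ℂ) y = ((gramMatrix (g y)).det : ℂ) := fun y => by
    change ev y M.det = Complex.ofRealHom _
    rw [RingHom.map_det, RingHom.map_det, hM]
  have hadj : ∀ y, (M.adjugate j l : Y → ℂ) y = ((gramMatrix (g y)).adjugate j l : ℂ) :=
    fun y => by
    have := congrFun (congrFun ((RingHom.map_adjugate (ev y) M).trans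
      ((congrArg _ (hM y)).trans (RingHom.map_adjugate Complex.ofRealHom _).symm)) j) l
    exact this
  have hinv : (fun y => ((M.det : Y → ℂ) y)⁻¹) ∈ S := hS _ M.det.2 fun y hy => by
    rw [hdet]
    exact_mod_cast (hpos y hy).det_gramMatrix_ne_zero
  have : (fun y => (((gramMatrix (g y))⁻¹ j l : ℝ) : ℂ)) =
      (fun y => ((M.det : Y → ℂ) y)⁻¹) * (M.adjugate j l : Y → ℂ) := by
    funext y
    rw [Pi.mul_apply, hdet, hadj, Matrix.inv_def, Ring.inverse_eq_inv', Matrix.smul_apply,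
      smul_eq_mul]
    push_cast
    rfl
  rw [this]
  exact S.mul_mem hinv (M.adjugate j l).2

theorem Regular.cometric (ξ : V →ₗ[ℝ] ℂ) : Regular S (fun y => cometric (g y) ξ) := by
  refine Regular.linearMap fun η => ?_
  simp only [cometric_apply]
  exact Regular.sum fun j _ => Regular.sum fun l _ => Regular.of_mem
    (S.mul_mem (inv_gramMatrix_mem hS hg hpos j l) (S.algebraMap_mem _))

theorem Regular.contractAll (x : CForm V) : Regular S (fun y => contractAll (g y) x) :=
  Regular.algHom (fun ξ => by
    simp only [contractAll_oneForm]
    exact (Regular.cometric hS hg hpos ξ).map CliffordAlgebra.contractLeft) x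

/-- Used for two algebras: with `smoothAlg`, star preserves smoothness; with `stationaryAlg`, star
has zero derivative at a point where the metric coefficients do. -/
theorem Regular.hodgeStarLin : Regular S (fun y => hodgeStarLin (g y)) :=
  Regular.linearMap fun x => by
    simp only [hodgeStarLin_apply]
    exact (Regular.contractAll hS hg hpos _).apply (Regular.volForm hg)

theorem Regular.contractFundamental : Regular S (fun y => contractFundamental (g y)) := by
  have h : Regular S (fun y => (_root_.contractAll (g y)).toLinearMap) :=
    Regular.linearMap (Regular.contractAll hS hg hpos)
  exact h.apply (Regular.fundamentalForm hg)

end Regular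

/-! ### The coefficient algebras: differentiable, stationary, smooth -/

section Calculus

variable {E : Type*} [NormedAddCommGroup E] [NormedSpace ℝ E]

/-- The functions differentiable at a point. -/
def diffAlg (y₀ : E) : Subalgebra ℂ (E → ℂ) where
  carrier := {f | DifferentiableAt ℝ f y₀}
  mul_mem' hf hh := DifferentiableAt.mul hf hh
  add_mem' hf hh := DifferentiableAt.add hf hh
  algebraMap_mem' c := differentiableAt_const c

/-- The functions with derivative zero at a point. -/
def stationaryAlg (y₀ : E) : Subalgebra ℂ (E → ℂ) where
  carrier := {f | HasFDerivAt f (0 : E →L[ℝ] ℂ) y₀}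
  mul_mem' hf hh := (HasFDerivAt.mul hf hh).congr_fderiv (by ext; simp)
  add_mem' hf hh := by simpa using HasFDerivAt.add hf hh
  algebraMap_mem' c := hasFDerivAt_const c y₀

/-- The functions smooth on a set. -/
def smoothAlg (s : Set E) : Subalgebra ℂ (E → ℂ) where
  carrier := {f | ContDiffOn ℝ ∞ f s}
  mul_mem' hf hh := ContDiffOn.mul hf hh
  add_mem' hf hh := ContDiffOn.add hf hh
  algebraMap_mem' _ := contDiffOn_const

theorem mem_stationaryAlg {y₀ : E} {f : E → ℂ} :
    f ∈ stationaryAlg y₀ ↔ HasFDerivAt f (0 : E →L[ℝ] ℂ) y₀ := Iff.rfl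

theorem mem_smoothAlg {s : Set E} {f : E → ℂ} : f ∈ smoothAlg s ↔ ContDiffOn ℝ ∞ f s := Iff.rfl

theorem invClosed_stationaryAlg (y₀ : E) : InvClosed (stationaryAlg y₀) {y₀} := by
  intro f hf h0
  have h1 := (hasFDerivAt_inv' (𝕜 := ℂ) (h0 y₀ rfl)).restrictScalars ℝ
  have := HasFDerivAt.comp y₀ h1 (mem_stationaryAlg.1 hf)
  simpa [mem_stationaryAlg, Function.comp_def] using this

theorem invClosed_smoothAlg (s : Set E) : InvClosed (smoothAlg s) s :=
  fun _ hf h0 => ContDiffOn.inv (mem_smoothAlg.1 hf) h0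

end Calculus

/-! ### Calculus of vector-valued directional derivatives -/

section DirDeriv

variable {E : Type*} [NormedAddCommGroup E] [NormedSpace ℂ E]
  {F : Type*} [AddCommGroup F] [Module ℂ F] [Module.Finite ℂ F]
  {F' : Type*} [AddCommGroup F'] [Module ℂ F'] [Module.Finite ℂ F']
  {F'' : Type*} [AddCommGroup F''] [Module ℂ F''] [Module.Finite ℂ F'']

theorem ext_dual {x y : F} (h : ∀ l : Module.Dual ℂ F, l x = l y) : x = y := by
  rw [← sub_eq_zero, ← Module.forall_dual_apply_eq_zero_iff ℂ]
  intro l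
  rw [map_sub, h, sub_self]

/-- Shows that the basis chosen in `dirDeriv` does not matter. Together with `ext_dual` it reduces
each rule below to the scalar derivative. -/
theorem map_dirDeriv {f : E → F} {y : E} (hf : Regular (diffAlg y) f) (v : E)
    (l : Module.Dual ℂ F) : l (dirDeriv f y v) = fderiv ℝ (fun z => l (f z)) y v := by
  let b := Module.finBasis ℂ F
  have h1 : (fun z => l (f z)) = fun z => ∑ j, b.repr (f z) j * l (b j) := by
    funext z
    conv_lhs => rw [← b.sum_repr (f z), map_sum]
    simp
  have h2 : ∀ j, DifferentiableAt ℝ (fun z => b.repr (f z) j) y := fun j => hf (b.coord j)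
  rw [h1, fderiv_fun_sum (fun j _ => (h2 j).mul_const _)]
  simp only [dirDeriv, map_sum, map_smul, _root_.sum_apply]
  refine Finset.sum_congr rfl fun j _ => ?_
  rw [fderiv_mul_const (h2 j)]
  simp [b, mul_comm]

/-- The directional derivative as a real linear map. -/
def dirDerivLin (f : E → F) (y : E) : E →ₗ[ℝ] F where
  toFun v := dirDeriv f y v
  map_add' v w := by simp [dirDeriv, add_smul, Finset.sum_add_distrib]
  map_smul' c v := by simp [dirDeriv, mul_smul, Finset.smul_sum]

@[simp] theorem dirDerivLin_apply (f : E → F) (y v : E) :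
    dirDerivLin f y v = dirDeriv f y v := rfl

open Filter Topology in
theorem dirDeriv_congr {f h : E → F} {y : E} (hfh : f =ᶠ[𝓝 y] h) (v : E) :
    dirDeriv f y v = dirDeriv h y v := by
  unfold dirDeriv
  refine Finset.sum_congr rfl fun j _ => ?_
  have h1 : (fun z => (Module.finBasis ℂ F).repr (f z) j) =ᶠ[𝓝 y]
      fun z => (Module.finBasis ℂ F).repr (h z) j := hfh.mono fun z hz => by simp only [hz]
  rw [h1.fderiv_eq]

theorem dirDeriv_map {f : E → F} {y : E} (hf : Regular (diffAlg y) f) (L : F →ₗ[ℂ] F') (v : E) :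
    dirDeriv (fun z => L (f z)) y v = L (dirDeriv f y v) :=
  ext_dual fun l => by
    rw [map_dirDeriv (hf.map L)]
    exact (map_dirDeriv hf v (l ∘ₗ L)).symm

theorem dirDeriv_add {f h : E → F} {y : E} (hf : Regular (diffAlg y) f)
    (hh : Regular (diffAlg y) h) (v : E) :
    dirDeriv (fun z => f z + h z) y v = dirDeriv f y v + dirDeriv h y v :=
  ext_dual fun l => by
    rw [map_dirDeriv (hf.add hh), map_add, map_dirDeriv hf, map_dirDeriv hh]
    simp only [map_add]
    rw [fderiv_fun_add (hf l) (hh l)]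
    rfl

theorem dirDeriv_const (x : F) (y v : E) : dirDeriv (fun _ : E => x) y v = 0 :=
  ext_dual fun l => by
    rw [map_dirDeriv (Regular.const _)]
    simp

theorem dirDeriv_sum {ι : Type*} (s : Finset ι) {f : ι → E → F} {y : E}
    (hf : ∀ i ∈ s, Regular (diffAlg y) (f i)) (v : E) :
    dirDeriv (fun z => ∑ i ∈ s, f i z) y v = ∑ i ∈ s, dirDeriv (f i) y v :=
  ext_dual fun l => by
    rw [map_dirDeriv (Regular.sum hf), map_sum]
    simp only [map_sum]
    rw [fderiv_fun_sum fun i hi => hf i hi l, _root_.sum_apply]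
    exact Finset.sum_congr rfl fun i hi => (map_dirDeriv (hf i hi) v l).symm

theorem dirDeriv_bilin {f : E → F} {h : E → F'} {y : E} (hf : Regular (diffAlg y) f)
    (hh : Regular (diffAlg y) h) (m : F →ₗ[ℂ] F' →ₗ[ℂ] F'') (v : E) :
    dirDeriv (fun z => m (f z) (h z)) y v =
      m (dirDeriv f y v) (h y) + m (f y) (dirDeriv h y v) :=
  ext_dual fun l => by
    let b := Module.finBasis ℂ F
    have h1 : (fun z => l (m (f z) (h z))) =
        fun z => ∑ i, b.coord i (f z) * l (m (b i) (h z)) := by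
      funext z
      conv_lhs => rw [← b.sum_repr (f z), map_sum, LinearMap.sum_apply]
      simp
    have h2 : ∀ x w, l (m x w) = ∑ i, b.coord i x * l (m (b i) w) := fun x w => by
      conv_lhs => rw [← b.sum_repr x, map_sum, LinearMap.sum_apply]
      simp
    have h3 : ∀ i, DifferentiableAt ℝ (fun z => b.coord i (f z)) y := fun i => hf _
    have h4 : ∀ i, DifferentiableAt ℝ (fun z => l (m (b i) (h z))) y := fun i => hh (l ∘ₗ m (b i))
    rw [map_dirDeriv (hf.bilin hh m), h1, fderiv_fun_sum fun i _ => (h3 i).fun_mul (h4 i),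
      _root_.sum_apply, map_add, h2, h2, ← Finset.sum_add_distrib]
    refine Finset.sum_congr rfl fun i _ => ?_
    rw [fderiv_fun_mul (h3 i) (h4 i), map_dirDeriv hf]
    have h5 := map_dirDeriv hh v (l ∘ₗ m (b i))
    simp only [LinearMap.comp_apply] at h5
    rw [h5]
    simp only [_root_.add_apply, _root_.smul_apply, smul_eq_mul]
    ring

theorem dirDeriv_mul {A : Type*} [Ring A] [Algebra ℂ A] [Module.Finite ℂ A] {f h : E → A} {y : E}
    (hf : Regular (diffAlg y) f) (hh : Regular (diffAlg y) h) (v : E) :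
    dirDeriv (fun z => f z * h z) y v = dirDeriv f y v * h y + f y * dirDeriv h y v :=
  dirDeriv_bilin hf hh (LinearMap.mul ℂ A) v

theorem dirDeriv_apply {T : E → F →ₗ[ℂ] F'} {f : E → F} {y : E} (hT : Regular (diffAlg y) T)
    (hf : Regular (diffAlg y) f) (v : E) :
    dirDeriv (fun z => T z (f z)) y v = dirDeriv T y v (f y) + T y (dirDeriv f y v) :=
  dirDeriv_bilin hT hf LinearMap.id v

omit [Module.Finite ℂ F] in
theorem Regular.comp_diff {T : E → E} {f : E → F} {y : E} (hT : DifferentiableAt ℝ T y)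
    (hf : Regular (diffAlg (T y)) f) : Regular (diffAlg y) (fun z => f (T z)) := fun l =>
  (show DifferentiableAt ℝ (fun z => l (f z)) (T y) from hf l).comp y hT

theorem dirDeriv_comp {T : E → E} {f : E → F} {y : E} (hT : DifferentiableAt ℝ T y)
    (hf : Regular (diffAlg (T y)) f) (v : E) :
    dirDeriv (fun z => f (T z)) y v = dirDeriv f (T y) (fderiv ℝ T y v) :=
  ext_dual fun l => by
    rw [map_dirDeriv (Regular.comp_diff hT hf), map_dirDeriv hf]
    have := fderiv_comp y (show DifferentiableAt ℝ (fun z => l (f z)) (T y) from hf l) hT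
    exact congrArg (fun D => D v) this

omit [Module.Finite ℂ F] in
theorem Regular.diff_of_stationary {f : E → F} {y : E} (hf : Regular (stationaryAlg y) f) :
    Regular (diffAlg y) f := fun l => (mem_stationaryAlg.1 (hf l)).differentiableAt

theorem dirDeriv_of_stationary {f : E → F} {y : E} (hf : Regular (stationaryAlg y) f) (v : E) :
    dirDeriv f y v = 0 :=
  ext_dual fun l => by
    rw [map_dirDeriv hf.diff_of_stationary, (mem_stationaryAlg.1 (hf l)).fderiv]
    simp

omit [Module.Finite ℂ F] in
theorem Regular.diff_of_smooth {f : E → F} {s : Set E} (hs : IsOpen s)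
    (hf : Regular (smoothAlg s) f) {y : E} (hy : y ∈ s) : Regular (diffAlg y) f := fun l =>
  ((mem_smoothAlg.1 (hf l)).contDiffAt (hs.mem_nhds hy)).differentiableAt (by simp)

theorem Regular.dirDeriv {f : E → F} {s : Set E} (hs : IsOpen s)
    (hf : Regular (smoothAlg s) f) (v : E) :
    Regular (smoothAlg s) (fun y => dirDeriv f y v) := fun l => by
  have h1 : ContDiffOn ℝ ∞ (fun y => fderiv ℝ (fun z => l (f z)) y v) s :=
    ((mem_smoothAlg.1 (hf l)).fderiv_of_isOpen hs (by simp)).clm_apply contDiffOn_const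
  exact h1.congr fun y hy => map_dirDeriv (hf.diff_of_smooth hs hy) v l

theorem dirDeriv_comm {f : E → F} {s : Set E} (hs : IsOpen s)
    (hf : Regular (smoothAlg s) f) {y : E} (hy : y ∈ s) (v w : E) :
    dirDeriv (fun z => dirDeriv f z v) y w = dirDeriv (fun z => dirDeriv f z w) y v := by
  have key : ∀ (l : Module.Dual ℂ F) (v w : E), l (dirDeriv (fun z => dirDeriv f z v) y w) =
      fderiv ℝ (fderiv ℝ (fun z => l (f z))) y w v := fun l v w => by
    rw [map_dirDeriv ((hf.dirDeriv hs v).diff_of_smooth hs hy)]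
    have h1 : (fun z => l (dirDeriv f z v)) =ᶠ[nhds y] fun z => fderiv ℝ (fun z => l (f z)) z v := by
      filter_upwards [hs.mem_nhds hy] with z hz using map_dirDeriv (hf.diff_of_smooth hs hz) v l
    have h2 : DifferentiableAt ℝ (fderiv ℝ (fun z => l (f z))) y :=
      (((mem_smoothAlg.1 (hf l)).fderiv_of_isOpen (m := ∞) hs (by simp)).contDiffAt
        (hs.mem_nhds hy)).differentiableAt (by simp)
    rw [h1.fderiv_eq, fderiv_clm_apply h2 (differentiableAt_const v)]
    simp
  refine ext_dual fun l => ?_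
  rw [key, key]
  have h3 : ContDiffAt ℝ ∞ (fun z => l (f z)) y :=
    (mem_smoothAlg.1 (hf l)).contDiffAt (hs.mem_nhds hy)
  exact (h3.isSymmSndFDerivAt (by
    rw [minSmoothness_of_isRCLikeNormedField]
    exact WithTop.coe_le_coe.2 (le_top : (2 : ℕ∞) ≤ ⊤))) w v

end DirDeriv

/-! ### The operator ∂̄ on an open set of E -/

section DelBar

variable {E : Type*} [NormedAddCommGroup E] [NormedSpace ℂ E] [Module.Finite ℂ E]

/-- The antilinear part of a real linear map. -/
def antilinearPart {F : Type*} [AddCommGroup F] [Module ℂ F] (L : E →ₗ[ℝ] F) (v : E) : F :=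
  (1 / 2 : ℂ) • (L v + Complex.I • L (Complex.I • v))

theorem antilinear_apply {F : Type*} [AddCommGroup F] [Module ℂ F] {σ : E → F}
    (hadd : ∀ v w, σ (v + w) = σ v + σ w) (hsmul : ∀ (c : ℂ) v, σ (c • v) = star c • σ v) (v : E) :
    σ v = ∑ k, star ((Module.finBasis ℂ E).coord k v) • σ (Module.finBasis ℂ E k) := by
  let σ' : E →+ F := ⟨⟨σ, by simpa using hsmul 0 0⟩, hadd⟩
  conv_lhs => rw [← (Module.finBasis ℂ E).sum_repr v]
  have := map_sum σ' (fun k => (Module.finBasis ℂ E).repr v k • Module.finBasis ℂ E k) Finset.univ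
  refine this.trans (Finset.sum_congr rfl fun k _ => hsmul _ _)

omit [Module.Finite ℂ E] in
theorem antilinearPart_add {F : Type*} [AddCommGroup F] [Module ℂ F] (L : E →ₗ[ℝ] F) (v w : E) :
    antilinearPart L (v + w) = antilinearPart L v + antilinearPart L w := by
  simp only [antilinearPart, smul_add, map_add]
  abel

omit [Module.Finite ℂ E] in
theorem antilinearPart_smul {F : Type*} [AddCommGroup F] [Module ℂ F] (L : E →ₗ[ℝ] F) (c : ℂ)
    (v : E) : antilinearPart L (c • v) = star c • antilinearPart L v := by
  have hc : c = (c.re : ℂ) + (c.im : ℂ) * Complex.I := (Complex.re_add_im c).symm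
  have hs : star c = (c.re : ℂ) - (c.im : ℂ) * Complex.I := by
    apply Complex.ext <;> simp
  have h1 : ∀ (r : ℝ) (w : E), L ((r : ℂ) • w) = (r : ℂ) • L w := fun r w => by
    have := L.map_smul r w
    simpa only [← Complex.coe_smul] using this
  have h2 : L (c • v) = (c.re : ℂ) • L v + (c.im : ℂ) • L (Complex.I • v) := by
    conv_lhs => rw [hc]
    rw [add_smul, mul_smul, map_add, h1, h1]
  have h3 : L (Complex.I • c • v) = (c.re : ℂ) • L (Complex.I • v) - (c.im : ℂ) • L v := by
    conv_lhs => rw [hc]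
    rw [smul_smul, show Complex.I * ((c.re : ℂ) + (c.im : ℂ) * Complex.I) =
      (c.re : ℂ) * Complex.I + ((-c.im : ℝ) : ℂ) by
        push_cast; linear_combination (c.im : ℂ) * Complex.I_mul_I,
      add_smul, mul_smul, map_add, h1, h1]
    push_cast
    rw [neg_smul, sub_eq_add_neg]
  rw [antilinearPart, antilinearPart, h2, h3, hs]
  match_scalars 
  · ring
  · linear_combination (1 / 2 : ℂ) * c.im * Complex.I_mul_I

/-- The value of `∂̄` on a form with given differential. -/
def delBarSymbol (L : E →ₗ[ℝ] CForm E) : CForm E :=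
  ∑ j, dzBar E j * antilinearPart L (Module.finBasis ℂ E j)

theorem localDelBar_eq (α : E → CForm E) (y : E) :
    localDelBar α y = delBarSymbol (dirDerivLin α y) := rfl

theorem dzBar_mul (j : Fin (Module.finrank ℂ E)) (x : CForm E) :
    dzBar E j * x = signForm x * dzBar E j := oneForm_mul_eq_signForm_mul _ _

theorem localDelBar_congr {α β : E → CForm E} {y : E} (h : α =ᶠ[nhds y] β) :
    localDelBar α y = localDelBar β y := by
  have : dirDerivLin α y = dirDerivLin β y := LinearMap.ext fun v => dirDeriv_congr h v
  rw [localDelBar_eq, localDelBar_eq, this]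

theorem wirtingerBar_mul {α β : E → CForm E} {y : E} (hα : Regular (diffAlg y) α)
    (hβ : Regular (diffAlg y) β) (j : Fin (Module.finrank ℂ E)) :
    wirtingerBar (fun z => α z * β z) y j =
      wirtingerBar α y j * β y + α y * wirtingerBar β y j := by
  simp only [wirtingerBar, dirDeriv_mul hα hβ, smul_add, add_mul, mul_add, smul_mul_assoc,
    mul_smul_comm]
  abel

theorem wirtingerBar_map {α : E → CForm E} {y : E} (hα : Regular (diffAlg y) α)
    (L : CForm E →ₗ[ℂ] CForm E) (j : Fin (Module.finrank ℂ E)) :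
    wirtingerBar (fun z => L (α z)) y j = L (wirtingerBar α y j) := by
  simp only [wirtingerBar, dirDeriv_map hα, map_smul, map_add]

/-- The Leibniz term that differentiates the operator vanishes. Applied to star and to C, this is
the whole benefit of osculating coordinates. -/
theorem wirtingerBar_apply_of_stationary {T : E → CForm E →ₗ[ℂ] CForm E} {α : E → CForm E} {y : E}
    (hT : Regular (stationaryAlg y) T) (hα : Regular (diffAlg y) α)
    (j : Fin (Module.finrank ℂ E)) :
    wirtingerBar (fun z => T z (α z)) y j = T y (wirtingerBar α y j) := by
  simp only [wirtingerBar, dirDeriv_apply hT.diff_of_stationary hα, dirDeriv_of_stationary hT,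
    map_smul, map_add, LinearMap.zero_apply, zero_add]

theorem localDelBar_mul {α β : E → CForm E} {y : E} (hα : Regular (diffAlg y) α)
    (hβ : Regular (diffAlg y) β) : localDelBar (fun z => α z * β z) y =
      localDelBar α y * β y + signForm (α y) * localDelBar β y := by
  simp only [localDelBar, wirtingerBar_mul hα hβ, mul_add, Finset.sum_add_distrib, Finset.sum_mul,
    Finset.mul_sum, mul_assoc]
  congr 1
  refine Finset.sum_congr rfl fun j _ => ?_
  rw [← mul_assoc, dzBar_mul, mul_assoc]

theorem localDelBar_add {α β : E → CForm E} {y : E} (hα : Regular (diffAlg y) α)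
    (hβ : Regular (diffAlg y) β) :
    localDelBar (fun z => α z + β z) y = localDelBar α y + localDelBar β y := by
  simp only [localDelBar, ← Finset.sum_add_distrib, ← mul_add, wirtingerBar, dirDeriv_add hα hβ]
  refine Finset.sum_congr rfl fun j _ => ?_
  congr 1
  module

theorem localDelBar_smul {α : E → CForm E} {y : E} (hα : Regular (diffAlg y) α) (c : ℂ) :
    localDelBar (fun z => c • α z) y = c • localDelBar α y := by
  have := wirtingerBar_map hα (c • LinearMap.id)
  simp only [LinearMap.smul_apply, LinearMap.id_apply] at this
  simp only [localDelBar, this, mul_smul_comm, Finset.smul_sum]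

theorem localDelBar_signForm {α : E → CForm E} {y : E} (hα : Regular (diffAlg y) α) :
    localDelBar (fun z => signForm (α z)) y = -signForm (localDelBar α y) := by
  have := wirtingerBar_map hα signForm.toLinearMap
  simp only [AlgHom.toLinearMap_apply] at this
  simp only [localDelBar, this, map_sum, map_mul, dzBar, signForm_oneForm, neg_mul,
    Finset.sum_neg_distrib, neg_neg]

theorem Regular.wirtingerBar {α : E → CForm E} {s : Set E} (hs : IsOpen s)
    (hα : Regular (smoothAlg s) α) (j : Fin (Module.finrank ℂ E)) :
    Regular (smoothAlg s) (fun y => wirtingerBar α y j) := by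
  have h2 := (hα.dirDeriv hs (Complex.I • Module.finBasis ℂ E j)).map
    (LinearMap.lsmul ℂ (CForm E) Complex.I)
  exact (((hα.dirDeriv hs _).add h2)).map (LinearMap.lsmul ℂ (CForm E) (1 / 2 : ℂ))

theorem Regular.localDelBar {α : E → CForm E} {s : Set E} (hs : IsOpen s)
    (hα : Regular (smoothAlg s) α) : Regular (smoothAlg s) (localDelBar α) :=
  Regular.sum fun j _ => (Regular.const _).mul (hα.wirtingerBar hs j)

theorem wirtingerBar_comm {α : E → CForm E} {s : Set E} (hs : IsOpen s)
    (hα : Regular (smoothAlg s) α) {y : E} (hy : y ∈ s) (j k : Fin (Module.finrank ℂ E)) :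
    wirtingerBar (fun z => wirtingerBar α z j) y k =
      wirtingerBar (fun z => wirtingerBar α z k) y j := by
  have h1 : ∀ v, Regular (diffAlg y) (fun z => dirDeriv α z v) := fun v =>
    (hα.dirDeriv hs v).diff_of_smooth hs hy
  have h2 : ∀ (j : Fin (Module.finrank ℂ E)) (w : E),
      dirDeriv (fun z => wirtingerBar α z j) y w = (1 / 2 : ℂ) •
        (dirDeriv (fun z => dirDeriv α z (Module.finBasis ℂ E j)) y w +
          Complex.I • dirDeriv (fun z => dirDeriv α z (Complex.I • Module.finBasis ℂ E j)) y w) := by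
    intro j w
    have h3 := (h1 (Complex.I • Module.finBasis ℂ E j)).map
      (LinearMap.lsmul ℂ (CForm E) Complex.I)
    have h4 := dirDeriv_map ((h1 (Module.finBasis ℂ E j)).add h3)
      (LinearMap.lsmul ℂ (CForm E) (1 / 2 : ℂ)) w
    rw [dirDeriv_add (h1 _) h3, dirDeriv_map (h1 _)] at h4
    exact h4
  have c := dirDeriv_comm hs hα hy
  rw [wirtingerBar, h2, h2]
  conv_rhs => rw [wirtingerBar, h2, h2]
  rw [c (Module.finBasis ℂ E j) (Module.finBasis ℂ E k),
    c (Module.finBasis ℂ E j) (Complex.I • Module.finBasis ℂ E k),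
    c (Complex.I • Module.finBasis ℂ E j) (Module.finBasis ℂ E k),
    c (Complex.I • Module.finBasis ℂ E j) (Complex.I • Module.finBasis ℂ E k)]
  module

theorem localDelBar_localDelBar {α : E → CForm E} {s : Set E} (hs : IsOpen s)
    (hα : Regular (smoothAlg s) α) {y : E} (hy : y ∈ s) : localDelBar (localDelBar α) y = 0 := by
  have hw : ∀ j, Regular (diffAlg y) (fun z => wirtingerBar α z j) := fun j =>
    (hα.wirtingerBar hs j).diff_of_smooth hs hy
  have h1 : ∀ k, wirtingerBar (localDelBar α) y k =
      ∑ j, dzBar E j * wirtingerBar (fun z => wirtingerBar α z j) y k := by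
    intro k
    have h2 : ∀ v, dirDeriv (localDelBar α) y v =
        ∑ j, dzBar E j * dirDeriv (fun z => wirtingerBar α z j) y v := fun v => by
      refine (dirDeriv_sum Finset.univ
        (fun j _ => (hw j).map (LinearMap.mulLeft ℂ (dzBar E j))) v).trans ?_
      exact Finset.sum_congr rfl fun j _ => dirDeriv_map (hw j) (LinearMap.mulLeft ℂ (dzBar E j)) v
    rw [wirtingerBar, h2, h2]
    simp only [wirtingerBar, Finset.smul_sum, ← Finset.sum_add_distrib, ← mul_smul_comm, ← mul_add]
  -- Mixed derivatives are symmetric and dz̄_j ∧ dz̄_k is antisymmetric, so swapping the indices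
  -- shows that the double sum is its own negative.
  have h3 : localDelBar (localDelBar α) y = -localDelBar (localDelBar α) y := by
    conv_lhs => rw [localDelBar]
    conv_rhs => rw [localDelBar]
    simp only [h1, Finset.mul_sum, ← Finset.sum_neg_distrib]
    rw [Finset.sum_comm]
    refine Finset.sum_congr rfl fun j _ => Finset.sum_congr rfl fun k _ => ?_
    rw [← mul_assoc, ← mul_assoc, wirtingerBar_comm hs hα hy, dzBar, dzBar, oneForm_mul_oneForm,
      neg_mul]
  have h4 : (2 : ℂ) • localDelBar (localDelBar α) y = 0 := by
    rw [two_smul]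
    nth_rw 1 [h3]
    exact neg_add_cancel _
  exact (smul_eq_zero.1 h4).resolve_left two_ne_zero

end DelBar

/-! ### ∂̄ commutes with holomorphic pullback -/

section HolomorphicPullback

variable {E : Type*} [NormedAddCommGroup E] [NormedSpace ℂ E] [Module.Finite ℂ E]

theorem oneForm_eq_sum_dzBar {φ : E →ₗ[ℝ] ℂ} (hφ : ∀ (c : ℂ) v, φ (c • v) = star c • φ v) :
    oneForm φ = ∑ j, φ (Module.finBasis ℂ E j) • dzBar E j := by
  have : φ = ∑ j, φ (Module.finBasis ℂ E j) • (Complex.conjAe.toLinearMap ∘ₗ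
      ((Module.finBasis ℂ E).coord j).restrictScalars ℝ) := by
    ext v
    rw [antilinear_apply (fun v w => map_add φ v w) hφ v]
    simp [LinearMap.sum_apply, mul_comm]
  conv_lhs => rw [this, map_sum]
  simp only [map_smul]
  rfl

theorem dzBar_apply_smul (k : Fin (Module.finrank ℂ E)) (A : E →ₗ[ℂ] E) :
    pullForm A (dzBar E k) =
      ∑ j, star ((Module.finBasis ℂ E).coord k (A (Module.finBasis ℂ E j))) • dzBar E j := by
  rw [dzBar, pullForm_oneForm, oneForm_eq_sum_dzBar]
  · rfl
  · intro c v
    simp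

/-- The antilinear part makes ∑ dz̄_j ⊗ e_j behave as the identity tensor on antilinear maps, so A
may be moved from the vectors e_j to the covectors dz̄_j. -/
theorem sum_dzBar_mul_pullForm (L : E →ₗ[ℝ] CForm E) (A : E →ₗ[ℂ] E) :
    ∑ j, dzBar E j * pullForm A (antilinearPart L (A (Module.finBasis ℂ E j))) =
      pullForm A (delBarSymbol L) := by
  have h : ∀ j, pullForm A (antilinearPart L (A (Module.finBasis ℂ E j))) =
      ∑ k, star ((Module.finBasis ℂ E).coord k (A (Module.finBasis ℂ E j))) •
        pullForm A (antilinearPart L (Module.finBasis ℂ E k)) := fun j => by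
    rw [antilinear_apply (antilinearPart_add L) (antilinearPart_smul L), map_sum]
    simp only [map_smul]
  simp only [h, delBarSymbol, map_sum, map_mul, dzBar_apply_smul, Finset.mul_sum, Finset.sum_mul]
  rw [Finset.sum_comm]
  refine Finset.sum_congr rfl fun j _ => Finset.sum_congr rfl fun k _ => ?_
  rw [mul_smul_comm, smul_mul_assoc]

theorem dirDeriv_covector {φ : E → E →ₗ[ℝ] ℂ} {y v : E} {ψ : E →ₗ[ℝ] ℂ}
    (hφ : ∀ w, DifferentiableAt ℝ (fun z => φ z w) y)
    (hψ : ∀ w, fderiv ℝ (fun z => φ z w) y v = ψ w) :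
    dirDeriv (fun z => oneForm (φ z)) y v = oneForm ψ := by
  simp only [← sum_smul_coord]
  have h1 : ∀ j, Regular (diffAlg y) (fun z => φ z (Module.finBasis ℝ E j)) := fun j =>
    Regular.of_mem (hφ _)
  have h2 : ∀ j, Regular (diffAlg y) (fun z => φ z (Module.finBasis ℝ E j) •
    realOneForm ((Module.finBasis ℝ E).coord j)) := fun j =>
    Regular.smul (hφ _) (Regular.const _)
  rw [dirDeriv_sum _ fun j _ => h2 j]
  refine Finset.sum_congr rfl fun j _ => ?_
  have h3 := dirDeriv_map (h1 j) (LinearMap.toSpanSingleton ℂ (CForm E)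
    (realOneForm ((Module.finBasis ℝ E).coord j))) v
  have h4 := map_dirDeriv (h1 j) v LinearMap.id
  simp only [LinearMap.id_apply] at h4
  rw [h4, hψ] at h3
  exact h3

/-- The pullback of a form along a map holomorphic near the point considered. -/
def pullAlong (T : E → E) (α : E → CForm E) (z : E) : CForm E :=
  pullForm (fderiv ℂ T z).toLinearMap (α (T z))

theorem differentiableAt_covector_fderiv {T : E → E} {y : E} (hT : ContDiffAt ℂ 2 T y)
    (ξ : E →ₗ[ℝ] ℂ) (w : E) :
    HasFDerivAt (fun z => ξ (fderiv ℂ T z w)) ((ξ.toContinuousLinearMap ∘L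
      ((ContinuousLinearMap.apply ℂ E w) ∘L
        (fderiv ℂ (fderiv ℂ T) y)).restrictScalars ℝ)) y := by
  have h1 : DifferentiableAt ℂ (fderiv ℂ T) y :=
    (hT.fderiv_right (m := 1) (by norm_num)).differentiableAt (by norm_num)
  have h2 : HasFDerivAt (fun z => fderiv ℂ T z w)
      ((ContinuousLinearMap.apply ℂ E w) ∘L (fderiv ℂ (fderiv ℂ T) y)) y :=
    (ContinuousLinearMap.apply ℂ E w).hasFDerivAt.comp y h1.hasFDerivAt
  exact ξ.toContinuousLinearMap.hasFDerivAt.comp y (h2.restrictScalars ℝ)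

theorem Regular.pullForm_fderiv {T : E → E} {y : E} (hT : ContDiffAt ℂ 2 T y) :
    Regular (diffAlg y) (fun z => (_root_.pullForm (fderiv ℂ T z).toLinearMap).toLinearMap) :=
  Regular.pullForm fun ξ w => (differentiableAt_covector_fderiv hT ξ w).differentiableAt

/-- Differentiating the pullback operator itself contributes nothing to ∂̄. The contribution obeys a
signed Leibniz rule in x, which reduces the claim to covectors; there it is the symmetry of the
second derivative of T against the antisymmetry of the wedge product. -/
theorem sum_dzBar_mul_deriv_pullForm {T : E → E} {y : E} (hT : ContDiffAt ℂ 2 T y) (x : CForm E) :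
    ∑ j, dzBar E j * antilinearPart (dirDerivLin (fun z =>
      (pullForm (fderiv ℂ T z).toLinearMap).toLinearMap) y) (Module.finBasis ℂ E j) x = 0 := by
  let M := fun z => (pullForm (fderiv ℂ T z).toLinearMap).toLinearMap
  have hM : Regular (diffAlg y) M := Regular.pullForm_fderiv hT
  have hMx : ∀ x, Regular (diffAlg y) (fun z => M z x) := fun x => hM.map (LinearMap.applyₗ x)
  have hN : ∀ (v : E) x, antilinearPart (dirDerivLin M y) v x =
      antilinearPart (dirDerivLin (fun z => M z x) y) v := by
    intro v x
    have h1 : ∀ v, dirDeriv (fun z => M z x) y v = dirDeriv M y v x :=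
      dirDeriv_map hM (LinearMap.applyₗ x)
    simp [antilinearPart, h1]
  change ∑ j, dzBar E j * antilinearPart (dirDerivLin M y) (Module.finBasis ℂ E j) x = 0
  induction x using CForm.induction with
  | algebraMap r =>
    have h1 : (fun z => M z (algebraMap ℂ (CForm E) r)) = fun _ => algebraMap ℂ (CForm E) r := by
      funext z; simp [M]
    refine Finset.sum_eq_zero fun j _ => ?_
    rw [hN, h1]
    simp [antilinearPart, dirDeriv_const]
  | add x x' hx hx' => simp only [map_add, mul_add, Finset.sum_add_distrib, hx, hx', add_zero]
  | oneForm_mul ξ x hx =>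
    have hmul : (fun z => M z (oneForm ξ * x)) = fun z => M z (oneForm ξ) * M z x := by
      funext z; simp [M]
    have h1 : ∀ v, antilinearPart (dirDerivLin M y) v (oneForm ξ * x) =
        antilinearPart (dirDerivLin M y) v (oneForm ξ) * M y x +
          M y (oneForm ξ) * antilinearPart (dirDerivLin M y) v x := by
      intro v
      rw [hN, hN, hN, hmul]
      simp only [antilinearPart, dirDerivLin_apply, dirDeriv_mul (hMx _) (hMx x)]
      simp only [smul_add, add_mul, mul_add, smul_mul_assoc, mul_smul_comm]
      abel
    have h2 : ∀ j, dzBar E j * (M y (oneForm ξ) *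
        antilinearPart (dirDerivLin M y) (Module.finBasis ℂ E j) x) =
        -(M y (oneForm ξ) * (dzBar E j *
          antilinearPart (dirDerivLin M y) (Module.finBasis ℂ E j) x)) := fun j => by
      have h3 : dzBar E j * M y (oneForm ξ) = -(M y (oneForm ξ) * dzBar E j) := by
        change dzBar E j * pullForm _ (oneForm ξ) = -(pullForm _ (oneForm ξ) * dzBar E j)
        rw [pullForm_oneForm, dzBar, oneForm_mul_oneForm]
      rw [← mul_assoc, h3, neg_mul, mul_assoc]
    have hsplit : ∑ j, dzBar E j *
        antilinearPart (dirDerivLin M y) (Module.finBasis ℂ E j) (oneForm ξ * x) =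
        (∑ j, dzBar E j * antilinearPart (dirDerivLin M y) (Module.finBasis ℂ E j) (oneForm ξ)) *
          M y x - M y (oneForm ξ) *
            ∑ j, dzBar E j * antilinearPart (dirDerivLin M y) (Module.finBasis ℂ E j) x := by
      rw [Finset.sum_mul, Finset.mul_sum, ← Finset.sum_sub_distrib]
      refine Finset.sum_congr rfl fun j _ => ?_
      rw [h1, mul_add, h2, mul_assoc, sub_eq_add_neg]
    rw [hsplit, hx, mul_zero, sub_zero]
    suffices h0 : ∑ j, dzBar E j *
        antilinearPart (dirDerivLin M y) (Module.finBasis ℂ E j) (oneForm ξ) = 0 by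
      rw [h0, zero_mul]
    let Q := fderiv ℂ (fderiv ℂ T) y
    have hQ : ∀ v w, Q v w = Q w v := fun v w =>
      (hT.isSymmSndFDerivAt (by rw [minSmoothness_of_isRCLikeNormedField])) v w
    have h4 : ∀ v, dirDeriv (fun z => M z (oneForm ξ)) y v =
        oneForm (ξ ∘ₗ (Q v).toLinearMap.restrictScalars ℝ) := fun v => by
      have h5 : (fun z => M z (oneForm ξ)) = fun z =>
          oneForm (ξ ∘ₗ (fderiv ℂ T z).toLinearMap.restrictScalars ℝ) :=
        funext fun z => pullForm_oneForm _ _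
      rw [h5]
      refine dirDeriv_covector
        (fun w => (differentiableAt_covector_fderiv hT ξ w).differentiableAt) fun w => ?_
      exact congrArg (fun D => D v) (differentiableAt_covector_fderiv hT ξ w).fderiv
    -- Since Q is complex linear in v, taking the antilinear part of v ↦ ξ ∘ Q v amounts to
    -- replacing ξ by its antilinear part; the result expands in the dz̄_k alone.
    let ξ' : E →ₗ[ℝ] ℂ :=
      { toFun := antilinearPart ξ
        map_add' := antilinearPart_add ξ
        map_smul' := fun r v => by
          have := antilinearPart_smul ξ (r : ℂ) v
          rw [Complex.coe_smul] at this
          rw [this]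
          simp }
    have h6 : ∀ v, antilinearPart (dirDerivLin (fun z => M z (oneForm ξ)) y) v =
        oneForm (ξ' ∘ₗ (Q v).toLinearMap.restrictScalars ℝ) := by
      intro v
      rw [antilinearPart, dirDerivLin_apply, dirDerivLin_apply, h4, h4, ← map_smul, ← map_add,
        ← map_smul]
      congr 1
      ext w
      simp [ξ', antilinearPart, mul_add]
    have h7 : ∀ v, oneForm (ξ' ∘ₗ (Q v).toLinearMap.restrictScalars ℝ) =
        ∑ k, ξ' (Q v (Module.finBasis ℂ E k)) • dzBar E k := by
      intro v
      refine oneForm_eq_sum_dzBar fun c w => ?_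
      change antilinearPart ξ (Q v (c • w)) = _
      rw [map_smul, antilinearPart_smul]
      rfl
    simp only [hN, h6, h7, Finset.mul_sum]
    have h8 : ∀ z : CForm E, z = -z → z = 0 := fun z hz => by
      have h9 : (2 : ℂ) • z = 0 := by rw [two_smul]; nth_rw 1 [hz]; exact neg_add_cancel z
      exact (smul_eq_zero.1 h9).resolve_left two_ne_zero
    apply h8
    conv_rhs => rw [Finset.sum_comm]
    simp only [← Finset.sum_neg_distrib]
    refine Finset.sum_congr rfl fun j _ => Finset.sum_congr rfl fun k _ => ?_
    rw [mul_smul_comm, mul_smul_comm, hQ, dzBar, dzBar, oneForm_mul_oneForm, smul_neg]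

/-- The derivative of the pullback has two terms: one differentiates the operator T'^* and vanishes
by the previous lemma, the other differentiates α along T' and gives the pullback of ∂̄α. -/
theorem localDelBar_pullAlong {T : E → E} {y : E} {α : E → CForm E} (hT : ContDiffAt ℂ 2 T y)
    (hα : Regular (diffAlg (T y)) α) :
    localDelBar (pullAlong T α) y =
      pullForm (fderiv ℂ T y).toLinearMap (localDelBar α (T y)) := by
  let M := fun z => (pullForm (fderiv ℂ T z).toLinearMap).toLinearMap
  have hM : Regular (diffAlg y) M := Regular.pullForm_fderiv hT
  have hTC : DifferentiableAt ℂ T y := hT.differentiableAt (by norm_num)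
  have hTR : DifferentiableAt ℝ T y := hTC.restrictScalars ℝ
  have hfd : ∀ v, fderiv ℝ T y v = fderiv ℂ T y v := fun v => by
    rw [hTC.fderiv_restrictScalars ℝ]; rfl
  have h1 : ∀ v, dirDeriv (pullAlong T α) y v = dirDeriv M y v (α (T y)) +
      M y (dirDeriv α (T y) (fderiv ℂ T y v)) := fun v => by
    rw [← hfd, ← dirDeriv_comp hTR hα]
    exact dirDeriv_apply hM (Regular.comp_diff hTR hα) v
  have h2 : ∀ j, wirtingerBar (pullAlong T α) y j =
      antilinearPart (dirDerivLin M y) (Module.finBasis ℂ E j) (α (T y)) +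
      pullForm (fderiv ℂ T y).toLinearMap (antilinearPart (dirDerivLin α (T y))
        ((fderiv ℂ T y).toLinearMap (Module.finBasis ℂ E j))) := fun j => by
    simp only [wirtingerBar, h1, antilinearPart, dirDerivLin_apply, map_smul, map_add,
      LinearMap.smul_apply, LinearMap.add_apply, ContinuousLinearMap.coe_coe]
    change _ = _ + (1 / 2 : ℂ) • (M y _ + Complex.I • M y _)
    module
  rw [localDelBar]
  simp only [h2, mul_add, Finset.sum_add_distrib]
  rw [sum_dzBar_mul_deriv_pullForm hT, zero_add, sum_dzBar_mul_pullForm]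
  rfl

end HolomorphicPullback

/-! ### What dω = 0 says about the derivative of the metric -/

section Closedness

variable {E : Type*} [NormedAddCommGroup E] [NormedSpace ℂ E] [Module.Finite ℂ E]

/-- The value of `d = ∂ + ∂̄` on a form with given differential. -/
def dSymbol (L : E →ₗ[ℝ] CForm E) : CForm E :=
  ∑ j, (dz E j * ((1 / 2 : ℂ) • (L (Module.finBasis ℂ E j) -
    Complex.I • L (Complex.I • Module.finBasis ℂ E j))) +
    dzBar E j * antilinearPart L (Module.finBasis ℂ E j))

theorem localDel_add_localDelBar (α : E → CForm E) (y : E) :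
    localDel α y + localDelBar α y = dSymbol (dirDerivLin α y) := by
  rw [localDel, localDelBar, ← Finset.sum_add_distrib]
  rfl

/-- Cartan's formula for a constant vector field u, where the Lie derivative is the directional
derivative. It lets dω be evaluated on vectors without expanding in coordinates. -/
theorem interiorProd_dSymbol (u : E) (L : E →ₗ[ℝ] CForm E) :
    interiorProd (evalCov u) (dSymbol L) =
      L u - dSymbol ((interiorProd (evalCov u)).restrictScalars ℝ ∘ₗ L) := by
  have hu : L u = ∑ j, ((((Module.finBasis ℂ E).coord j u).re : ℂ) • L (Module.finBasis ℂ E j) +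
      (((Module.finBasis ℂ E).coord j u).im : ℂ) •
        L (Complex.I • Module.finBasis ℂ E j)) := by
    conv_lhs => rw [← (Module.finBasis ℂ E).sum_repr u, map_sum]
    refine Finset.sum_congr rfl fun j _ => ?_
    have h1 : ∀ c : ℂ, c • Module.finBasis ℂ E j = c.re • Module.finBasis ℂ E j +
        c.im • (Complex.I • Module.finBasis ℂ E j) := fun c => by
      conv_lhs => rw [← Complex.re_add_im c, add_smul, mul_smul]
      simp only [Complex.coe_smul]
    rw [h1, map_add, map_smul, map_smul]
    simp only [Complex.coe_smul]
    rfl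
  have hz : ∀ j x, interiorProd (evalCov u) (dz E j * x) =
      (Module.finBasis ℂ E).coord j u • x - dz E j * interiorProd (evalCov u) x := fun j x =>
    interiorProd_oneForm_mul _ _ _
  have hzb : ∀ j x, interiorProd (evalCov u) (dzBar E j * x) =
      star ((Module.finBasis ℂ E).coord j u) • x - dzBar E j * interiorProd (evalCov u) x :=
    fun j x => interiorProd_oneForm_mul _ _ _
  rw [dSymbol, map_sum, hu, dSymbol, ← Finset.sum_sub_distrib]
  refine Finset.sum_congr rfl fun j _ => ?_
  rw [map_add, hz, hzb]
  generalize (Module.finBasis ℂ E).coord j u = c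
  have hc : c = (c.re : ℂ) + (c.im : ℂ) * Complex.I := (Complex.re_add_im c).symm
  have hs : star c = (c.re : ℂ) - (c.im : ℂ) * Complex.I := by
    apply Complex.ext <;> simp
  simp only [antilinearPart, LinearMap.comp_apply, LinearMap.restrictScalars_apply, map_smul,
    map_sub, map_add]
  rw [hs]
  nth_rw 1 [hc]
  have hI := Complex.I_mul_I
  have e : ∀ a b p q : CForm E, ∀ x y : CForm E, ∀ r t : ℂ,
      (r + t * Complex.I) • (1 / 2 : ℂ) • (a - Complex.I • b) - x +
        ((r - t * Complex.I) • (1 / 2 : ℂ) • (a + Complex.I • b) - y) =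
      r • a + t • b - (x + y) := fun a b p q x y r t => by
    match_scalars
    · ring
    · linear_combination (-t) * hI
    · ring
    · ring
  exact e _ _ 0 0 _ _ _ _

theorem dSymbol_zero : dSymbol (0 : E →ₗ[ℝ] CForm E) = 0 := by
  simp [dSymbol, antilinearPart]

theorem interiorProd_interiorProd_fundamentalForm {V : Type*} [AddCommGroup V] [Module ℂ V]
    [Module.Finite ℂ V] {g : V →ₗ[ℝ] V →ₗ[ℝ] ℝ} (hg : IsHermitianForm g) (u v : V) :
    interiorProd (evalCov v) (interiorProd (evalCov u) (fundamentalForm g)) =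
      algebraMap ℂ (CForm V) (g (Complex.I • u) v) := by
  rw [← hg.cometric_flatCov u, ← sharpProd, hg.sharpProd_fundamentalForm, map_neg,
    interiorProd_oneForm, ← map_neg]
  congr 1
  have : g (Complex.I • u) v = -g u (Complex.I • v) := by
    rw [← hg.inner_J u, smul_smul, Complex.I_mul_I]; simp
  simp [this]

theorem closed_fundamentalForm {g : E → E →ₗ[ℝ] E →ₗ[ℝ] ℝ} {y : E}
    (hpos : ∀ᶠ z in nhds y, IsHermitianForm (g z))
    (hd : ∀ u v, DifferentiableAt ℝ (fun z => g z u v) y)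
    (hK : localDel (fun z => fundamentalForm (g z)) y +
      localDelBar (fun z => fundamentalForm (g z)) y = 0) (u v w : E) :
    fderiv ℝ (fun z => g z (Complex.I • v) w) y u + fderiv ℝ (fun z => g z (Complex.I • w) u) y v +
      fderiv ℝ (fun z => g z (Complex.I • u) v) y w = 0 := by
  have hdC : ∀ u v, (fun z => (g z u v : ℂ)) ∈ diffAlg y := fun u v =>
    (Complex.ofRealCLM.differentiableAt).comp y (hd u v)
  have hR : Regular (diffAlg y) (fun z => fundamentalForm (g z)) := Regular.fundamentalForm hdC
  let L := dirDerivLin (fun z => fundamentalForm (g z)) y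
  have hL : ∀ u v w, interiorProd (evalCov v) (interiorProd (evalCov u) (L w)) =
      algebraMap ℂ (CForm E) (fderiv ℝ (fun z => g z (Complex.I • u) v) y w : ℝ) := by
    intro u v w
    have h1 := dirDeriv_map hR (interiorProd (evalCov v) ∘ₗ interiorProd (evalCov u)) w
    have h2 : (fun z => (interiorProd (evalCov v) ∘ₗ interiorProd (evalCov u))
        (fundamentalForm (g z))) =ᶠ[nhds y]
        fun z => Algebra.linearMap ℂ (CForm E) (g z (Complex.I • u) v : ℂ) :=
      hpos.mono fun z hz => interiorProd_interiorProd_fundamentalForm hz u v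
    rw [dirDeriv_congr h2, dirDeriv_map (Regular.of_mem (hdC _ _))] at h1
    have h3 := map_dirDeriv (Regular.of_mem (hdC (Complex.I • u) v)) w LinearMap.id
    simp only [LinearMap.id_apply] at h3
    have h4 : fderiv ℝ (fun z => (g z (Complex.I • u) v : ℂ)) y w =
        (fderiv ℝ (fun z => g z (Complex.I • u) v) y w : ℝ) := by
      have := (Complex.ofRealCLM.hasFDerivAt.comp y (hd (Complex.I • u) v).hasFDerivAt).fderiv
      exact congrArg (fun D => D w) this
    rw [h3, h4] at h1
    exact h1.symm
  have h0 : dSymbol L = 0 := by rw [← localDel_add_localDelBar]; exact hK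
  -- Three applications of Cartan's formula turn dω = 0 into ∂_u ω(v,w) - ∂_v ω(u,w) + ∂_w ω(u,v) =
  -- 0; the last remainder, `h2`, contracts a scalar.
  have h1 := congrArg (fun x => interiorProd (evalCov w) (interiorProd (evalCov v)
    (interiorProd (evalCov u) x))) h0
  simp only [map_zero, interiorProd_dSymbol, map_sub, hL] at h1
  have h2 : (interiorProd (evalCov w)).restrictScalars ℝ ∘ₗ
      ((interiorProd (evalCov v)).restrictScalars ℝ ∘ₗ
        ((interiorProd (evalCov u)).restrictScalars ℝ ∘ₗ L)) = 0 := by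
    ext x
    simp [hL]
  rw [h2, dSymbol_zero] at h1
  simp only [LinearMap.comp_apply, LinearMap.restrictScalars_apply, hL, sub_zero, ← map_sub] at h1
  have h3 := (ExteriorAlgebra.algebraMap_eq_zero_iff _ _).1 h1
  have h4 : fderiv ℝ (fun z => g z (Complex.I • v) w) y u -
      (fderiv ℝ (fun z => g z (Complex.I • u) w) y v -
        fderiv ℝ (fun z => g z (Complex.I • u) v) y w) = 0 := by
    exact_mod_cast h3
  have h5 : fderiv ℝ (fun z => g z (Complex.I • w) u) y v =
      -fderiv ℝ (fun z => g z (Complex.I • u) w) y v := by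
    have h6 : (fun z => g z (Complex.I • w) u) =ᶠ[nhds y] fun z => -g z (Complex.I • u) w :=
      hpos.mono fun z hz => by
        change g z (Complex.I • w) u = -g z (Complex.I • u) w
        rw [hz.symm (Complex.I • u), ← hz.inner_J _ u, smul_smul, Complex.I_mul_I]
        simp
    rw [h6.fderiv_eq, fderiv_fun_neg]
    rfl
  rw [h5]
  linarith

end Closedness

/-! ### Osculation: removing the first derivative of the metric -/

section Osculation

/-- Here a is the derivative of the metric, with the direction first. J-invariance of a makes the
candidate B complex linear in the second slot; closedness makes it symmetric, hence complex
bilinear, as the second derivative of a holomorphic map must be. -/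
theorem exists_quadratic_correction {V : Type*} [AddCommGroup V] [Module ℂ V] [Module.Finite ℂ V]
    {g : V →ₗ[ℝ] V →ₗ[ℝ] ℝ} (hg : IsHermitianForm g) (a : V →ₗ[ℝ] V →ₗ[ℝ] V →ₗ[ℝ] ℝ)
    (hsymm : ∀ w u v, a w u v = a w v u)
    (hJ : ∀ w u v, a w (Complex.I • u) (Complex.I • v) = a w u v)
    (hcl : ∀ u v w, a u (Complex.I • v) w + a v (Complex.I • w) u + a w (Complex.I • u) v = 0) :
    ∃ B : V →ₗ[ℂ] V →ₗ[ℂ] V, (∀ u v, B u v = B v u) ∧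
      ∀ w u v, a w u v + g (B w u) v + g u (B w v) = 0 := by
  have hII : ∀ u : V, Complex.I • Complex.I • u = -u := fun u => by
    rw [smul_smul, Complex.I_mul_I, neg_one_smul]
  have hJ1 : ∀ w u v, a w (Complex.I • u) v = -a w u (Complex.I • v) := fun w u v => by
    rw [← hJ w u, hII]; simp
  have hg1 : ∀ u v, g (Complex.I • u) v = -g u (Complex.I • v) := fun u v => by
    rw [← hg.inner_J u, hII]; simp
  -- Minus the part of a that is complex linear in the direction w. In g(B_w u, v) + g(u, B_w v) the
  -- terms with a_{iw} cancel, and the two halves of a_w add up to -a_w(u, v).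
  have hex : ∀ w u, ∃ b, ∀ v,
      g b v = -(1 / 2) * (a w u v + a (Complex.I • w) u (Complex.I • v)) := by
    intro w u
    obtain ⟨b, hb⟩ := hg.exists_flatCov_eq
      ((-(1 / 2) : ℝ) • (a w u + a (Complex.I • w) u ∘ₗ jMap V))
    exact ⟨b, fun v => by rw [hb]; simp only [LinearMap.smul_apply, LinearMap.add_apply,
      LinearMap.comp_apply, jMap_apply, smul_eq_mul]⟩
  choose b hb using hex
  have hext : ∀ p q, (∀ v, g p v = g q v) → p = q := fun p q h => by
    by_contra hne
    have := hg.pos (p - q) (sub_ne_zero.2 hne)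
    rw [g.map_sub, LinearMap.sub_apply, h, sub_self] at this
    exact lt_irrefl _ this
  have hcomm : ∀ u v, b u v = b v u := fun w u => hext _ _ fun v => by
    rw [hb, hb]
    -- The only use of closedness, for the triples (w, u, iv) and (iw, iu, iv); J-invariance and
    -- symmetry of a turn their combination into the symmetry of b.
    have h1 := hcl w u (Complex.I • v)
    have h2 := hcl (Complex.I • w) (Complex.I • u) (Complex.I • v)
    have e1 := hJ w u v
    have e2 := hsymm u v w
    have e3 := hsymm (Complex.I • u) v (Complex.I • w)
    have e4 := hJ1 (Complex.I • u) w v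
    have e5 := hsymm (Complex.I • v) w (Complex.I • u)
    have e6 := hJ1 (Complex.I • v) w u
    rw [hII] at h1
    rw [hII, hII, hII] at h2
    simp only [map_neg, LinearMap.neg_apply] at h1 h2
    linarith
  have hsmul : ∀ (c : ℂ) (x : V), c • x = c.re • x + c.im • (Complex.I • x) := fun c x => by
    conv_lhs => rw [← Complex.re_add_im c, add_smul, mul_smul]
    simp only [Complex.coe_smul]
  have hadd2 : ∀ w u u', b w (u + u') = b w u + b w u' := fun w u u' => hext _ _ fun v => by
    rw [map_add, LinearMap.add_apply, hb, hb, hb]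
    simp only [map_add, LinearMap.add_apply]
    ring
  have hsmul2 : ∀ (c : ℂ) w u, b w (c • u) = c • b w u := fun c w u => hext _ _ fun v => by
    rw [hsmul c, hsmul c, hb]
    simp only [map_add, map_smul, LinearMap.add_apply, LinearMap.smul_apply, smul_eq_mul]
    rw [hg1, hb, hb, hJ1, hJ1, hII]
    simp only [map_neg]
    ring
  refine ⟨LinearMap.mk₂ ℂ b (fun w w' u => by rw [hcomm, hadd2, hcomm u, hcomm u])
    (fun c w u => by rw [hcomm, hsmul2, hcomm u]) hadd2 (fun c w u => hsmul2 c w u),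
    hcomm, fun w u v => ?_⟩
  simp only [LinearMap.mk₂_apply]
  rw [hg.symm u, hb, hb, hsymm w v u, hsymm (Complex.I • w) v, hJ1]
  ring

variable {E : Type*} [NormedAddCommGroup E] [NormedSpace ℂ E] [Module.Finite ℂ E]

theorem hasFDerivAt_bilin_apply {m : E → E →ₗ[ℝ] E →ₗ[ℝ] ℝ} {D : E → E → E →L[ℝ] ℝ} {y : E}
    (hm : ∀ u v, HasFDerivAt (fun z => m z u v) (D u v) y)
    {p q : E → E} {p' q' : E →L[ℝ] E} (hp : HasFDerivAt p p' y) (hq : HasFDerivAt q q' y)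
    (h0 : ∀ w, D (p y) (q y) w + m y (p' w) (q y) + m y (p y) (q' w) = 0) :
    HasFDerivAt (fun z => m z (p z) (q z)) (0 : E →L[ℝ] ℝ) y := by
  let b := Module.finBasis ℝ E
  have hcoord : ∀ i, ∀ x : E, b.coord i x = (b.coord i).toContinuousLinearMap x := fun _ _ => rfl
  have hexp : ∀ (l : E →ₗ[ℝ] E →ₗ[ℝ] ℝ) (x x' : E),
      l x x' = ∑ i, ∑ j, b.coord i x * (b.coord j x' * l (b i) (b j)) := by
    intro l x x'
    conv_lhs => rw [← b.sum_repr x, ← b.sum_repr x']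
    simp only [map_sum, map_smul, LinearMap.sum_apply, LinearMap.smul_apply, smul_eq_mul,
      Module.Basis.coord_apply]
    rw [Finset.sum_comm]
    refine Finset.sum_congr rfl fun i _ => ?_
    rw [Finset.mul_sum]
    refine Finset.sum_congr rfl fun j _ => ?_
    ring
  have hpi : ∀ i, HasFDerivAt (fun z => b.coord i (p z))
      ((b.coord i).toContinuousLinearMap ∘L p') y := fun i =>
    (b.coord i).toContinuousLinearMap.hasFDerivAt.comp y hp
  have hqi : ∀ i, HasFDerivAt (fun z => b.coord i (q z))
      ((b.coord i).toContinuousLinearMap ∘L q') y := fun i =>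
    (b.coord i).toContinuousLinearMap.hasFDerivAt.comp y hq
  have h1 := HasFDerivAt.fun_sum (u := Finset.univ) fun i _ =>
    HasFDerivAt.fun_sum (u := Finset.univ) fun j _ =>
      (hpi i).fun_mul ((hqi j).fun_mul (hm (b i) (b j)))
  have h2 : (fun z => m z (p z) (q z)) = fun z => ∑ i, ∑ j,
      b.coord i (p z) * (b.coord j (q z) * m z (b i) (b j)) := funext fun z => hexp _ _ _
  rw [h2]
  refine h1.congr_fderiv ?_
  ext w
  -- `D` is only assumed to give the derivatives; its bilinear expansion in a basis comes from
  -- uniqueness of the derivative.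
  have hDl : D (p y) (q y) w = ∑ i, ∑ j, b.coord i (p y) * (b.coord j (q y) * D (b i) (b j) w) := by
    have h3 := HasFDerivAt.fun_sum (u := Finset.univ) fun i _ =>
      HasFDerivAt.fun_sum (u := Finset.univ) fun j _ =>
        ((hm (b i) (b j)).const_mul (b.coord j (q y))).const_mul (b.coord i (p y))
    have h4 : (fun z => m z (p y) (q y)) = fun z => ∑ i, ∑ j,
      b.coord i (p y) * (b.coord j (q y) * m z (b i) (b j)) := funext fun z => hexp _ _ _
    rw [← h4] at h3
    rw [(hm _ _).unique h3]
    simp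
  have h5 := h0 w
  rw [hDl, hexp (m y) (p' w), hexp (m y) (p y) (q' w)] at h5
  rw [_root_.zero_apply, ← h5]
  simp only [_root_.sum_apply, _root_.add_apply, _root_.smul_apply, smul_eq_mul,
    ContinuousLinearMap.comp_apply, ← Finset.sum_add_distrib, ← hcoord]
  refine Finset.sum_congr rfl fun i _ => Finset.sum_congr rfl fun j _ => ?_
  ring

end Osculation

/-! ### Osculating coordinates and the pointwise Kähler identity -/

section KahlerIdentities

variable {E : Type*} [NormedAddCommGroup E] [NormedSpace ℂ E] [Module.Finite ℂ E]

/-- The pullback of a bilinear form along a linear map. -/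
def pullMetric {V W : Type*} [AddCommGroup V] [Module ℂ V] [AddCommGroup W] [Module ℂ W]
    (g : W →ₗ[ℝ] W →ₗ[ℝ] ℝ) (A : V →ₗ[ℂ] W) : V →ₗ[ℝ] V →ₗ[ℝ] ℝ :=
  g.compl₁₂ (A.restrictScalars ℝ) (A.restrictScalars ℝ)

@[simp] theorem pullMetric_apply {V W : Type*} [AddCommGroup V] [Module ℂ V] [AddCommGroup W]
    [Module ℂ W] (g : W →ₗ[ℝ] W →ₗ[ℝ] ℝ) (A : V →ₗ[ℂ] W) (u v : V) :
    pullMetric g A u v = g (A u) (A v) := rfl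

/-- A holomorphic change of coordinates `T` fixing `y` to first order, in which the metric `g` is
constant to first order at `y`. -/
structure IsOsculating (g : E → E →ₗ[ℝ] E →ₗ[ℝ] ℝ) (U : Set E) (y : E) (T : E → E) : Prop where
  contDiffAt : ContDiffAt ℂ 2 T y
  map_eq : T y = y
  fderiv_eq : fderiv ℂ T y = ContinuousLinearMap.id ℂ E
  eventually_mem : ∀ᶠ z in nhds y, T z ∈ U
  eventually_bijective : ∀ᶠ z in nhds y, Function.Bijective (fderiv ℂ T z).toLinearMap
  stationary : ∀ u v, (fun z => (pullMetric (g (T z)) (fderiv ℂ T z).toLinearMap u v : ℂ)) ∈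
    stationaryAlg y

theorem exists_isOsculating {g : E → E →ₗ[ℝ] E →ₗ[ℝ] ℝ} {U : Set E} {y : E} (hU : IsOpen U)
    (hy : y ∈ U) (hpos : ∀ z ∈ U, IsHermitianForm (g z))
    (hd : ∀ u v, DifferentiableAt ℝ (fun z => g z u v) y)
    (hK : localDel (fun z => fundamentalForm (g z)) y +
      localDelBar (fun z => fundamentalForm (g z)) y = 0) :
    ∃ T, IsOsculating g U y T := by
  have hev : ∀ᶠ z in nhds y, IsHermitianForm (g z) :=
    Filter.mem_of_superset (hU.mem_nhds hy) hpos
  let D : E → E → E →L[ℝ] ℝ := fun u v => fderiv ℝ (fun z => g z u v) y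
  have hD : ∀ u v, D u v = fderiv ℝ (fun z => g z u v) y := fun u v => rfl
  have hadd1 : ∀ u u' v, D (u + u') v = D u v + D u' v := fun u u' v => by
    rw [hD, hD, hD, ← fderiv_fun_add (hd _ _) (hd _ _)]
    simp only [map_add, LinearMap.add_apply]
  have hsmul1 : ∀ (c : ℝ) u v, D (c • u) v = c • D u v := fun c u v => by
    rw [hD, hD, ← fderiv_fun_const_smul (hd _ _)]
    simp only [map_smul, LinearMap.smul_apply]
  have hsymm : ∀ u v, D u v = D v u := fun u v =>
    Filter.EventuallyEq.fderiv_eq (hev.mono fun z hz => hz.symm u v)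
  have hadd2 : ∀ u v v', D u (v + v') = D u v + D u v' := fun u v v' => by
    rw [hsymm, hadd1, hsymm v, hsymm v']
  have hsmul2 : ∀ (c : ℝ) u v, D u (c • v) = c • D u v := fun c u v => by
    rw [hsymm, hsmul1, hsymm v]
  let a : E →ₗ[ℝ] E →ₗ[ℝ] E →ₗ[ℝ] ℝ := LinearMap.mk₂ ℝ
    (fun w u =>
      { toFun := fun v => D u v w
        map_add' := fun v v' => by rw [hadd2]; rfl
        map_smul' := fun c v => by rw [hsmul2]; rfl })
    (fun w w' u => LinearMap.ext fun v => map_add (D u v) w w')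
    (fun c w u => LinearMap.ext fun v => map_smul (D u v) c w)
    (fun w u u' => LinearMap.ext fun v => congrArg (fun l : E →L[ℝ] ℝ => l w) (hadd1 u u' v))
    (fun c w u => LinearMap.ext fun v => congrArg (fun l : E →L[ℝ] ℝ => l w) (hsmul1 c u v))
  have ha : ∀ w u v, a w u v = D u v w := fun w u v => rfl
  obtain ⟨B, hBsymm, hB⟩ := exists_quadratic_correction (hpos y hy) a
    (fun w u v => by rw [ha, ha, hsymm])
    (fun w u v => by
      rw [ha, ha, hD, hD]
      exact congrArg (fun l : E →L[ℝ] ℝ => l w)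
        (Filter.EventuallyEq.fderiv_eq (hev.mono fun z hz => hz.inner_J u v)))
    (fun u v w => closed_fundamentalForm hev hd hK u v w)
  let Bc : E →L[ℂ] E →L[ℂ] E := LinearMap.toContinuousLinearMap
    ((LinearMap.toContinuousLinearMap : (E →ₗ[ℂ] E) ≃ₗ[ℂ] (E →L[ℂ] E)).toLinearMap ∘ₗ B)
  have hBc : ∀ u v, Bc u v = B u v := fun u v => rfl
  -- By symmetry of B, the factor 1/2 makes the derivative at z equal to id + B(z - y, ·).
  let T : E → E := fun z => z + (1 / 2 : ℂ) • Bc (z - y) (z - y)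
  have hT' : ∀ z, HasFDerivAt T (ContinuousLinearMap.id ℂ E + Bc (z - y)) z := fun z => by
    have h1 : HasFDerivAt (fun z => z - y) (ContinuousLinearMap.id ℂ E) z :=
      (hasFDerivAt_id z).sub_const y
    have h2 := Bc.hasFDerivAt_of_bilinear h1 h1
    refine ((hasFDerivAt_id z).add (h2.const_smul (1 / 2 : ℂ))).congr_fderiv ?_
    ext w
    change w + (1 / 2 : ℂ) • (B (z - y) w + B w (z - y)) = w + B (z - y) w
    rw [hBsymm w, ← two_smul ℂ, smul_smul]
    simp
  have hfd : ∀ z, fderiv ℂ T z = ContinuousLinearMap.id ℂ E + Bc (z - y) := fun z => (hT' z).fderiv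
  have hTy : T y = y := by simp [T]
  have hfy : fderiv ℂ T y = ContinuousLinearMap.id ℂ E := by rw [hfd]; simp
  have hcont : Continuous (fun z => fderiv ℂ T z) := by
    simp only [hfd]
    fun_prop
  have hTc : ContDiff ℂ 2 T := by
    have h1 : ContDiff ℂ 2 (fun z : E => z - y) := contDiff_id.sub contDiff_const
    exact contDiff_id.add (((Bc.contDiff.comp h1).clm_apply h1).const_smul (1 / 2 : ℂ))
  have hTcont : Continuous T := hTc.continuous
  refine ⟨T, hTc.contDiffAt, hTy, hfy, ?_, ?_, fun u v => ?_⟩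
  · exact hTcont.continuousAt.eventually_mem (hU.mem_nhds (by rwa [hTy]))
  · have : CompleteSpace E := FiniteDimensional.complete ℂ E
    -- Invertible operators form an open set, and the derivative of T at y is the identity.
    have h1 : Set.range ((↑) : (E ≃L[ℂ] E) → E →L[ℂ] E) ∈ nhds (fderiv ℂ T y) := by
      rw [hfy]
      exact ContinuousLinearEquiv.nhds (ContinuousLinearEquiv.refl ℂ E)
    filter_upwards [hcont.continuousAt.eventually_mem h1] with z hz
    obtain ⟨e, he⟩ := hz
    rw [← he]
    exact e.bijective
  · have hTR : HasFDerivAt T (ContinuousLinearMap.id ℝ E) y := by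
      have := (hT' y).restrictScalars ℝ
      refine this.congr_fderiv ?_
      ext w
      simp
    have hm : ∀ u v, HasFDerivAt (fun z => g (T z) u v) (D u v) y := fun u v => by
      have h1 : HasFDerivAt (fun z => g z u v) (D u v) (T y) := by
        rw [hTy]; exact (hd u v).hasFDerivAt
      exact h1.comp y hTR
    have hp : ∀ u, HasFDerivAt (fun z => fderiv ℂ T z u)
        (((ContinuousLinearMap.apply ℂ E u) ∘L Bc).restrictScalars ℝ) y := fun u => by
      have h1 : HasFDerivAt (fun z => (ContinuousLinearMap.apply ℂ E u) (Bc (z - y)))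
          ((ContinuousLinearMap.apply ℂ E u) ∘L Bc) y := by
        have h2 : HasFDerivAt (fun z => Bc (z - y)) Bc y := by
          have h3 : HasFDerivAt (fun z => z - y) (ContinuousLinearMap.id ℂ E) y :=
            (hasFDerivAt_id y).sub_const y
          exact Bc.hasFDerivAt.comp y h3
        exact (ContinuousLinearMap.apply ℂ E u).hasFDerivAt.comp y h2
      have h2 : (fun z => fderiv ℂ T z u) =
          fun z => u + (ContinuousLinearMap.apply ℂ E u) (Bc (z - y)) := by
        funext z; rw [hfd]; rfl
      rw [h2]
      exact (h1.restrictScalars ℝ).const_add u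
    -- The product rule gives the three terms a_w(u,v) + g(B_w u, v) + g(u, B_w v), which B was
    -- chosen to annihilate.
    have h0 := hasFDerivAt_bilin_apply hm (hp u) (hp v) fun w => by
      rw [hfy, hTy]
      have := hB w u v
      rw [ha] at this
      exact this
    have h1 := Complex.ofRealCLM.hasFDerivAt.comp y h0
    rw [ContinuousLinearMap.comp_zero] at h1
    exact h1

theorem IsOsculating.regular_pullAlong {g : E → E →ₗ[ℝ] E →ₗ[ℝ] ℝ} {U : Set E} {y : E}
    {T : E → E} (hT : IsOsculating g U y T) {α : E → CForm E} (hα : Regular (diffAlg y) α) :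
    Regular (diffAlg y) (pullAlong T α) := by
  have hTR : DifferentiableAt ℝ T y :=
    (hT.contDiffAt.differentiableAt (by norm_num)).restrictScalars ℝ
  exact (Regular.pullForm_fderiv hT.contDiffAt).apply
    (Regular.comp_diff hTR (by rw [hT.map_eq]; exact hα))

/-- Pulling back by T does not change ∂̄ at y. Naturality replaces K(g) by K of the pulled-back
metric, which is stationary at y, so the derivatives fall only on the form. Used for K equal to
star, C and the identity. -/
theorem IsOsculating.localDelBar_apply {g : E → E →ₗ[ℝ] E →ₗ[ℝ] ℝ} {U : Set E} {y : E}
    {T : E → E} (hT : IsOsculating g U y T) (hpos : ∀ z ∈ U, IsHermitianForm (g z))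
    (K : (E →ₗ[ℝ] E →ₗ[ℝ] ℝ) → CForm E →ₗ[ℂ] CForm E)
    (hnat : ∀ h (A : E →ₗ[ℂ] E), IsHermitianForm h → Function.Bijective A → ∀ x,
      pullForm A (K h x) = K (pullMetric h A) (pullForm A x))
    (hstat : Regular (stationaryAlg y)
      (fun z => K (pullMetric (g (T z)) (fderiv ℂ T z).toLinearMap)))
    {α : E → CForm E} (hα : Regular (diffAlg y) α)
    (hKα : Regular (diffAlg y) (fun z => K (g z) (α z))) :
    localDelBar (fun z => K (g z) (α z)) y =
      ∑ j, dzBar E j * K (g y) (wirtingerBar (pullAlong T α) y j) := by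
  have h1 := localDelBar_pullAlong (α := fun z => K (g z) (α z)) hT.contDiffAt
    (by rw [hT.map_eq]; exact hKα)
  have hid : ∀ x : CForm E, pullForm (fderiv ℂ T y).toLinearMap x = x := fun x => by
    rw [hT.fderiv_eq]; exact pullForm_id x
  have hpα := hT.regular_pullAlong hα
  rw [hid, hT.map_eq] at h1
  rw [← h1]
  have h2 : pullAlong T (fun z => K (g z) (α z)) =ᶠ[nhds y] fun z =>
      K (pullMetric (g (T z)) (fderiv ℂ T z).toLinearMap) (pullAlong T α z) := by
    filter_upwards [hT.eventually_mem, hT.eventually_bijective] with z hz hb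
    exact hnat _ _ (hpos _ hz) hb _
  rw [localDelBar_congr h2, localDelBar]
  refine Finset.sum_congr rfl fun j _ => ?_
  rw [wirtingerBar_apply_of_stationary hstat hpα, hT.map_eq, hT.fderiv_eq]
  rfl

omit [Module.Finite ℂ E] in
theorem IsOsculating.isHermitianForm {g : E → E →ₗ[ℝ] E →ₗ[ℝ] ℝ} {U : Set E} {y : E}
    {T : E → E} (hT : IsOsculating g U y T) (hy : y ∈ U) (hpos : ∀ z ∈ U, IsHermitianForm (g z)) :
    ∀ z ∈ ({y} : Set E), IsHermitianForm (pullMetric (g (T z)) (fderiv ℂ T z).toLinearMap) := by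
  rintro z rfl
  rw [hT.map_eq, hT.fderiv_eq]
  exact hpos _ hy

omit [Module.Finite ℂ E] in
theorem IsOsculating.pullAlong_apply {g : E → E →ₗ[ℝ] E →ₗ[ℝ] ℝ} {U : Set E} {y : E}
    {T : E → E} (hT : IsOsculating g U y T) (α : E → CForm E) : pullAlong T α y = α y := by
  rw [pullAlong, hT.fderiv_eq, hT.map_eq]
  exact pullForm_id _

/-- The covector `dz̄_j`. -/
def dzBarCov (E : Type*) [NormedAddCommGroup E] [NormedSpace ℂ E] [Module.Finite ℂ E]
    (j : Fin (Module.finrank ℂ E)) : E →ₗ[ℝ] ℂ :=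
  Complex.conjAe.toLinearMap ∘ₗ ((Module.finBasis ℂ E).coord j).restrictScalars ℝ

theorem dzBar_eq (j : Fin (Module.finrank ℂ E)) : dzBar E j = oneForm (dzBarCov E j) := rfl

variable {g : E → E →ₗ[ℝ] E →ₗ[ℝ] ℝ} {U : Set E} {y : E} {T : E → E}

/-- `∂̄` conjugated by the Hodge star, in osculating coordinates. -/
theorem IsOsculating.hodge_localDelBar_hodge (hT : IsOsculating g U y T) (hU : IsOpen U)
    (hy : y ∈ U) (hpos : ∀ z ∈ U, IsHermitianForm (g z))
    (hg : ∀ u v, (fun z => (g z u v : ℂ)) ∈ smoothAlg U)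
    {α : E → CForm E} (hα : Regular (smoothAlg U) α) :
    hodgeStarLin (g y) (localDelBar (fun z => hodgeStarLin (g z) (α z)) y) =
      ∑ j, sharpProd (g y) (dzBarCov E j) (wirtingerBar (pullAlong T α) y j) := by
  have hs := (Regular.hodgeStarLin (invClosed_smoothAlg U) hg hpos).apply hα
  rw [hT.localDelBar_apply hpos hodgeStarLin
    (fun h A hh hA x => pullForm_hodgeStarLin hh hA (fun _ _ => rfl) x)
    (Regular.hodgeStarLin (invClosed_stationaryAlg y) hT.stationary (hT.isHermitianForm hy hpos))
    (hα.diff_of_smooth hU hy) (hs.diff_of_smooth hU hy), map_sum]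
  exact Finset.sum_congr rfl fun j _ =>
    (hpos y hy).hodgeStarLin_oneForm_mul_hodgeStarLin _ _

/-- The Kähler identity relating `∂*` to the commutator of `∂̄` with contraction by `ω`. -/
theorem IsOsculating.commutator_contractFundamental (hT : IsOsculating g U y T) (hU : IsOpen U)
    (hy : y ∈ U) (hpos : ∀ z ∈ U, IsHermitianForm (g z))
    (hg : ∀ u v, (fun z => (g z u v : ℂ)) ∈ smoothAlg U)
    {α : E → CForm E} (hα : Regular (smoothAlg U) α) :
    hodgeStarLin (g y) (localDelBar (fun z => hodgeStarLin (g z) (α z)) y) =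
      Complex.I • (contractFundamental (g y) (localDelBar α y) -
        localDelBar (fun z => contractFundamental (g z) (α z)) y) := by
  have hs := (Regular.contractFundamental (invClosed_smoothAlg U) hg hpos).apply hα
  have hd := hα.diff_of_smooth hU hy
  -- Taking K to be the identity writes ∂̄α itself in osculating coordinates, so that both sides of
  -- the identity become sums over j that can be compared term by term.
  have h1 := hT.localDelBar_apply hpos (fun _ => LinearMap.id) (fun _ _ _ _ _ => rfl)
    (Regular.const _) hd hd
  simp only [LinearMap.id_apply] at h1
  rw [hT.hodge_localDelBar_hodge hU hy hpos hg hα, hT.localDelBar_apply hpos contractFundamental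
    (fun h A hh hA x => pullForm_contractFundamental hh hA (fun _ _ => rfl) x)
    (Regular.contractFundamental (invClosed_stationaryAlg y) hT.stationary
      (hT.isHermitianForm hy hpos)) hd (hs.diff_of_smooth hU hy), h1, map_sum,
    ← Finset.sum_sub_distrib, Finset.smul_sum]
  refine Finset.sum_congr rfl fun j _ => ?_
  rw [dzBar_eq]
  refine (hpos y hy).sharpProd_eq_commutator (fun v => ?_) _
  simp [dzBarCov]

end KahlerIdentities

/-! ### Charts and their differentials -/

section Charts

variable {E : Type*} [NormedAddCommGroup E] [NormedSpace ℂ E]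
  {X : Type*} [TopologicalSpace X] [ChartedSpace E X]

/-- The transition map from the chart `φ` to the chart `ψ`. -/
def transition (φ ψ : OpenPartialHomeomorph X E) (z : E) : E := ψ (φ.symm z)

variable [IsManifold 𝓘(ℂ, E) ω X] {φ ψ : OpenPartialHomeomorph X E}

theorem chartDeriv_comp_chartSymmDeriv (hφ : φ ∈ atlas E X) {y : E} (hy : y ∈ φ.target) :
    chartDeriv φ (φ.symm y) ∘ₗ chartSymmDeriv φ y = LinearMap.id := by
  have h := (mdifferentiable_of_mem_atlas (I := 𝓘(ℂ, E)) hφ).comp_symm_deriv hy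
  exact congrArg ContinuousLinearMap.toLinearMap h

theorem chartSymmDeriv_bijective (hφ : φ ∈ atlas E X) {y : E} (hy : y ∈ φ.target) :
    Function.Bijective (chartSymmDeriv φ y) :=
  (mdifferentiable_of_mem_atlas (I := 𝓘(ℂ, E)) hφ).symm.mfderiv_bijective hy

theorem chartDeriv_bijective (hφ : φ ∈ atlas E X) {x : X} (hx : x ∈ φ.source) :
    Function.Bijective (chartDeriv φ x) :=
  (mdifferentiable_of_mem_atlas (I := 𝓘(ℂ, E)) hφ).mfderiv_bijective hx

theorem chartSymmDeriv_comp_chartDeriv (hφ : φ ∈ atlas E X) {y : E} (hy : y ∈ φ.target) :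
    chartSymmDeriv φ y ∘ₗ chartDeriv φ (φ.symm y) = LinearMap.id := by
  refine LinearMap.ext fun v => ?_
  obtain ⟨u, rfl⟩ := (chartSymmDeriv_bijective hφ hy).surjective v
  have h := LinearMap.congr_fun (chartDeriv_comp_chartSymmDeriv hφ hy) u
  exact congrArg (chartSymmDeriv φ y) h

theorem contDiffAt_transition (hφ : φ ∈ atlas E X) (hψ : ψ ∈ atlas E X) {y : E}
    (hy : y ∈ φ.target) (hy' : φ.symm y ∈ ψ.source) :
    ContDiffAt ℂ 2 (transition φ ψ) y := by
  have h1 : ContMDiffAt 𝓘(ℂ, E) 𝓘(ℂ, E) 2 ψ (φ.symm y) :=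
    contMDiffAt_of_mem_maximalAtlas (IsManifold.subset_maximalAtlas hψ) hy'
  have h2 : ContMDiffAt 𝓘(ℂ, E) 𝓘(ℂ, E) 2 φ.symm y :=
    contMDiffAt_symm_of_mem_maximalAtlas (IsManifold.subset_maximalAtlas hφ) hy
  exact contMDiffAt_iff_contDiffAt.1 (h1.comp y h2)

theorem fderiv_transition (hφ : φ ∈ atlas E X) (hψ : ψ ∈ atlas E X) {y : E}
    (hy : y ∈ φ.target) (hy' : φ.symm y ∈ ψ.source) :
    (fderiv ℂ (transition φ ψ) y).toLinearMap =
      chartDeriv ψ (φ.symm y) ∘ₗ chartSymmDeriv φ y := by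
  have h1 := (mdifferentiable_of_mem_atlas (I := 𝓘(ℂ, E)) hψ).mdifferentiableAt hy'
  have h2 := (mdifferentiable_of_mem_atlas (I := 𝓘(ℂ, E)) hφ).mdifferentiableAt_symm hy
  have h3 := mfderiv_comp y h1 h2
  rw [← mfderiv_eq_fderiv]
  exact congrArg ContinuousLinearMap.toLinearMap h3

omit [NormedSpace ℂ E] [ChartedSpace E X] [IsManifold 𝓘(ℂ, E) ω X] in
theorem eventually_mem_source {y : E}
    (hy : y ∈ φ.target) (hy' : φ.symm y ∈ ψ.source) :
    ∀ᶠ z in nhds y, z ∈ φ.target ∧ φ.symm z ∈ ψ.source :=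
  (φ.open_target.eventually_mem hy).and
    ((φ.continuousAt_symm hy).eventually_mem (ψ.open_source.mem_nhds hy'))

end Charts

/-! ### Global operators read in charts -/

section FormsInCharts

variable {E : Type*} [NormedAddCommGroup E] [NormedSpace ℂ E] [Module.Finite ℂ E]
  {X : Type*} [TopologicalSpace X] [ChartedSpace E X]
  {φ ψ : OpenPartialHomeomorph X E}

omit [Module.Finite ℂ E] in
theorem Regular.congr_smooth {F : Type*} [AddCommGroup F] [Module ℂ F] {f h : E → F} {s : Set E}
    (hf : Regular (smoothAlg s) f) (hfh : ∀ y ∈ s, h y = f y) : Regular (smoothAlg s) h :=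
  fun l => (mem_smoothAlg.1 (hf l)).congr fun y hy => by rw [hfh y hy]

omit [Module.Finite ℂ E] in
theorem IsSmoothForm.regular {α : RawForm E X} (hα : IsSmoothForm α) (hφ : φ ∈ atlas E X) :
    Regular (smoothAlg φ.target) (inChart φ α) := fun l => hα φ hφ l

omit [Module.Finite ℂ E] in
theorem inChart_mul (φ : OpenPartialHomeomorph X E) (α β : RawForm E X) (y : E) :
    inChart φ (α * β) y = inChart φ α y * inChart φ β y := by
  simp [inChart]

theorem pullForm_injective {V W : Type*} [AddCommGroup V] [Module ℂ V] [AddCommGroup W]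
    [Module ℂ W] {A : V →ₗ[ℂ] W} (hA : Function.Bijective A) :
    Function.Injective (pullForm A) := by
  let e := LinearEquiv.ofBijective A hA
  have h : ∀ x, pullForm e.symm.toLinearMap (pullForm A x) = x := fun x => by
    rw [← pullForm_comp]
    have : A ∘ₗ e.symm.toLinearMap = LinearMap.id :=
      LinearMap.ext fun w => e.apply_symm_apply w
    rw [this, pullForm_id]
  exact Function.LeftInverse.injective h

/-- The expression of a family of bilinear forms on the tangent spaces in a chart. -/
def metricInChart (φ : OpenPartialHomeomorph X E)
    (g : ∀ x : X, TangentSpace 𝓘(ℂ, E) x →ₗ[ℝ] TangentSpace 𝓘(ℂ, E) x →ₗ[ℝ] ℝ) (y : E) :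
    E →ₗ[ℝ] E →ₗ[ℝ] ℝ :=
  pullMetric (g (φ.symm y)) (chartSymmDeriv φ y)

omit [Module.Finite ℂ E] in
theorem HermitianMetric.isHermitianForm (g : HermitianMetric E X) (x : X) :
    IsHermitianForm (g.inner x) := ⟨g.symm x, g.pos x, g.inner_J x⟩

theorem inChart_kahlerForm (g : HermitianMetric E X) (φ : OpenPartialHomeomorph X E) (y : E) :
    inChart φ (kahlerForm g) y = fundamentalForm (metricInChart φ g.inner y) :=
  pullForm_fundamentalForm fun _ _ => rfl

omit [Module.Finite ℂ E] in
theorem HermitianMetric.metricInChart_mem (g : HermitianMetric E X) (hφ : φ ∈ atlas E X)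
    (u v : E) : (fun y => (metricInChart φ g.inner y u v : ℂ)) ∈ smoothAlg φ.target :=
  Complex.ofRealCLM.contDiff.comp_contDiffOn (g.smooth φ hφ u v)

variable [IsManifold 𝓘(ℂ, E) ω X]

omit [Module.Finite ℂ E] in
theorem HermitianMetric.isHermitianForm_inChart (g : HermitianMetric E X) (hφ : φ ∈ atlas E X)
    (y : E) (hy : y ∈ φ.target) : IsHermitianForm (metricInChart φ g.inner y) :=
  (g.isHermitianForm _).of_injective (chartSymmDeriv_bijective hφ hy).injective fun _ _ => rfl

omit [Module.Finite ℂ E] in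
theorem pullForm_chartDeriv_inChart (hφ : φ ∈ atlas E X) (α : RawForm E X) {x : X}
    (hx : x ∈ φ.source) : pullForm (chartDeriv φ x) (inChart φ α (φ x)) = α x := by
  obtain ⟨y, hy, rfl⟩ : ∃ y ∈ φ.target, φ.symm y = x := ⟨φ x, φ.map_source hx, φ.left_inv hx⟩
  rw [φ.right_inv hy, inChart, ← pullForm_comp, chartSymmDeriv_comp_chartDeriv hφ hy, pullForm_id]

omit [Module.Finite ℂ E] in
theorem metricInChart_chartDeriv (hφ : φ ∈ atlas E X)
    (g : ∀ x : X, TangentSpace 𝓘(ℂ, E) x →ₗ[ℝ] TangentSpace 𝓘(ℂ, E) x →ₗ[ℝ] ℝ) {x : X}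
    (hx : x ∈ φ.source) (u v : TangentSpace 𝓘(ℂ, E) x) :
    g x u v = metricInChart φ g (φ x) (chartDeriv φ x u) (chartDeriv φ x v) := by
  obtain ⟨y, hy, rfl⟩ : ∃ y ∈ φ.target, φ.symm y = x := ⟨φ x, φ.map_source hx, φ.left_inv hx⟩
  rw [φ.right_inv hy, metricInChart, pullMetric_apply, ← LinearMap.comp_apply (chartSymmDeriv φ y),
    ← LinearMap.comp_apply (chartSymmDeriv φ y), chartSymmDeriv_comp_chartDeriv hφ hy]
  rfl

omit [Module.Finite ℂ E] in
theorem pullAlong_transition (hφ : φ ∈ atlas E X) (hψ : ψ ∈ atlas E X) (α : RawForm E X) {y : E}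
    (hy : y ∈ φ.target) (hy' : φ.symm y ∈ ψ.source) :
    pullAlong (transition φ ψ) (inChart ψ α) y = inChart φ α y := by
  rw [pullAlong, fderiv_transition hφ hψ hy hy', pullForm_comp, transition,
    pullForm_chartDeriv_inChart hψ α hy']
  rfl

/-- The definition of ∂̄ changes charts from point to point; holomorphy of the transition maps gives
a single expression on the whole target of φ. Without it ∂̄α could not be differentiated again. -/
theorem inChart_delBar {α : RawForm E X} (hα : IsSmoothForm α) (hφ : φ ∈ atlas E X) {y : E}
    (hy : y ∈ φ.target) : inChart φ (delBar α) y = localDelBar (inChart φ α) y := by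
  have hψ : chartAt E (φ.symm y) ∈ atlas E X := chart_mem_atlas E _
  have hy' : φ.symm y ∈ (chartAt E (φ.symm y)).source := mem_chart_source E _
  have h1 := localDelBar_pullAlong (α := inChart (chartAt E (φ.symm y)) α)
    (contDiffAt_transition hφ hψ hy hy')
    ((hα.regular hψ).diff_of_smooth (chartAt E (φ.symm y)).open_target
      ((chartAt E (φ.symm y)).map_source hy'))
  have h2 : pullAlong (transition φ (chartAt E (φ.symm y))) (inChart (chartAt E (φ.symm y)) α)
      =ᶠ[nhds y] inChart φ α :=
    (eventually_mem_source hy hy').mono fun z hz => pullAlong_transition hφ hψ α hz.1 hz.2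
  rw [← localDelBar_congr h2, h1, fderiv_transition hφ hψ hy hy', pullForm_comp]
  rfl

theorem IsSmoothForm.delBar {α : RawForm E X} (hα : IsSmoothForm α) :
    IsSmoothForm (delBar α) := fun φ hφ =>
  ((hα.regular hφ).localDelBar φ.open_target).congr_smooth fun _ hy => inChart_delBar hα hφ hy

/-- Pointwise contraction of forms with the fundamental form. -/
def contractKahler (g : HermitianMetric E X) (α : RawForm E X) : RawForm E X :=
  fun x => contractFundamental (g.inner x) (α x)

theorem inChart_hodge (g : HermitianMetric E X) (α : RawForm E X) (hφ : φ ∈ atlas E X) {y : E}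
    (hy : y ∈ φ.target) :
    inChart φ (hodge g α) y = hodgeStarLin (metricInChart φ g.inner y) (inChart φ α y) :=
  pullForm_hodgeStarLin (g.isHermitianForm _) (chartSymmDeriv_bijective hφ hy) (fun _ _ => rfl) _

theorem inChart_contractKahler (g : HermitianMetric E X) (α : RawForm E X) (hφ : φ ∈ atlas E X)
    {y : E} (hy : y ∈ φ.target) : inChart φ (contractKahler g α) y =
      contractFundamental (metricInChart φ g.inner y) (inChart φ α y) :=
  pullForm_contractFundamental (g.isHermitianForm _) (chartSymmDeriv_bijective hφ hy)
    (fun _ _ => rfl) _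

theorem IsSmoothForm.hodge (g : HermitianMetric E X) {α : RawForm E X} (hα : IsSmoothForm α) :
    IsSmoothForm (hodge g α) := fun _ hφ =>
  ((Regular.hodgeStarLin (invClosed_smoothAlg _) (g.metricInChart_mem hφ)
    (g.isHermitianForm_inChart hφ)).apply (hα.regular hφ)).congr_smooth
      fun _ hy => inChart_hodge g α hφ hy

theorem IsSmoothForm.contractKahler (g : HermitianMetric E X) {α : RawForm E X}
    (hα : IsSmoothForm α) : IsSmoothForm (contractKahler g α) := fun _ hφ =>
  ((Regular.contractFundamental (invClosed_smoothAlg _) (g.metricInChart_mem hφ)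
    (g.isHermitianForm_inChart hφ)).apply (hα.regular hφ)).congr_smooth
      fun _ hy => inChart_contractKahler g α hφ hy

theorem delBar_delBar {α : RawForm E X} (hα : IsSmoothForm α) : delBar (delBar α) = 0 := by
  funext x
  have hφ := chart_mem_atlas E x
  have hx := (chartAt E x).map_source (mem_chart_source E x)
  have h1 : inChart (chartAt E x) (delBar α) =ᶠ[nhds (chartAt E x x)]
      localDelBar (inChart (chartAt E x) α) :=
    ((chartAt E x).open_target.eventually_mem hx).mono fun z hz => inChart_delBar hα hφ hz
  rw [delBar, localDelBar_congr h1,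
    localDelBar_localDelBar (chartAt E x).open_target (hα.regular hφ) hx, map_zero]
  rfl

theorem hodge_delBar_hodge_apply (g : HermitianMetric E X) (α : RawForm E X) (x : X) :
    hodge g (delBar (hodge g α)) x = pullForm (chartDeriv (chartAt E x) x)
      (hodgeStarLin (metricInChart (chartAt E x) g.inner (chartAt E x x))
        (localDelBar (fun z => hodgeStarLin (metricInChart (chartAt E x) g.inner z)
          (inChart (chartAt E x) α z)) (chartAt E x x))) := by
  have hφ := chart_mem_atlas E x
  have hs := mem_chart_source E x
  have hx := (chartAt E x).map_source hs
  have h1 : inChart (chartAt E x) (hodge g α) =ᶠ[nhds (chartAt E x x)]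
      fun z => hodgeStarLin (metricInChart (chartAt E x) g.inner z) (inChart (chartAt E x) α z) :=
    ((chartAt E x).open_target.eventually_mem hx).mono fun z hz => inChart_hodge g α hφ hz
  rw [pullForm_hodgeStarLin (g.isHermitianForm_inChart hφ _ hx) (chartDeriv_bijective hφ hs)
    (metricInChart_chartDeriv hφ g.inner hs), ← localDelBar_congr h1]
  rfl

theorem IsKahler.exists_isOsculating {g : HermitianMetric E X} (hg : IsKahler g) (x : X) :
    ∃ T, IsOsculating (metricInChart (chartAt E x) g.inner) (chartAt E x).target
      (chartAt E x x) T := by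
  have hφ := chart_mem_atlas E x
  have hs := mem_chart_source E x
  have hx := (chartAt E x).map_source hs
  refine _root_.exists_isOsculating (chartAt E x).open_target hx (g.isHermitianForm_inChart hφ)
    (fun u v => ((g.smooth _ hφ u v).contDiffAt
      ((chartAt E x).open_target.mem_nhds hx)).differentiableAt (by simp)) ?_
  have h1 := congrFun hg x
  have h2 : inChart (chartAt E x) (kahlerForm g) =
      fun z => fundamentalForm (metricInChart (chartAt E x) g.inner z) :=
    funext fun z => inChart_kahlerForm g _ z
  rw [← h2]
  -- The Kähler condition is needed only at the centre x of its own preferred chart, so chart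
  -- independence of ∂ never enters.
  refine pullForm_injective (chartDeriv_bijective hφ hs) ?_
  rw [map_add, map_zero]
  exact h1

/-- The Kähler identity `∂* = -i [C, ∂̄]`, where `C` is the contraction with `ω`. -/
theorem IsKahler.delStar_eq {g : HermitianMetric E X} (hg : IsKahler g) {α : RawForm E X}
    (hα : IsSmoothForm α) : delStar g α =
      -(Complex.I • (contractKahler g (delBar α) - delBar (contractKahler g α))) := by
  funext x
  have hφ := chart_mem_atlas E x
  have hs := mem_chart_source E x
  have hx := (chartAt E x).map_source hs
  obtain ⟨T, hT⟩ := hg.exists_isOsculating x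
  have h1 := hT.commutator_contractFundamental (chartAt E x).open_target hx
    (g.isHermitianForm_inChart hφ) (g.metricInChart_mem hφ) (hα.regular hφ)
  have h2 : inChart (chartAt E x) (contractKahler g α) =ᶠ[nhds (chartAt E x x)]
      fun z => contractFundamental (metricInChart (chartAt E x) g.inner z)
        (inChart (chartAt E x) α z) :=
    ((chartAt E x).open_target.eventually_mem hx).mono fun z hz =>
      inChart_contractKahler g α hφ hz
  have h3 : delStar g α x = -(hodge g (delBar (hodge g α)) x) := rfl
  rw [h3, hodge_delBar_hodge_apply, h1, map_smul, map_sub,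
    pullForm_contractFundamental (g.isHermitianForm_inChart hφ _ hx) (chartDeriv_bijective hφ hs)
    (metricInChart_chartDeriv hφ g.inner hs), ← localDelBar_congr h2]
  rfl

end FormsInCharts

/-! ### The derivation property of the bracket -/

section Bracket

variable {E : Type*} [NormedAddCommGroup E] [NormedSpace ℂ E] [Module.Finite ℂ E]

/-- A sum of compositions of contractions and first order derivations is a second order operator:
its deviation from being a derivation is `∑ ± w_j α ∧ κ_j β + κ_j α ∧ w_j β`. -/
theorem sum_sharpProd_wirtingerBar_mul {h : E →ₗ[ℝ] E →ₗ[ℝ] ℝ} {y : E} {a b : E → CForm E}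
    (ha : Regular (diffAlg y) a) (hb : Regular (diffAlg y) b) :
    ∑ j, sharpProd h (dzBarCov E j) (wirtingerBar (fun z => a z * b z) y j) =
      (∑ j, sharpProd h (dzBarCov E j) (wirtingerBar a y j)) * b y +
        signForm (a y) * (∑ j, sharpProd h (dzBarCov E j) (wirtingerBar b y j)) +
        ∑ j, (signForm (wirtingerBar a y j) * sharpProd h (dzBarCov E j) (b y) +
          sharpProd h (dzBarCov E j) (a y) * wirtingerBar b y j) := by
  rw [Finset.sum_mul, Finset.mul_sum, ← Finset.sum_add_distrib, ← Finset.sum_add_distrib]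
  refine Finset.sum_congr rfl fun j _ => ?_
  rw [wirtingerBar_mul ha hb, map_add, sharpProd_mul, sharpProd_mul]
  abel

theorem neg_one_pow_val_add (i j : ZMod 2) :
    (-1 : ℂ) ^ (i + j).val = (-1 : ℂ) ^ i.val * (-1 : ℂ) ^ j.val := by
  rw [ZMod.val_add, ← pow_add, neg_one_pow_eq_pow_mod_two (n := i.val + j.val)]

theorem sharpProd_mem_formParity {V : Type*} [AddCommGroup V] [Module ℂ V] [Module.Finite ℂ V]
    (h : V →ₗ[ℝ] V →ₗ[ℝ] ℝ) (ξ : V →ₗ[ℝ] ℂ) {i : ZMod 2} {x : CForm V}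
    (hx : x ∈ formParity V i) : sharpProd h ξ x ∈ formParity V (i + 1) := by
  rw [mem_formParity_iff] at hx ⊢
  rw [sharpProd, signForm_interiorProd, hx, map_smul, neg_one_pow_val_add, ZMod.val_one]
  simp

theorem wirtingerBar_mem_formParity {a : E → CForm E} {y : E} (ha : Regular (diffAlg y) a)
    {i : ZMod 2} (hi : ∀ z, a z ∈ formParity E i) (j : Fin (Module.finrank ℂ E)) :
    wirtingerBar a y j ∈ formParity E i := by
  have h1 := wirtingerBar_map ha signForm.toLinearMap j
  have h2 := wirtingerBar_map ha ((-1 : ℂ) ^ i.val • LinearMap.id) j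
  simp only [AlgHom.toLinearMap_apply, LinearMap.smul_apply, LinearMap.id_apply] at h1 h2
  have h3 : (fun z => signForm (a z)) = fun z => (-1 : ℂ) ^ i.val • a z :=
    funext fun z => (mem_formParity_iff i _).1 (hi z)
  rw [h3, h2] at h1
  exact (mem_formParity_iff i _).2 h1.symm

/-- The odd Poisson rule for the bracket of a second order operator at a point. -/
theorem bracket_mul_at {h : E →ₗ[ℝ] E →ₗ[ℝ] ℝ} {y : E} {a b c : E → CForm E}
    (ha : Regular (diffAlg y) a) (hb : Regular (diffAlg y) b) (hc : Regular (diffAlg y) c)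
    {i j : ZMod 2} (hi : ∀ z, a z ∈ formParity E i) (hj : ∀ z, b z ∈ formParity E j)
    {Δ : (E → CForm E) → CForm E}
    (hΔ : ∀ a, Regular (diffAlg y) a →
      Δ a = -∑ k, sharpProd h (dzBarCov E k) (wirtingerBar a y k)) :
    (-1 : ℂ) ^ i.val • (Δ (fun z => a z * (b z * c z)) - Δ a * (b y * c y) -
        (-1 : ℂ) ^ i.val • (a y * Δ (fun z => b z * c z))) =
      ((-1 : ℂ) ^ i.val • (Δ (fun z => a z * b z) - Δ a * b y -
        (-1 : ℂ) ^ i.val • (a y * Δ b))) * c y +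
      (-1 : ℂ) ^ ((i + 1) * j).val • (b y * ((-1 : ℂ) ^ i.val •
        (Δ (fun z => a z * c z) - Δ a * c y - (-1 : ℂ) ^ i.val • (a y * Δ c)))) := by
  -- In the bracket the terms carrying Δa and Δf cancel; what remains is of first order in f.
  have hbr : ∀ f, Regular (diffAlg y) f →
      Δ (fun z => a z * f z) - Δ a * f y - (-1 : ℂ) ^ i.val • (a y * Δ f) =
      -∑ k, (signForm (wirtingerBar a y k) * sharpProd h (dzBarCov E k) (f y) +
          sharpProd h (dzBarCov E k) (a y) * wirtingerBar f y k) := fun f hf => by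
    rw [hΔ _ (ha.mul hf), hΔ _ ha, hΔ _ hf, sum_sharpProd_wirtingerBar_mul ha hf,
      (mem_formParity_iff i _).1 (hi y)]
    simp only [smul_mul_assoc, mul_neg, neg_mul, smul_neg]
    abel
  rw [hbr _ (hb.mul hc), hbr _ hb, hbr _ hc, smul_mul_assoc, mul_smul_comm, smul_comm _ (_ ^ i.val),
    ← smul_add]
  congr 1
  rw [neg_mul, mul_neg, smul_neg, ← neg_add, Finset.sum_mul, Finset.mul_sum, Finset.smul_sum,
    ← Finset.sum_add_distrib]
  congr 1
  refine Finset.sum_congr rfl fun k _ => ?_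
  have hw := wirtingerBar_mem_formParity ha hi k
  -- Moving a past b costs (-1)^(ij), and the contraction passing b costs a further (-1)^j; together
  -- these give the exponent (i+1)j.
  have h1 : signForm (wirtingerBar a y k) * signForm (b y) =
      (-1 : ℂ) ^ ((i + 1) * j).val • (b y * signForm (wirtingerBar a y k)) := by
    rw [(mem_formParity_iff i _).1 hw, (mem_formParity_iff j _).1 (hj y), smul_mul_smul_comm,
      formParity_supercomm hw (hj y), mul_smul_comm, smul_smul, smul_smul, add_mul, one_mul,
      neg_one_pow_val_add]
    congr 1
    ring
  have h2 := formParity_supercomm (sharpProd_mem_formParity h (dzBarCov E k) (hi y)) (hj y)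
  rw [wirtingerBar_mul hb hc, sharpProd_mul, mul_add, mul_add, ← mul_assoc (signForm _) (signForm _),
    h1, ← mul_assoc (sharpProd _ _ (a y)) (b y), h2]
  simp only [smul_mul_assoc, mul_add, add_mul, smul_add, mul_assoc]
  abel

variable {X : Type*} [TopologicalSpace X] [ChartedSpace E X]

omit [Module.Finite ℂ E] in
theorem inChart_mem_formParity (φ : OpenPartialHomeomorph X E) {a : RawForm E X} {i : ZMod 2}
    (ha : ∀ x, a x ∈ formParity (TangentSpace 𝓘(ℂ, E) x) i) (z : E) :
    inChart φ a z ∈ formParity E i := by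
  rw [mem_formParity_iff, inChart]
  have h := (mem_formParity_iff i _).1 (ha (φ.symm z))
  rw [signForm_pullForm, h, map_smul]

variable [IsManifold 𝓘(ℂ, E) ω X]

/-- The identity is pointwise, so at each x everything is transported to osculating coordinates,
where ∂* is the explicit second order sum treated in `bracket_mul_at`. -/
theorem IsKahler.bvBracket_mul {g : HermitianMetric E X} (hg : IsKahler g) {i j : ZMod 2}
    {a b c : RawForm E X} (ha : IsSmoothForm a) (hb : IsSmoothForm b) (hc : IsSmoothForm c)
    (hi : ∀ x, a x ∈ formParity (TangentSpace 𝓘(ℂ, E) x) i)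
    (hj : ∀ x, b x ∈ formParity (TangentSpace 𝓘(ℂ, E) x) j) :
    bvBracket ℂ (delStar g) i a (b * c) =
      bvBracket ℂ (delStar g) i a b * c +
        (-1 : ℂ) ^ ((i + 1) * j).val • (b * bvBracket ℂ (delStar g) i a c) := by
  funext x
  have hφ := chart_mem_atlas E x
  have hs := mem_chart_source E x
  have hx := (chartAt E x).map_source hs
  obtain ⟨T, hT⟩ := hg.exists_isOsculating x
  let gφ := metricInChart (chartAt E x) g.inner
  let y := chartAt E x x
  let Δ : (E → CForm E) → CForm E := fun α =>
    -hodgeStarLin (gφ y) (localDelBar (fun z => hodgeStarLin (gφ z) (α z)) y)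
  have hΔ : ∀ α : RawForm E X,
      delStar g α x = pullForm (chartDeriv (chartAt E x) x) (Δ (inChart (chartAt E x) α)) :=
    fun α => by
      have h1 : delStar g α x = -(hodge g (delBar (hodge g α)) x) := rfl
      rw [h1, hodge_delBar_hodge_apply, map_neg]
  have hv : ∀ α : RawForm E X,
      α x = pullForm (chartDeriv (chartAt E x) x) (inChart (chartAt E x) α y) := fun α =>
    (pullForm_chartDeriv_inChart hφ α hs).symm
  have hΔ' : ∀ α : RawForm E X, IsSmoothForm α → Δ (inChart (chartAt E x) α) =
      -∑ k, sharpProd (gφ y) (dzBarCov E k)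
        (wirtingerBar (pullAlong T (inChart (chartAt E x) α)) y k) := fun α hα =>
    congrArg Neg.neg (hT.hodge_localDelBar_hodge (chartAt E x).open_target hx
      (g.isHermitianForm_inChart hφ) (g.metricInChart_mem hφ) (hα.regular hφ))
  have hreg : ∀ {α : RawForm E X}, IsSmoothForm α →
      Regular (diffAlg y) (pullAlong T (inChart (chartAt E x) α)) := fun hα =>
    hT.regular_pullAlong ((hα.regular hφ).diff_of_smooth (chartAt E x).open_target hx)
  have hpar : ∀ {α : RawForm E X} {k : ZMod 2},
      (∀ x, α x ∈ formParity (TangentSpace 𝓘(ℂ, E) x) k) →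
      ∀ z, pullAlong T (inChart (chartAt E x) α) z ∈ formParity E k := fun hα z => by
    rw [mem_formParity_iff, pullAlong, signForm_pullForm,
      (mem_formParity_iff _ _).1 (inChart_mem_formParity _ hα _), map_smul]
  have hmul : ∀ α β : RawForm E X, pullAlong T (inChart (chartAt E x) (α * β)) =
      fun z => pullAlong T (inChart (chartAt E x) α) z *
        pullAlong T (inChart (chartAt E x) β) z := fun α β => by
    funext z
    rw [pullAlong, inChart_mul, map_mul]
    rfl
  have hval : ∀ α : RawForm E X, inChart (chartAt E x) α y =
      pullAlong T (inChart (chartAt E x) α) y := fun α => (hT.pullAlong_apply _).symm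
  have key := bracket_mul_at (hreg ha) (hreg hb) (hreg hc) (hpar hi) (hpar hj)
    (Δ := fun α => -∑ k, sharpProd (gφ y) (dzBarCov E k) (wirtingerBar α y k))
    (fun _ _ => rfl)
  simp only [bvBracket, Pi.add_apply, Pi.mul_apply, Pi.smul_apply, Pi.sub_apply, hΔ]
  rw [hv a, hv b, hv c]
  simp only [← map_mul, ← map_sub, ← map_smul, ← map_add]
  congr 1
  rw [hΔ' _ (ha.mul (hb.mul hc)), hΔ' _ ha, hΔ' _ (hb.mul hc), hΔ' _ (ha.mul hb), hΔ' _ hb,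
    hΔ' _ (ha.mul hc), hΔ' _ hc, hmul a, hmul b, hmul a, hmul a, hval, hval, hval]
  exact key

end Bracket

/-! ### The algebra of smooth forms and the remaining axioms -/

section GlobalForms

variable {E : Type*} [NormedAddCommGroup E] [NormedSpace ℂ E] [Module.Finite ℂ E]
  {X : Type*} [TopologicalSpace X] [ChartedSpace E X]

/-- The grading involution on forms. -/
def signRaw (α : RawForm E X) : RawForm E X := fun x => signForm (α x)

omit [Module.Finite ℂ E] in
theorem inChart_signRaw (φ : OpenPartialHomeomorph X E) (α : RawForm E X) (y : E) :
    inChart φ (signRaw α) y = signForm (inChart φ α y) :=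
  (signForm_pullForm _ _).symm

omit [Module.Finite ℂ E] in
theorem IsSmoothForm.signRaw {α : RawForm E X} (hα : IsSmoothForm α) :
    IsSmoothForm (signRaw α) := fun φ hφ =>
  ((hα.regular hφ).map signForm.toLinearMap).congr_smooth fun y _ => inChart_signRaw φ α y

omit [Module.Finite ℂ E] in
theorem forall_mem_formParity_iff {α : RawForm E X} {i : ZMod 2} :
    (∀ x, α x ∈ formParity (TangentSpace 𝓘(ℂ, E) x) i) ↔
      signRaw α = (-1 : ℂ) ^ i.val • α :=
  (forall_congr' fun _ => mem_formParity_iff i _).trans funext_iff.symm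

omit [Module.Finite ℂ E] in
theorem IsSmoothForm.regular_chartAt {α : RawForm E X} (hα : IsSmoothForm α) (x : X) :
    Regular (diffAlg (chartAt E x x)) (inChart (chartAt E x) α) :=
  (hα.regular (chart_mem_atlas E x)).diff_of_smooth (chartAt E x).open_target
    ((chartAt E x).map_source (mem_chart_source E x))

theorem delBar_add {α β : RawForm E X} (hα : IsSmoothForm α) (hβ : IsSmoothForm β) :
    delBar (α + β) = delBar α + delBar β := by
  funext x
  have h : inChart (chartAt E x) (α + β) =
      fun z => inChart (chartAt E x) α z + inChart (chartAt E x) β z :=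
    funext fun _ => map_add (pullForm _) _ _
  rw [delBar, h, localDelBar_add (hα.regular_chartAt x) (hβ.regular_chartAt x), map_add]
  rfl

theorem delBar_smul {α : RawForm E X} (hα : IsSmoothForm α) (c : ℂ) :
    delBar (c • α) = c • delBar α := by
  funext x
  have h : inChart (chartAt E x) (c • α) = fun z => c • inChart (chartAt E x) α z :=
    funext fun _ => map_smul (pullForm _) _ _
  rw [delBar, h, localDelBar_smul (hα.regular_chartAt x), map_smul]
  rfl

theorem delBar_signRaw {α : RawForm E X} (hα : IsSmoothForm α) :
    delBar (signRaw α) = -signRaw (delBar α) := by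
  funext x
  have h : inChart (chartAt E x) (signRaw α) = fun z => signForm (inChart (chartAt E x) α z) :=
    funext fun _ => inChart_signRaw _ _ _
  rw [delBar, h, localDelBar_signForm (hα.regular_chartAt x), map_neg, ← signForm_pullForm]
  rfl

theorem hodge_signRaw (g : HermitianMetric E X) (α : RawForm E X) :
    hodge g (signRaw α) = signRaw (hodge g α) :=
  funext fun _ => (signForm_hodgeStarLin _ _).symm

theorem hodge_hodge (g : HermitianMetric E X) (α : RawForm E X) :
    hodge g (hodge g α) = signRaw α :=
  funext fun x => (g.isHermitianForm x).hodgeStarLin_hodgeStarLin _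

theorem hodge_add (g : HermitianMetric E X) (α β : RawForm E X) :
    hodge g (α + β) = hodge g α + hodge g β :=
  funext fun _ => map_add (hodgeStarLin _) _ _

theorem hodge_smul (g : HermitianMetric E X) (c : ℂ) (α : RawForm E X) :
    hodge g (c • α) = c • hodge g α :=
  funext fun _ => map_smul (hodgeStarLin _) _ _

variable (E X) in
/-- The pointwise grading involution of smooth forms. -/
def signSmooth : SmoothForms E X →ₗ[ℂ] SmoothForms E X where
  toFun α := ⟨signRaw α.1, α.2.signRaw⟩
  map_add' _ _ := Subtype.ext (funext fun _ => map_add signForm _ _)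
  map_smul' _ _ := Subtype.ext (funext fun _ => map_smul signForm _ _)

theorem mem_smoothFormParity_iff {i : ZMod 2} {α : SmoothForms E X} :
    α ∈ smoothFormParity E X i ↔ signSmooth E X α = (-1 : ℂ) ^ i.val • α :=
  (forall_mem_formParity_iff (α := α.1)).trans
    (Subtype.ext_iff (a1 := signSmooth E X α) (a2 := (-1 : ℂ) ^ i.val • α)).symm

theorem signSmooth_signSmooth (α : SmoothForms E X) : signSmooth E X (signSmooth E X α) = α :=
  Subtype.ext (funext fun _ => signForm_signForm _)

theorem signSmooth_mul (α β : SmoothForms E X) :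
    signSmooth E X (α * β) = signSmooth E X α * signSmooth E X β :=
  Subtype.ext (funext fun _ => map_mul signForm _ _)

theorem mul_mem_smoothFormParity {i j : ZMod 2} {α β : SmoothForms E X}
    (hα : α ∈ smoothFormParity E X i) (hβ : β ∈ smoothFormParity E X j) :
    α * β ∈ smoothFormParity E X (i + j) := by
  rw [mem_smoothFormParity_iff] at *
  rw [signSmooth_mul, hα, hβ, smul_mul_smul_comm, neg_one_pow_val_add]

-- The two parities are the ±1 eigenspaces of an involution, so (α ± sα)/2 splits every form.
variable (E X) in
theorem isInternal_smoothFormParity : DirectSum.IsInternal (smoothFormParity E X) := by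
  have huniv : (Set.univ : Set (ZMod 2)) = {0, 1} := by
    ext i; simpa using ZMod.two_eq_zero_or_one i
  rw [DirectSum.isInternal_submodule_iff_isCompl (smoothFormParity E X) zero_ne_one huniv]
  refine ⟨Submodule.disjoint_def.2 fun α h0 h1 => ?_, codisjoint_iff.2 (eq_top_iff.2 fun α _ => ?_)⟩
  · rw [mem_smoothFormParity_iff] at h0 h1
    rw [h0, ZMod.val_zero, ZMod.val_one, pow_zero, pow_one, one_smul, neg_one_smul] at h1
    have h2 : (2 : ℂ) • α = 0 := by
      rw [two_smul]; nth_rw 1 [h1]; exact neg_add_cancel α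
    exact (smul_eq_zero.1 h2).resolve_left two_ne_zero
  · refine Submodule.mem_sup.2 ⟨(1 / 2 : ℂ) • (α + signSmooth E X α), ?_,
      (1 / 2 : ℂ) • (α - signSmooth E X α), ?_, by module⟩
    · rw [mem_smoothFormParity_iff, map_smul, map_add, signSmooth_signSmooth, ZMod.val_zero]
      module
    · rw [mem_smoothFormParity_iff, map_smul, map_sub, signSmooth_signSmooth, ZMod.val_one]
      module

variable [IsManifold 𝓘(ℂ, E) ω X]

theorem delBar_mul {α β : RawForm E X} (hα : IsSmoothForm α) (hβ : IsSmoothForm β) :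
    delBar (α * β) = delBar α * β + signRaw α * delBar β := by
  funext x
  have h : inChart (chartAt E x) (α * β) =
      fun z => inChart (chartAt E x) α z * inChart (chartAt E x) β z :=
    funext fun _ => inChart_mul _ _ _ _
  have hv : ∀ γ : RawForm E X, pullForm (chartDeriv (chartAt E x) x)
      (inChart (chartAt E x) γ (chartAt E x x)) = γ x := fun γ =>
    pullForm_chartDeriv_inChart (chart_mem_atlas E x) γ (mem_chart_source E x)
  rw [delBar, h, localDelBar_mul (hα.regular_chartAt x) (hβ.regular_chartAt x), map_add, map_mul,
    map_mul, ← signForm_pullForm, hv, hv]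
  rfl

variable (E X) in
/-- The operator `∂̄` on smooth forms. -/
def smoothDelBar : SmoothForms E X →ₗ[ℂ] SmoothForms E X where
  toFun α := ⟨delBar α.1, IsSmoothForm.delBar α.2⟩
  map_add' α β := Subtype.ext (delBar_add α.2 β.2)
  map_smul' c α := Subtype.ext (delBar_smul α.2 c)

/-- The Hodge star operator on smooth forms. -/
def smoothHodge (g : HermitianMetric E X) : SmoothForms E X →ₗ[ℂ] SmoothForms E X where
  toFun α := ⟨hodge g α.1, IsSmoothForm.hodge g α.2⟩
  map_add' _ _ := Subtype.ext (hodge_add g _ _)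
  map_smul' _ _ := Subtype.ext (hodge_smul g _ _)

/-- Contraction of smooth forms with the fundamental form. -/
def smoothContractKahler (g : HermitianMetric E X) :
    SmoothForms E X →ₗ[ℂ] SmoothForms E X where
  toFun α := ⟨contractKahler g α.1, IsSmoothForm.contractKahler g α.2⟩
  map_add' _ _ := Subtype.ext (funext fun _ => map_add (contractFundamental _) _ _)
  map_smul' _ _ := Subtype.ext (funext fun _ => map_smul (contractFundamental _) _ _)

/-- The formal adjoint `∂^*` of `∂` on smooth forms. -/
def smoothDelStar (g : HermitianMetric E X) : SmoothForms E X →ₗ[ℂ] SmoothForms E X :=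
  -(smoothHodge g ∘ₗ smoothDelBar E X ∘ₗ smoothHodge g)

theorem coe_smoothDelStar (g : HermitianMetric E X) (α : SmoothForms E X) :
    (smoothDelStar g α : RawForm E X) = delStar g α := rfl

theorem smoothDelBar_smoothDelBar (α : SmoothForms E X) :
    smoothDelBar E X (smoothDelBar E X α) = 0 :=
  Subtype.ext (_root_.delBar_delBar α.2)

theorem smoothDelBar_signSmooth (α : SmoothForms E X) :
    smoothDelBar E X (signSmooth E X α) = -signSmooth E X (smoothDelBar E X α) :=
  Subtype.ext (delBar_signRaw α.2)

theorem smoothHodge_signSmooth (g : HermitianMetric E X) (α : SmoothForms E X) :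
    smoothHodge g (signSmooth E X α) = signSmooth E X (smoothHodge g α) :=
  Subtype.ext (hodge_signRaw g _)

theorem smoothHodge_smoothHodge (g : HermitianMetric E X) (α : SmoothForms E X) :
    smoothHodge g (smoothHodge g α) = signSmooth E X α :=
  Subtype.ext (hodge_hodge g _)

theorem smoothDelStar_apply (g : HermitianMetric E X) (α : SmoothForms E X) :
    smoothDelStar g α = -smoothHodge g (smoothDelBar E X (smoothHodge g α)) := rfl

theorem smoothDelStar_signSmooth (g : HermitianMetric E X) (α : SmoothForms E X) :
    smoothDelStar g (signSmooth E X α) = -signSmooth E X (smoothDelStar g α) := by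
  simp only [smoothDelStar_apply, smoothHodge_signSmooth, smoothDelBar_signSmooth, map_neg]

/-- The two inner stars combine to the grading involution, which anticommutes with ∂̄, leaving
*∂̄∂̄* up to sign. -/
theorem smoothDelStar_smoothDelStar (g : HermitianMetric E X) (α : SmoothForms E X) :
    smoothDelStar g (smoothDelStar g α) = 0 := by
  simp only [smoothDelStar_apply, map_neg, smoothHodge_smoothHodge,
    smoothDelBar_signSmooth, smoothDelBar_smoothDelBar, map_zero, neg_zero]

omit [IsManifold 𝓘(ℂ, E) ω X] in
/-- A linear operator anticommuting with the grading involution is odd. -/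
theorem mem_smoothFormParity_of_signSmooth {D : SmoothForms E X →ₗ[ℂ] SmoothForms E X}
    (hD : ∀ α, D (signSmooth E X α) = -signSmooth E X (D α)) {i : ZMod 2} {α : SmoothForms E X}
    (hα : α ∈ smoothFormParity E X i) : D α ∈ smoothFormParity E X (i + 1) := by
  rw [mem_smoothFormParity_iff] at *
  rw [← neg_neg (signSmooth E X (D α)), ← hD, hα, map_smul, neg_one_pow_val_add, ZMod.val_one,
    pow_one, mul_neg_one, neg_smul]

theorem smoothDelBar_mul {i : ZMod 2} {α : SmoothForms E X} (hα : α ∈ smoothFormParity E X i)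
    (β : SmoothForms E X) : smoothDelBar E X (α * β) =
      smoothDelBar E X α * β + (-1 : ℂ) ^ i.val • (α * smoothDelBar E X β) := by
  have h : smoothDelBar E X (α * β) =
      smoothDelBar E X α * β + signSmooth E X α * smoothDelBar E X β :=
    Subtype.ext (delBar_mul α.2 β.2)
  rw [h, mem_smoothFormParity_iff.1 hα, smul_mul_assoc]

theorem IsKahler.smoothDelStar_eq {g : HermitianMetric E X} (hg : IsKahler g)
    (α : SmoothForms E X) : smoothDelStar g α =
      -(Complex.I • (smoothContractKahler g (smoothDelBar E X α) -
        smoothDelBar E X (smoothContractKahler g α))) :=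
  Subtype.ext (hg.delStar_eq α.2)

/-- Substituting ∂* = -i[C, ∂̄], the terms containing ∂̄² vanish and the two copies of ∂̄C∂̄ cancel.
-/
theorem IsKahler.smoothDelBar_smoothDelStar {g : HermitianMetric E X} (hg : IsKahler g)
    (α : SmoothForms E X) :
    smoothDelBar E X (smoothDelStar g α) + smoothDelStar g (smoothDelBar E X α) = 0 := by
  rw [hg.smoothDelStar_eq, hg.smoothDelStar_eq]
  simp only [map_neg, map_smul, map_sub, smoothDelBar_smoothDelBar, map_zero, sub_zero, zero_sub,
    smul_neg, neg_neg, neg_add_cancel]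

theorem bvBracket_mem_smoothFormParity (g : HermitianMetric E X) {i j : ZMod 2}
    {α β : SmoothForms E X} (hα : α ∈ smoothFormParity E X i) (hβ : β ∈ smoothFormParity E X j) :
    bvBracket ℂ (smoothDelStar g) i α β ∈ smoothFormParity E X ((i + 1) + j) := by
  have hodd : ∀ {k : ZMod 2} {γ : SmoothForms E X}, γ ∈ smoothFormParity E X k →
      smoothDelStar g γ ∈ smoothFormParity E X (k + 1) := fun hγ =>
    mem_smoothFormParity_of_signSmooth (smoothDelStar_signSmooth g) hγ
  refine Submodule.smul_mem _ _ (sub_mem (sub_mem ?_ ?_) (Submodule.smul_mem _ _ ?_))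
  · rw [add_right_comm]
    exact hodd (mul_mem_smoothFormParity hα hβ)
  · exact mul_mem_smoothFormParity (hodd hα) hβ
  · rw [add_assoc, add_comm 1 j]
    exact mul_mem_smoothFormParity hα (hodd hβ)

theorem IsKahler.isDGBVAlgebra {g : HermitianMetric E X} (hg : IsKahler g) :
    IsDGBVAlgebra (smoothFormParity E X) (smoothDelBar E X) (smoothDelStar g) where
  one_mem := mem_smoothFormParity_iff.2 <| by
    rw [ZMod.val_zero, pow_zero, one_smul]
    exact Subtype.ext (funext fun _ => map_one signForm)
  mul_mem _ _ _ ha _ hb := mul_mem_smoothFormParity ha hb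
  isInternal := isInternal_smoothFormParity E X
  supercomm _ _ _ ha _ hb := Subtype.ext (funext fun x => formParity_supercomm (ha x) (hb x))
  δ_odd _ _ ha := mem_smoothFormParity_of_signSmooth smoothDelBar_signSmooth ha
  Δ_odd _ _ ha := mem_smoothFormParity_of_signSmooth (smoothDelStar_signSmooth g) ha
  δ_δ := smoothDelBar_smoothDelBar
  δ_Δ := hg.smoothDelBar_smoothDelStar
  Δ_Δ := smoothDelStar_smoothDelStar g
  δ_mul _ _ ha b := smoothDelBar_mul ha b
  bracket_mem _ _ _ ha _ hb := bvBracket_mem_smoothFormParity g ha hb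
  bracket_mul _ _ a ha b hb c := Subtype.ext (hg.bvBracket_mul a.2 b.2 c.2 ha hb)

end GlobalForms

end

theorem lemma2p1 {E : Type*} [NormedAddCommGroup E] [NormedSpace ℂ E] [Module.Finite ℂ E]
    {X : Type*} [TopologicalSpace X] [ChartedSpace E X] [IsManifold 𝓘(ℂ, E) ω X]
    (g : HermitianMetric E X) (hg : IsKahler g) :
    (∀ i j : ZMod 2, ∀ a b c : RawForm E X,
      IsSmoothForm a → IsSmoothForm b → IsSmoothForm c →
      (∀ x, a x ∈ formParity (TangentSpace 𝓘(ℂ, E) x) i) →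
      (∀ x, b x ∈ formParity (TangentSpace 𝓘(ℂ, E) x) j) →
      bvBracket ℂ (delStar g) i a (b * c) =
        bvBracket ℂ (delStar g) i a b * c +
          (-1 : ℂ) ^ ((i + 1) * j).val • (b * bvBracket ℂ (delStar g) i a c)) ∧
    ∃ δ Δ : SmoothForms E X →ₗ[ℂ] SmoothForms E X,
      (∀ a : SmoothForms E X, (δ a : RawForm E X) = delBar (a : RawForm E X)) ∧
      (∀ a : SmoothForms E X, (Δ a : RawForm E X) = delStar g (a : RawForm E X)) ∧
      IsDGBVAlgebra (smoothFormParity E X) δ Δ :=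
  ⟨fun _ _ _ _ _ ha hb hc hi hj => hg.bvBracket_mul ha hb hc hi hj,
    smoothDelBar E X, smoothDelStar g, fun _ => rfl, coe_smoothDelStar g, hg.isDGBVAlgebra⟩
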